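/- Let $G$ be a finite group and let $H^2(G,U(1))$ be its second group cohomology with coefficients in the trivial $G$-module $U(1)$. **Setting.** A *spin chain* $\mathcal A$ assigns to each $j\in\mathbb Z$ a nonzero finite-dimensional Hilbert space $\mathcal H_j$, with $\sup_j\dim\mathcal H_j<\infty$. We write $\mathcal A$ also for its quasi-local $C^*$-algebra (the $C^*$-inductive limit of the algebras $\bigotimes_{j\in F}\mathrm{End}(\mathcal H_j)$ over finite $F\subset\mathbb Z$) and $\mathcal A_X$ for the $C^*$-subalgebra of observables supported on $X\subseteq\mathbb Z$. Automorphisms are $*$-automorphisms. *Stacking* two chains means forming the chain $\mathcal A\otimes\mathcal A'$ with on-site spaces $\mathcal H_j\otimes\mathcal H_j'$. An *on-site symmetry* is a homomorphism $\beta:G\to\mathrm{Aut}(\mathcal A)$ of the form $\beta_g=\bigotimes_j\mathrm{Ad}(U_j(g))$ with unitary representations $U_j$ of $G$ on $\mathcal H_j$. A *finite depth quantum circuit* (FDQC) is a finite composition of automorphisms $\bigotimes_a\mathrm{Ad}(V_a)$, where $(I_a)_{a\in\mathbb Z}$ is a partition of $\mathbb Z$ into intervals of uniformly bounded length and the *gates*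 $V_a\in\mathcal A_{I_a}$ are unitary; it *has symmetric gates* if it can be written so that all gates satisfy $\beta_g(V_a)=V_a$ for all $g\in G$. A (1d) *symmetric entangler* is a triple $(\alpha,\beta,\mathcal A)$ of a spin chain $\mathcal A$, an on-site symmetry $\beta$ and an FDQC $\alpha$ on $\mathcal A$ with $\alpha\circ\beta_g=\beta_g\circ\alpha$ for all $g\in G$. Two symmetric entanglers are *equivalent* if, after an identification of the two chains by a $*$-isomorphism that maps on-site algebras onto on-site algebras and intertwines the two symmetries, they are $(\alpha,\beta,\mathcal A)$ and $(\alpha\circ\gamma,\beta,\mathcal A)$ for an FDQC $\gamma$ with symmetric gates. They are *stably equivalent*, $(\alpha,\beta,\mathcal A)\sim(\alpha',\beta',\mathcal A')$, if there are spin chains with on-site symmetries $(\tilde\beta,\tilde{\mathcal A})$ and $(\tilde\beta',\tilde{\mathcal A}')$ such that $(\alpha\otimes\mathrm{id},\beta\otimes\tilde\beta,\mathcal A\otimes\tilde{\mathcal A})$ and $(\alpha'\otimes\mathrm{id},\beta'\otimes\tilde\beta',\mathcal A'\otimes\tilde{\mathcal A}')$ are equivalent. Let $\mathsf{sEnt}_{G,1}$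 be the collection of all 1d symmetric entanglers, with stacking $(\alpha\otimes\alpha',\beta\otimes\beta',\mathcal A\otimes\mathcal A')$ as multiplication. **Lemma.** Stable equivalence is an equivalence relation on $\mathsf{sEnt}_{G,1}$ compatible with stacking, the quotient $(\mathsf{sEnt}_{G,1}/\!\sim)$ is a group under stacking, and there is a group isomorphism $$\mathrm{ind}:(\mathsf{sEnt}_{G,1}/\!\sim)\;\xrightarrow{\ \simeq\ }\;H^2(G,U(1)).$$ It is given by the $G$-action on the boundary algebra: every $\alpha$ has a finite range, that is, there is an integer $r\ge 0$ with $\alpha(\mathcal A_X)\subseteq\mathcal A_{\{j\,:\,\mathrm{dist}(j,X)\le r\}}$ for all $X\subseteq\mathbb Z$; and for every such $r$ and every $x\in\mathbb Z$, with $L_y=\{i\in\mathbb Z: i<y\}$ and $$\mathcal P=\alpha(\mathcal A_{L_x})\cap\mathcal A_{L_{x-r}}',$$ there are unitaries $W(g)\in\mathcal P$, $g\in G$, with $\beta_g(p)=W(g)\,p\,W(g)^*$ for all $p\in\mathcal P$ and $g\in G$, and any such unitaries satisfy $W(g)W(h)=\mu(g,h)W(gh)$ for a 2-cocycle $\mu\in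 Z^2(G,U(1))$ whose class is $[\mu]=\mathrm{ind}([(\alpha,\beta,\mathcal A)])$. -/

import Mathlib

noncomputable section

/-- The Hilbert space with orthonormal basis indexed by `X`. -/
abbrev HilbertOf (X : Type) : Type := lp (fun _ : X => ℂ) 2

/-- Bounded operators on the Hilbert space with orthonormal basis indexed by `X`. -/
abbrev Op (X : Type) : Type := HilbertOf X →L[ℂ] HilbertOf X

/-! Shortcut instances. -/

instance (X : Type) : Ring (Op X) := inferInstance
instance (X : Type) : Semiring (Op X) := inferInstance
instance (X : Type) : NonUnitalNonAssocSemiring (Op X) := inferInstance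
instance (X : Type) : AddCommMonoid (Op X) := inferInstance
instance (X : Type) : Monoid (Op X) := inferInstance
instance (X : Type) : Mul (Op X) := inferInstance
instance (X : Type) : Add (Op X) := inferInstance
instance (X : Type) : Star (Op X) := inferInstance
instance (X : Type) : StarRing (Op X) := inferInstance
instance (X : Type) : TopologicalSpace (Op X) := inferInstance
instance (X : Type) : Algebra ℂ (Op X) := inferInstance
instance (X : Type) : Module ℂ (Op X) := inferInstance
instance (X : Type) : SMul ℂ (Op X) := inferInstance

namespace Amplify

variable {X C D : Type}

theorem memlp_iff (f : X → ℂ) : Memℓp f 2 ↔ Summable fun x => ‖f x‖ ^ 2 := by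
  rw [memℓp_gen_iff (by norm_num)]
  simp

theorem summable_sq (ψ : HilbertOf X) : Summable fun x => ‖ψ x‖ ^ 2 :=
  (memlp_iff _).1 (lp.memℓp ψ)

theorem hasSum_sq (ψ : HilbertOf X) : HasSum (fun x => ‖ψ x‖ ^ 2) (‖ψ‖ ^ 2) := by
  simpa using lp.hasSum_norm (p := 2) (by norm_num) ψ

/-- For `X ≃ C × D`, the slice of a vector at a fixed second coordinate `d`. -/
def slice (e : X ≃ C × D) (d : D) : HilbertOf X →ₗ[ℂ] HilbertOf C where
  toFun ψ := ⟨fun c => ψ (e.symm (c, d)), (memlp_iff _).2 <|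
    (summable_sq ψ).comp_injective (i := fun c => e.symm (c, d)) fun c c' h => by simpa using h⟩
  map_add' _ _ := rfl
  map_smul' _ _ := rfl

@[simp] theorem slice_apply (e : X ≃ C × D) (d : D) (ψ : HilbertOf X) (c : C) :
    slice e d ψ c = ψ (e.symm (c, d)) := rfl

theorem hasSum_slice (e : X ≃ C × D) (ψ : HilbertOf X) :
    HasSum (fun d => ‖slice e d ψ‖ ^ 2) (‖ψ‖ ^ 2) := by
  have h : HasSum (fun p : D × C => ‖ψ (e.symm (p.2, p.1))‖ ^ 2) (‖ψ‖ ^ 2) :=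
    ((e.trans (Equiv.prodComm C D)).symm.hasSum_iff (f := fun x => ‖ψ x‖ ^ 2)).2 (hasSum_sq ψ)
  exact h.prod_fiberwise fun d => hasSum_sq (slice e d ψ)

theorem amp_summable (e : X ≃ C × D) (a : Op C) (ψ : HilbertOf X) :
    Summable fun p : D × C => ‖a (slice e p.1 ψ) p.2‖ ^ 2 := by
  rw [summable_prod_of_nonneg (fun _ => by positivity)]
  refine ⟨fun d => summable_sq (a (slice e d ψ)), ?_⟩
  refine Summable.of_nonneg_of_le (fun d => tsum_nonneg fun _ => by positivity) (fun d => ?_)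
    ((hasSum_slice e ψ).summable.mul_left (‖a‖ ^ 2))
  change ∑' c, ‖a (slice e d ψ) c‖ ^ 2 ≤ _
  rw [(hasSum_sq _).tsum_eq, ← mul_pow]
  gcongr
  exact a.le_opNorm _

/-- `a ⊗ 1` on `ℓ²(X)`, where `X ≃ C × D`, as a linear map. -/
def ampLin (e : X ≃ C × D) (a : Op C) : HilbertOf X →ₗ[ℂ] HilbertOf X where
  toFun ψ := ⟨fun x => a (slice e (e x).2 ψ) (e x).1, (memlp_iff _).2 <|
    (amp_summable e a ψ).comp_injective (i := fun x => ((e x).2, (e x).1)) fun x y h => by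
      apply e.injective; ext <;> simp_all⟩
  map_add' φ ψ := by ext x; simp; rfl
  map_smul' c ψ := by ext x; simp

theorem slice_ampLin (e : X ≃ C × D) (a : Op C) (ψ : HilbertOf X) (d : D) :
    slice e d (ampLin e a ψ) = a (slice e d ψ) := by
  ext c; simp [ampLin]

theorem ext_slice (e : X ≃ C × D) {φ ψ : HilbertOf X} (h : ∀ d, slice e d φ = slice e d ψ) :
    φ = ψ := by
  ext x
  have := congrArg (fun f : HilbertOf C => f (e x).1) (h (e x).2)
  simpa using this

theorem ampLin_norm (e : X ≃ C × D) (a : Op C) (ψ : HilbertOf X) :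
    ‖ampLin e a ψ‖ ≤ ‖a‖ * ‖ψ‖ := by
  refine le_of_sq_le_sq ?_ (by positivity)
  rw [mul_pow]
  refine hasSum_le (fun d => ?_) (hasSum_slice e (ampLin e a ψ))
    ((hasSum_slice e ψ).mul_left (‖a‖ ^ 2))
  rw [slice_ampLin, ← mul_pow]
  gcongr
  exact a.le_opNorm _

/-- `a ⊗ 1` on `ℓ²(X)`, where `X ≃ C × D`, as a bounded operator. -/
def ampOp (e : X ≃ C × D) (a : Op C) : Op X :=
  (ampLin e a).mkContinuous ‖a‖ (ampLin_norm e a)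

theorem slice_ampOp (e : X ≃ C × D) (a : Op C) (ψ : HilbertOf X) (d : D) :
    slice e d (ampOp e a ψ) = a (slice e d ψ) := slice_ampLin e a ψ d

theorem hasSum_inner_slice (e : X ≃ C × D) (φ ψ : HilbertOf X) :
    HasSum (fun d => inner ℂ (slice e d φ) (slice e d ψ)) (inner ℂ φ ψ) := by
  have h : HasSum (fun p : D × C => inner ℂ (φ (e.symm (p.2, p.1))) (ψ (e.symm (p.2, p.1))))
      (inner ℂ φ ψ) :=
    ((e.trans (Equiv.prodComm C D)).symm.hasSum_iff (f := fun x => inner ℂ (φ x) (ψ x))).2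
      (lp.hasSum_inner φ ψ)
  exact h.prod_fiberwise fun d => lp.hasSum_inner (slice e d φ) (slice e d ψ)

end Amplify

open Amplify in
/-- For a bijection `X ≃ C × D`, so that `ℓ²(X) ≅ ℓ²(C) ⊗ ℓ²(D)`, the embedding
`a ↦ a ⊗ 1` of the operators on `ℓ²(C)` into the operators on `ℓ²(X)`. -/
def amplify {X C D : Type} (e : X ≃ C × D) : Op C →⋆ₐ[ℂ] Op X where
  toFun := ampOp e
  map_one' := by ext1 ψ; exact ext_slice e fun d => by simp [slice_ampOp]
  map_mul' a b := by ext1 ψ; exact ext_slice e fun d => by simp [slice_ampOp]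
  map_zero' := by ext1 ψ; exact ext_slice e fun d => by simp [slice_ampOp]
  map_add' a b := by ext1 ψ; exact ext_slice e fun d => by simp [slice_ampOp]
  commutes' r := by
    ext1 ψ; exact ext_slice e fun d => by simp [slice_ampOp, Algebra.algebraMap_eq_smul_one]
  map_star' a := by
    refine (ContinuousLinearMap.eq_adjoint_iff _ _).2 fun φ ψ => ?_
    refine (hasSum_inner_slice e _ ψ).unique ?_
    convert hasSum_inner_slice e φ (ampOp e a ψ) using 2 with d
    rw [slice_ampOp, slice_ampOp, ContinuousLinearMap.star_eq_adjoint,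
      ContinuousLinearMap.adjoint_inner_left]

namespace Amplify

variable {X C D C' D' C'' D'' D''' : Type}

theorem amplify_apply (e : X ≃ C × D) (a : Op C) (ψ : HilbertOf X) (x : X) :
    amplify e a ψ x = a (slice e (e x).2 ψ) (e x).1 := rfl

theorem amplify_congr (e : X ≃ C × D) (e' : X ≃ C × D') (h₁ : ∀ x, (e x).1 = (e' x).1)
    (h₂ : ∀ x y, (e x).2 = (e y).2 → (e' x).2 = (e' y).2) (a : Op C) :
    amplify e a = amplify e' a := by
  ext ψ x
  rw [amplify_apply, amplify_apply, ← h₁]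
  suffices h : slice e (e x).2 ψ = slice e' (e' x).2 ψ by rw [h]
  ext c
  rw [slice_apply, slice_apply]
  refine congrArg (fun z => ψ z) ?_
  rw [Equiv.eq_symm_apply]
  have := h₂ (e.symm (c, (e x).2)) x (by simp)
  ext1
  · simp [← h₁]
  · exact this

theorem amplify_amplify (e₁ : X ≃ C × D) (e₂ : C ≃ C' × D') (a : Op C') :
    amplify e₁ (amplify e₂ a) =
      amplify ((e₁.trans (e₂.prodCongr (Equiv.refl D))).trans (Equiv.prodAssoc C' D' D)) a := by
  ext ψ x
  rw [amplify_apply, amplify_apply, amplify_apply]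
  rfl

theorem amplify_amplify_congr (e₁ : X ≃ C × D) (e₂ : C ≃ C' × D') (e₃ : X ≃ C'' × D'')
    (e₄ : C'' ≃ C' × D''') (h₁ : ∀ x, (e₂ (e₁ x).1).1 = (e₄ (e₃ x).1).1)
    (h₂ : ∀ x y, (e₂ (e₁ x).1).2 = (e₂ (e₁ y).1).2 → (e₁ x).2 = (e₁ y).2 →
      (e₄ (e₃ x).1).2 = (e₄ (e₃ y).1).2 ∧ (e₃ x).2 = (e₃ y).2) (a : Op C') :
    amplify e₁ (amplify e₂ a) = amplify e₃ (amplify e₄ a) := by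
  rw [amplify_amplify, amplify_amplify]
  refine amplify_congr _ _ (fun x => by simpa using h₁ x) (fun x y h => ?_) a
  simp only [Equiv.trans_apply, Equiv.prodCongr_apply, Equiv.prodAssoc_apply, Prod.map,
    Prod.mk.injEq, Equiv.refl_apply] at h ⊢
  exact h₂ x y h.1 h.2

open Classical in
/-- The basis vector at `x`. -/
abbrev ket (x : X) : HilbertOf X := lp.single 2 x 1

theorem op_ext {a b : Op X} (h : ∀ x, a (ket x) = b (ket x)) : a = b := by
  classical
  ext1 ψ
  have key (a : Op X) : HasSum (fun x => ψ x • a (ket x)) (a ψ) := by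
    have := (lp.hasSum_single (p := 2) (by norm_num) ψ).mapL a
    convert this using 2 with x
    rw [← map_smul, ket, ← lp.single_smul]
    simp
  refine (key a).unique ?_
  simpa only [h] using key b

theorem slice_ket_same (e : X ≃ C × D) (c : C) (d : D) :
    slice e d (ket (e.symm (c, d))) = ket c := by
  classical
  ext c'
  by_cases h : c' = c <;> simp [ket, lp.single_apply, h]

theorem slice_ket_ne (e : X ≃ C × D) (c : C) {d d' : D} (h : d' ≠ d) :
    slice e d' (ket (e.symm (c, d))) = 0 := by
  classical
  ext c'
  simp [ket, lp.single_apply, h]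

theorem slice_amplify (e : X ≃ C × D) (a : Op C) (ψ : HilbertOf X) (d : D) :
    slice e d (amplify e a ψ) = a (slice e d ψ) := slice_ampOp e a ψ d

theorem amplify_injective [Nonempty D] (e : X ≃ C × D) : Function.Injective (amplify e) := by
  intro a b h
  obtain ⟨d⟩ := ‹Nonempty D›
  refine op_ext fun c => ?_
  rw [← slice_ket_same e c d, ← slice_amplify, h, slice_amplify]

theorem amplify_mul_ket (e : X ≃ C × D) (e' : X ≃ D × C) (he : ∀ x, e' x = (e x).swap)
    (a : Op C) (b : Op D) (c : C) (d : D) (x : X) :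
    (amplify e a * amplify e' b) (ket (e.symm (c, d))) x
      = a (ket c) (e x).1 * b (ket d) (e x).2 := by
  have he' : ∀ c d, e'.symm (d, c) = e.symm (c, d) := fun c d => by
    rw [Equiv.symm_apply_eq, he]; simp
  have h1 : slice e (e x).2 (amplify e' b (ket (e.symm (c, d)))) = b (ket d) (e x).2 • ket c := by
    ext c'
    rw [slice_apply, amplify_apply, he]
    simp only [Equiv.apply_symm_apply, Prod.swap]
    by_cases h : c' = c
    · subst h
      rw [← he', slice_ket_same]
      simp [ket]
    · rw [← he', slice_ket_ne _ _ h]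
      simp [ket, lp.single_apply, h]
  rw [mul_apply_eq_comp, amplify_apply, h1, map_smul]
  simp [mul_comm]

/-- The two tensor factors commute. -/
theorem amplify_commute (e : X ≃ C × D) (e' : X ≃ D × C) (he : ∀ x, e' x = (e x).swap)
    (a : Op C) (b : Op D) : Commute (amplify e a) (amplify e' b) := by
  refine op_ext fun y => ?_
  ext x
  have h1 := amplify_mul_ket e e' he a b (e y).1 (e y).2 x
  have h2 := amplify_mul_ket e' e (fun x => by rw [he]; simp) b a (e' y).1 (e' y).2 x
  simp only [Prod.mk.eta, Equiv.symm_apply_apply] at h1 h2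
  rw [h1, h2, he, he, mul_comm]
  rfl

/-- The matrix unit `|c⟩⟨c'|`. -/
def matrixUnit (c c' : C) : Op C := (innerSL ℂ (ket c')).smulRight (ket c)

theorem matrixUnit_ket (c c' d : C) [Decidable (c' = d)] :
    matrixUnit c c' (ket d) = if c' = d then ket c else 0 := by
  classical
  simp only [matrixUnit, ContinuousLinearMap.smulRight_apply, innerSL_apply_apply, ket]
  rw [lp.inner_single_left]
  simp [lp.single_apply, Pi.single_apply]

theorem op_eq_sum [Fintype X] (a : Op X) :
    a = ∑ x, ∑ y, (a (ket y) x) • matrixUnit x y := by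
  classical
  refine op_ext fun z => ?_
  ext w
  have h : ∀ x, (∑ y, (a (ket y) x) • matrixUnit x y) (ket z) = a (ket z) x • ket x := fun x => by
    simp [sum_apply, smul_apply, matrixUnit_ket]
  rw [sum_apply, Finset.sum_congr rfl fun x _ => h x, lp.coeFn_sum, Finset.sum_apply]
  simp [ket, Pi.single_apply]

theorem matrixUnit_eq (e : X ≃ C × D) (e' : X ≃ D × C) (he : ∀ x, e' x = (e x).swap) (x y : X) :
    matrixUnit x y =
      amplify e (matrixUnit (e x).1 (e y).1) * amplify e' (matrixUnit (e x).2 (e y).2) := by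
  classical
  refine op_ext fun z => ?_
  ext w
  have h1 := amplify_mul_ket e e' he (matrixUnit (e x).1 (e y).1) (matrixUnit (e x).2 (e y).2)
    (e z).1 (e z).2 w
  simp only [Prod.mk.eta, Equiv.symm_apply_apply] at h1
  rw [h1, matrixUnit_ket, matrixUnit_ket, matrixUnit_ket]
  by_cases hy : y = z
  · subst hy
    by_cases hw : w = x
    · subst hw; simp [ket]
    · have : ¬ ((e w).1 = (e x).1 ∧ (e w).2 = (e x).2) := fun h => hw (e.injective (Prod.ext h.1 h.2))
      simp [ket, lp.single_apply, Pi.single_apply, hw]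
      tauto
  · have : ¬ ((e y).1 = (e z).1 ∧ (e y).2 = (e z).2) := fun h => hy (e.injective (Prod.ext h.1 h.2))
    simp only [hy, if_false]
    split_ifs <;> simp_all


/-- For finite `X` the Hilbert space is the coordinate space. -/
def coordEquiv [Finite X] : HilbertOf X ≃ₗ[ℂ] (X → ℂ) where
  toFun ψ := ψ
  invFun f := ⟨f, Memℓp.all f⟩
  map_add' _ _ := rfl
  map_smul' _ _ := rfl

instance [Finite X] : FiniteDimensional ℂ (HilbertOf X) :=
  Module.Finite.equiv (coordEquiv (X := X)).symm

/-- For finite `X` every linear operator is bounded. -/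
def opEquiv [Finite X] : (HilbertOf X →ₗ[ℂ] HilbertOf X) ≃ₗ[ℂ] Op X :=
  LinearMap.toContinuousLinearMap

instance [Finite X] : FiniteDimensional ℂ (Op X) :=
  Module.Finite.equiv (opEquiv (X := X))

theorem finrank_op [Fintype X] : Module.finrank ℂ (Op X) = Fintype.card X * Fintype.card X := by
  rw [← (opEquiv (X := X)).finrank_eq, Module.finrank_linearMap, (coordEquiv (X := X)).finrank_eq]
  simp

open TensorProduct in
/-- The canonical homomorphism `a ⊗ b ↦ (a ⊗ 1) (1 ⊗ b)`. -/
def tensorHom (e : X ≃ C × D) (e' : X ≃ D × C) (he : ∀ x, e' x = (e x).swap) :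
    Op C ⊗[ℂ] Op D →ₐ[ℂ] Op X :=
  Algebra.TensorProduct.lift (amplify e).toAlgHom (amplify e').toAlgHom
    fun a b => amplify_commute e e' he a b

theorem tensorHom_bijective [Finite C] [Finite D] (e : X ≃ C × D) (e' : X ≃ D × C)
    (he : ∀ x, e' x = (e x).swap) : Function.Bijective (tensorHom e e' he) := by
  classical
  have := Fintype.ofFinite C
  have := Fintype.ofFinite D
  have : Fintype X := Fintype.ofEquiv _ e.symm
  have hs : Function.Surjective (tensorHom e e' he) := by
    rw [← AlgHom.range_eq_top, eq_top_iff]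
    rintro a -
    rw [op_eq_sum a]
    refine sum_mem fun x _ => sum_mem fun y _ => Subalgebra.smul_mem _ ?_ _
    rw [matrixUnit_eq e e' he]
    exact ⟨matrixUnit (e x).1 (e y).1 ⊗ₜ matrixUnit (e x).2 (e y).2, by simp [tensorHom]⟩
  refine ⟨?_, hs⟩
  have hd : Module.finrank ℂ (TensorProduct ℂ (Op C) (Op D)) = Module.finrank ℂ (Op X) := by
    rw [Module.finrank_tensorProduct, finrank_op, finrank_op, finrank_op, Fintype.card_congr e,
      Fintype.card_prod]
    ring
  exact (LinearMap.injective_iff_surjective_of_finrank_eq_finrank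
    (f := (tensorHom e e' he).toLinearMap) hd).2 hs

theorem exists_finite_lift [Finite C] [Finite D] (e : X ≃ C × D) (e' : X ≃ D × C)
    (he : ∀ x, e' x = (e x).swap) {A : Type*} [CStarAlgebra A] (f : Op C →⋆ₐ[ℂ] A)
    (g : Op D →⋆ₐ[ℂ] A) (hc : ∀ a b, Commute (f a) (g b)) :
    ∃ θ : Op X →⋆ₐ[ℂ] A, (∀ a, θ (amplify e a) = f a) ∧ ∀ b, θ (amplify e' b) = g b := by
  let E := AlgEquiv.ofBijective _ (tensorHom_bijective e e' he)
  let L : TensorProduct ℂ (Op C) (Op D) →ₐ[ℂ] A :=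
    Algebra.TensorProduct.lift f.toAlgHom g.toAlgHom hc
  have hE : ∀ a b, E (a ⊗ₜ b) = amplify e a * amplify e' b := fun a b => by
    simp [E, tensorHom]
  have hL : ∀ a b, L (a ⊗ₜ b) = f a * g b := fun a b => by simp [L]
  let θ : Op X →ₐ[ℂ] A := L.comp E.symm.toAlgHom
  have hθ : ∀ z, θ (E z) = L z := fun z => by simp [θ]
  have key : ∀ a b, θ (amplify e a * amplify e' b) = f a * g b := fun a b => by
    rw [← hE, hθ, hL]
  refine ⟨{ θ with map_star' := ?_ }, fun a => ?_, fun b => ?_⟩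
  · intro k
    change θ (star k) = star (θ k)
    obtain ⟨z, rfl⟩ := E.surjective k
    induction z with
    | zero => simp
    | add x y hx hy => simp only [map_add, star_add, hx, hy]
    | tmul a b =>
      rw [hE, key, star_mul, star_mul, ← map_star, ← map_star, ← map_star, ← map_star,
        ← (amplify_commute e e' he _ _).eq, key, (hc _ _).eq]
  · have := key a 1
    simpa using this
  · have := key 1 b
    simpa using this

theorem norm_map_of_injective {A B : Type*} [CStarAlgebra A] [CStarAlgebra B]
    [FiniteDimensional ℂ A] (f : A →⋆ₐ[ℂ] B) (hf : Function.Injective f) (a : A) :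
    ‖f a‖ = ‖a‖ := by
  have : FiniteDimensional ℂ (LinearMap.range f.toAlgHom.toLinearMap) := inferInstance
  have hcl : IsClosed (f.range : Set B) :=
    (LinearMap.range f.toAlgHom.toLinearMap).closed_of_finiteDimensional
  let E : A ≃⋆ₐ[ℂ] f.range := StarAlgEquiv.ofInjective f hf
  let : CStarAlgebra f.range := StarSubalgebra.cstarAlgebra _ (h_closed := hcl)
  exact StarAlgEquiv.norm_map E a

end Amplify

/-- A spin chain: at each site `j : ℤ` a nonzero finite-dimensional Hilbert space with an
orthonormal basis indexed by `ι j`, of dimension bounded uniformly in `j`. -/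
structure SpinChain where
  ι : ℤ → Type
  finite : ∀ j, Finite (ι j)
  nonempty : ∀ j, Nonempty (ι j)
  bounded : ∃ D : ℕ, ∀ j, Nat.card (ι j) ≤ D

namespace SpinChain

instance (S : SpinChain) (j : ℤ) : Finite (S.ι j) := S.finite j
instance (S : SpinChain) (j : ℤ) : Nonempty (S.ι j) := S.nonempty j

/-- Basis configurations of the sites in a finite set `F`; `ℓ²(S.LocalConfig F)` is the tensor
product of the on-site Hilbert spaces over `F`. -/
abbrev LocalConfig (S : SpinChain) (F : Finset ℤ) : Type := ∀ j : {j : ℤ // j ∈ F}, S.ι j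

/-- Basis configurations of the sites outside a finite set `F`. -/
abbrev OuterConfig (S : SpinChain) (F : Finset ℤ) : Type := ∀ j : {j : ℤ // j ∉ F}, S.ι j

/-- Basis configurations of the whole chain. -/
abbrev Config (S : SpinChain) : Type := ∀ j : ℤ, S.ι j

/-- Splitting a configuration into its parts inside and outside `F`. -/
def split (S : SpinChain) (F : Finset ℤ) : S.Config ≃ S.LocalConfig F × S.OuterConfig F :=
  Equiv.piEquivPiSubtypeProd (fun j => j ∈ F) S.ι

/-- The quasi-local algebra: the norm closure of the union of the algebras
`𝒜_F = End(⨂_{j ∈ F} ℋ_j)` over finite sets of sites `F`, all of them acting on the (nonseparable)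
Hilbert space `ℓ²(Config)`, with `𝒜_F` acting on the sites in `F` only. -/
def quasiLocal (S : SpinChain) : StarSubalgebra ℂ (Op S.Config) :=
  (⨆ F : Finset ℤ, (amplify (S.split F)).range).topologicalClosure

/-- The quasi-local C⋆-algebra of the chain. -/
abbrev Alg (S : SpinChain) : Type := S.quasiLocal

instance (S : SpinChain) : CStarAlgebra S.Alg :=
  StarSubalgebra.cstarAlgebra _ (h_closed := StarSubalgebra.isClosed_topologicalClosure _)

instance (S : SpinChain) : Ring (S.Alg) := inferInstance
instance (S : SpinChain) : Semiring (S.Alg) := inferInstance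
instance (S : SpinChain) : NonUnitalNonAssocSemiring (S.Alg) := inferInstance
instance (S : SpinChain) : AddCommMonoid (S.Alg) := inferInstance
instance (S : SpinChain) : Monoid (S.Alg) := inferInstance
instance (S : SpinChain) : Mul (S.Alg) := inferInstance
instance (S : SpinChain) : Add (S.Alg) := inferInstance
instance (S : SpinChain) : Star (S.Alg) := inferInstance
instance (S : SpinChain) : StarRing (S.Alg) := inferInstance
instance (S : SpinChain) : TopologicalSpace (S.Alg) := inferInstance
instance (S : SpinChain) : Algebra ℂ (S.Alg) := inferInstance
instance (S : SpinChain) : Module ℂ (S.Alg) := inferInstance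
instance (S : SpinChain) : SMul ℂ (S.Alg) := inferInstance

theorem amplify_mem (S : SpinChain) (F : Finset ℤ) (a : Op (S.LocalConfig F)) :
    amplify (S.split F) a ∈ S.quasiLocal :=
  StarSubalgebra.le_topologicalClosure _
    (le_iSup (fun F : Finset ℤ => (amplify (S.split F)).range) F ⟨a, rfl⟩)

/-- The inclusion of the observables of a finite set of sites into the quasi-local algebra. -/
def loc (S : SpinChain) (F : Finset ℤ) : Op (S.LocalConfig F) →⋆ₐ[ℂ] S.Alg :=
  (amplify (S.split F)).codRestrict S.quasiLocal (S.amplify_mem F)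

/-- The algebra `𝒜_X` of observables supported on a (possibly infinite) set of sites `X`. -/
def obs (S : SpinChain) (X : Set ℤ) : StarSubalgebra ℂ S.Alg :=
  (⨆ F : {F : Finset ℤ // (F : Set ℤ) ⊆ X}, (S.loc F).range).topologicalClosure

/-! ### Structure of the local algebras -/

/-- Splitting a configuration of `G ⊇ F`. -/
def splitLocal (S : SpinChain) {F G : Finset ℤ} (h : F ⊆ G) :
    S.LocalConfig G ≃ S.LocalConfig F × (∀ j : {j : {j : ℤ // j ∈ G} // (j : ℤ) ∉ F}, S.ι j) where
  toFun c := (fun j => c ⟨j, h j.2⟩, fun j => c j)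
  invFun p j := if hj : (j : ℤ) ∈ F then p.1 ⟨j, hj⟩ else p.2 ⟨j, hj⟩
  left_inv c := by ext j; simp
  right_inv p := by
    ext j
    · simp
    · have := j.2; simp [this]

theorem loc_mono (S : SpinChain) {F G : Finset ℤ} (h : F ⊆ G) (a : Op (S.LocalConfig F)) :
    S.loc F a = S.loc G (amplify (S.splitLocal h) a) := by
  apply Subtype.ext
  change amplify (S.split F) a = amplify (S.split G) (amplify (S.splitLocal h) a)
  rw [Amplify.amplify_amplify]
  refine Amplify.amplify_congr _ _ (fun x => by rfl) (fun x y hxy => ?_) a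
  have hxy' : ∀ j, j ∉ F → x j = y j := fun j hj => congrFun hxy ⟨j, hj⟩
  refine Prod.ext (funext fun j => ?_) (funext fun j => ?_)
  · exact hxy' _ j.2
  · exact hxy' _ fun hj => j.2 (h hj)

theorem range_loc_mono (S : SpinChain) {F G : Finset ℤ} (h : F ⊆ G) :
    (S.loc F).range ≤ (S.loc G).range := by
  rintro _ ⟨a, rfl⟩
  exact ⟨_, (S.loc_mono h a).symm⟩

theorem directed_loc (S : SpinChain) (X : Set ℤ) :
    Directed (· ≤ ·) fun F : {F : Finset ℤ // (F : Set ℤ) ⊆ X} => (S.loc F).range := by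
  classical
  intro F G
  refine ⟨⟨F.1 ∪ G.1, by simpa using ⟨F.2, G.2⟩⟩, ?_, ?_⟩
  · exact S.range_loc_mono Finset.subset_union_left
  · exact S.range_loc_mono Finset.subset_union_right

instance (X : Set ℤ) : Nonempty {F : Finset ℤ // (F : Set ℤ) ⊆ X} := ⟨⟨∅, by simp⟩⟩

/-- To prove a closed property of the elements of `𝒜_X` it is enough to prove it for elements
supported on finite subsets. -/
theorem obs_induction (S : SpinChain) {X : Set ℤ} {p : S.Alg → Prop} (hp : IsClosed {a | p a})
    (h : ∀ F : Finset ℤ, (F : Set ℤ) ⊆ X → ∀ a, p (S.loc F a)) {a : S.Alg} (ha : a ∈ S.obs X) :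
    p a := by
  have h1 : (S.obs X : Set S.Alg) ⊆ {a | p a} := by
    rw [obs, StarSubalgebra.topologicalClosure_coe]
    refine closure_minimal ?_ hp
    rw [StarSubalgebra.coe_iSup_of_directed (S.directed_loc X)]
    refine Set.iUnion_subset fun F => ?_
    rintro _ ⟨a, rfl⟩
    exact h F.1 F.2 a
  exact h1 ha

theorem loc_mem_obs (S : SpinChain) {X : Set ℤ} {F : Finset ℤ} (h : (F : Set ℤ) ⊆ X)
    (a : Op (S.LocalConfig F)) : S.loc F a ∈ S.obs X :=
  StarSubalgebra.le_topologicalClosure _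
    (le_iSup (fun F : {F : Finset ℤ // (F : Set ℤ) ⊆ X} => (S.loc F).range) ⟨F, h⟩ ⟨a, rfl⟩)

theorem obs_univ (S : SpinChain) : S.obs Set.univ = ⊤ := by
  rw [eq_top_iff]
  rintro ⟨a, ha⟩ -
  have hd : Directed (· ≤ ·) fun F : Finset ℤ => (amplify (S.split F)).range := by
    classical
    intro F G
    refine ⟨F ∪ G, ?_, ?_⟩ <;> rintro _ ⟨a, rfl⟩
    · exact ⟨_, (congrArg Subtype.val (S.loc_mono (Finset.subset_union_left (s₂ := G)) a)).symm⟩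
    · exact ⟨_, (congrArg Subtype.val (S.loc_mono (Finset.subset_union_right (s₁ := F)) a)).symm⟩
  have h1 : a ∈ closure (⋃ F : Finset ℤ, ((amplify (S.split F)).range : Set (Op S.Config))) := by
    rw [← StarSubalgebra.coe_iSup_of_directed hd]
    exact ha
  have hcl : IsClosed (S.obs Set.univ : Set S.Alg) :=
    StarSubalgebra.isClosed_topologicalClosure _
  change _ ∈ (S.obs Set.univ : Set S.Alg)
  rw [← hcl.closure_eq, Topology.IsInducing.subtypeVal.closure_eq_preimage_closure_image]
  refine closure_mono ?_ h1
  refine Set.iUnion_subset fun F => ?_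
  rintro _ ⟨a, rfl⟩
  exact ⟨S.loc F a, S.loc_mem_obs (by simp) a, rfl⟩

theorem loc_injective (S : SpinChain) (F : Finset ℤ) : Function.Injective (S.loc F) :=
  (StarAlgHom.injective_codRestrict _ _ _).2 (Amplify.amplify_injective _)

theorem norm_loc (S : SpinChain) (F : Finset ℤ) (a : Op (S.LocalConfig F)) :
    ‖S.loc F a‖ = ‖a‖ :=
  Amplify.norm_map_of_injective _ (S.loc_injective F) a

theorem continuous_hom {A B : Type*} [CStarAlgebra A] [CStarAlgebra B] (f : A →⋆ₐ[ℂ] B) :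
    Continuous f :=
  AddMonoidHomClass.continuous_of_bound f 1
    (by simpa only [one_mul] using NonUnitalStarAlgHom.norm_apply_le f)

/-! ### Stacking -/

/-- Stacking: the on-site Hilbert spaces are `ℋ_j ⊗ ℋ'_j`. -/
def stack (S T : SpinChain) : SpinChain where
  ι j := S.ι j × T.ι j
  finite _ := inferInstance
  nonempty _ := inferInstance
  bounded := by
    obtain ⟨D, hD⟩ := S.bounded
    obtain ⟨E, hE⟩ := T.bounded
    exact ⟨D * E, fun j => by rw [Nat.card_prod]; exact Nat.mul_le_mul (hD j) (hE j)⟩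

/-- A configuration of the stacked chain is a pair of configurations. -/
def stackEquiv (S T : SpinChain) : (S.stack T).Config ≃ S.Config × T.Config :=
  Equiv.arrowProdEquivProdArrow ℤ S.ι T.ι

/-- The same with the factors exchanged. -/
def stackEquiv' (S T : SpinChain) : (S.stack T).Config ≃ T.Config × S.Config :=
  (S.stackEquiv T).trans (Equiv.prodComm _ _)

/-- The same on a finite set of sites. -/
def localStackEquiv (S T : SpinChain) (F : Finset ℤ) :
    (S.stack T).LocalConfig F ≃ S.LocalConfig F × T.LocalConfig F :=
  Equiv.arrowProdEquivProdArrow {j : ℤ // j ∈ F} (fun j => S.ι j) (fun j => T.ι j)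

theorem amplify_left_loc (S T : SpinChain) (F : Finset ℤ) (a : Op (S.LocalConfig F)) :
    amplify (S.stackEquiv T) (S.loc F a : Op S.Config) =
      (S.stack T).loc F (amplify (S.localStackEquiv T F) a) := by
  change amplify (S.stackEquiv T) (amplify (S.split F) a) =
    amplify ((S.stack T).split F) (amplify (S.localStackEquiv T F) a)
  refine Amplify.amplify_amplify_congr _ _ _ _ (fun x => by rfl) (fun x y h h' => ⟨?_, ?_⟩) a
  · exact funext fun j => congrFun h' j.1
  · exact funext fun j => Prod.ext (congrFun h j) (congrFun h' j.1)

theorem amplify_right_loc (S T : SpinChain) (F : Finset ℤ) (a : Op (T.LocalConfig F)) :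
    amplify (S.stackEquiv' T) (T.loc F a : Op T.Config) =
      (S.stack T).loc F
        (amplify ((S.localStackEquiv T F).trans (Equiv.prodComm _ _)) a) := by
  change amplify (S.stackEquiv' T) (amplify (T.split F) a) =
    amplify ((S.stack T).split F) (amplify ((S.localStackEquiv T F).trans (Equiv.prodComm _ _)) a)
  refine Amplify.amplify_amplify_congr _ _ _ _ (fun x => by rfl) (fun x y h h' => ⟨?_, ?_⟩) a
  · exact funext fun j => congrFun h' j.1
  · exact funext fun j => Prod.ext (congrFun h' j.1) (congrFun h j)

theorem isClosed_mem_quasiLocal (S T : SpinChain) (f : Op S.Config →⋆ₐ[ℂ] Op T.Config) :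
    IsClosed {a : S.Alg | f a ∈ T.quasiLocal} :=
  (StarSubalgebra.isClosed_topologicalClosure _).preimage
    ((continuous_hom f).comp continuous_subtype_val)

/-- The embedding `a ↦ a ⊗ 1` of the first chain into the stacked chain. -/
def inl (S T : SpinChain) : S.Alg →⋆ₐ[ℂ] (S.stack T).Alg :=
  ((amplify (S.stackEquiv T)).comp S.quasiLocal.subtype).codRestrict _ fun a =>
    S.obs_induction (X := Set.univ) (isClosed_mem_quasiLocal S (S.stack T) _)
      (fun F _ b => by rw [amplify_left_loc]; exact Subtype.property _)
      (by rw [obs_univ]; trivial)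

/-- The embedding `b ↦ 1 ⊗ b` of the second chain into the stacked chain. -/
def inr (S T : SpinChain) : T.Alg →⋆ₐ[ℂ] (S.stack T).Alg :=
  ((amplify (S.stackEquiv' T)).comp T.quasiLocal.subtype).codRestrict _ fun a =>
    T.obs_induction (X := Set.univ) (isClosed_mem_quasiLocal T (S.stack T) _)
      (fun F _ b => by rw [amplify_right_loc]; exact Subtype.property _)
      (by rw [obs_univ]; trivial)

theorem inl_loc (S T : SpinChain) (F : Finset ℤ) (a : Op (S.LocalConfig F)) :
    S.inl T (S.loc F a) = (S.stack T).loc F (amplify (S.localStackEquiv T F) a) :=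
  Subtype.ext (S.amplify_left_loc T F a)

theorem inr_loc (S T : SpinChain) (F : Finset ℤ) (a : Op (T.LocalConfig F)) :
    S.inr T (T.loc F a) = (S.stack T).loc F
      (amplify ((S.localStackEquiv T F).trans (Equiv.prodComm _ _)) a) :=
  Subtype.ext (S.amplify_right_loc T F a)

theorem inl_commute_inr (S T : SpinChain) (a : S.Alg) (b : T.Alg) :
    Commute (S.inl T a) (S.inr T b) :=
  Subtype.ext (Amplify.amplify_commute (S.stackEquiv T) (S.stackEquiv' T) (fun _ => rfl) _ _)

theorem inl_mem_obs (S T : SpinChain) {X : Set ℤ} {a : S.Alg} (ha : a ∈ S.obs X) :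
    S.inl T a ∈ (S.stack T).obs X :=
  S.obs_induction (p := fun a => S.inl T a ∈ (S.stack T).obs X)
    ((StarSubalgebra.isClosed_topologicalClosure _).preimage (continuous_hom (S.inl T)))
    (fun F hF a => by rw [inl_loc]; exact loc_mem_obs _ hF _) ha

theorem inr_mem_obs (S T : SpinChain) {X : Set ℤ} {a : T.Alg} (ha : a ∈ T.obs X) :
    S.inr T a ∈ (S.stack T).obs X :=
  T.obs_induction (p := fun a => S.inr T a ∈ (S.stack T).obs X)
    ((StarSubalgebra.isClosed_topologicalClosure _).preimage (continuous_hom (S.inr T)))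
    (fun F hF a => by rw [inr_loc]; exact loc_mem_obs _ hF _) ha


/-- A homomorphism on the stacked chain is determined on `𝒜_X ⊗ 𝒜'_X` by its values on the
two factors. -/
theorem hom_eq_of_eq (S T : SpinChain) {X : Set ℤ} {A : Type*} [CStarAlgebra A]
    (f g : (S.stack T).Alg →⋆ₐ[ℂ] A) (hl : ∀ a ∈ S.obs X, f (S.inl T a) = g (S.inl T a))
    (hr : ∀ b ∈ T.obs X, f (S.inr T b) = g (S.inr T b)) :
    ∀ x ∈ (S.stack T).obs X, f x = g x := by
  intro x hx
  refine obs_induction _ (p := fun x => f x = g x)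
    (isClosed_eq (continuous_hom f) (continuous_hom g)) (fun F hF k => ?_) hx
  obtain ⟨z, rfl⟩ := (Amplify.tensorHom_bijective (S.localStackEquiv T F)
    ((S.localStackEquiv T F).trans (Equiv.prodComm _ _)) (fun _ => rfl)).2 k
  induction z with
  | zero => simp
  | add x y hx hy => simp only [map_add, hx, hy]
  | tmul a b =>
    have : Amplify.tensorHom (S.localStackEquiv T F)
        ((S.localStackEquiv T F).trans (Equiv.prodComm _ _)) (fun _ => rfl) (a ⊗ₜ b) =
        amplify (S.localStackEquiv T F) a *
          amplify ((S.localStackEquiv T F).trans (Equiv.prodComm _ _)) b := by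
      simp [Amplify.tensorHom]
    rw [this, map_mul, ← inl_loc, ← inr_loc, map_mul, map_mul, hl _ (S.loc_mem_obs hF a),
      hr _ (T.loc_mem_obs hF b)]

theorem hom_ext (S T : SpinChain) {A : Type*} [CStarAlgebra A]
    {f g : (S.stack T).Alg →⋆ₐ[ℂ] A} (hl : ∀ a, f (S.inl T a) = g (S.inl T a))
    (hr : ∀ b, f (S.inr T b) = g (S.inr T b)) : f = g :=
  StarAlgHom.ext fun x => S.hom_eq_of_eq T (X := Set.univ) f g (fun a _ => hl a)
    (fun b _ => hr b) x (by rw [obs_univ]; trivial)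

/-- A compatible family of homomorphisms on the local algebras extends to the quasi-local
algebra. -/
theorem exists_extend (U : SpinChain) {A : Type*} [CStarAlgebra A]
    (θ : ∀ F : Finset ℤ, Op (U.LocalConfig F) →⋆ₐ[ℂ] A)
    (compat : ∀ {F G : Finset ℤ} (h : F ⊆ G) (k : Op (U.LocalConfig F)),
      θ G (amplify (U.splitLocal h) k) = θ F k) :
    ∃ Θ : U.Alg →⋆ₐ[ℂ] A, ∀ F k, Θ (U.loc F k) = θ F k := by
  classical
  have hd : Directed (· ≤ ·) fun F : Finset ℤ => ((U.loc F).prod (θ F)).range := by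
    have mono : ∀ {F G : Finset ℤ}, F ⊆ G →
        ((U.loc F).prod (θ F)).range ≤ ((U.loc G).prod (θ G)).range := by
      rintro F G h _ ⟨a, rfl⟩
      refine ⟨amplify (U.splitLocal h) a, Prod.ext ?_ ?_⟩
      · exact (U.loc_mono h a).symm
      · exact compat h a
    intro F G
    exact ⟨F ∪ G, mono Finset.subset_union_left, mono Finset.subset_union_right⟩
  -- the graph of the homomorphism
  obtain ⟨K, hKdef⟩ : ∃ K : StarSubalgebra ℂ (U.Alg × A),
      K = (⨆ F, ((U.loc F).prod (θ F)).range).topologicalClosure := ⟨_, rfl⟩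
  have hK : IsClosed (K : Set (U.Alg × A)) :=
    hKdef ▸ StarSubalgebra.isClosed_topologicalClosure _
  have hgr : ∀ F k, (U.loc F k, θ F k) ∈ K := fun F k =>
    hKdef ▸ StarSubalgebra.le_topologicalClosure _
      (le_iSup (fun F => ((U.loc F).prod (θ F)).range) F ⟨k, rfl⟩)
  have hnorm : ∀ p ∈ K, ‖p.2‖ ≤ ‖p.1‖ := by
    have hsub : (K : Set (U.Alg × A)) ⊆ {p | ‖p.2‖ ≤ ‖p.1‖} := by
      rw [hKdef, StarSubalgebra.topologicalClosure_coe]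
      refine closure_minimal ?_ (isClosed_le (by fun_prop) (by fun_prop))
      rw [StarSubalgebra.coe_iSup_of_directed hd]
      refine Set.iUnion_subset fun F => ?_
      rintro _ ⟨a, rfl⟩
      change ‖θ F a‖ ≤ ‖U.loc F a‖
      rw [norm_loc]
      exact NonUnitalStarAlgHom.norm_apply_le (θ F) a
    exact fun p hp => hsub hp
  clear hKdef hd
  let : CStarAlgebra K := StarSubalgebra.cstarAlgebra _ (h_closed := hK)
  let π₁ : K →⋆ₐ[ℂ] U.Alg := (StarAlgHom.fst ℂ U.Alg A).comp K.subtype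
  let π₂ : K →⋆ₐ[ℂ] A := (StarAlgHom.snd ℂ U.Alg A).comp K.subtype
  have hiso : ∀ p : K, ‖π₁ p‖ = ‖p‖ := fun p =>
    (max_eq_left (hnorm p.1 p.2)).symm
  have hisom : Isometry π₁ := AddMonoidHomClass.isometry_of_norm _ hiso
  have hbij : Function.Bijective π₁ := by
    refine ⟨hisom.injective, fun x => ?_⟩
    have hcl : IsClosed {x | x ∈ Set.range π₁} := hisom.isClosedEmbedding.isClosed_range
    exact U.obs_induction (X := Set.univ) hcl
      (fun F _ k => ⟨⟨_, hgr F k⟩, rfl⟩) (by rw [obs_univ]; trivial)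
  let E : K ≃⋆ₐ[ℂ] U.Alg := StarAlgEquiv.ofBijective π₁ hbij
  refine ⟨π₂.comp (E.symm : U.Alg →⋆ₐ[ℂ] K), fun F k => ?_⟩
  have h1 : E ⟨_, hgr F k⟩ = U.loc F k := rfl
  have h2 : E.symm (U.loc F k) = ⟨_, hgr F k⟩ :=
    (congrArg E.symm h1).symm.trans (E.symm_apply_apply _)
  exact congrArg π₂ h2

/-- The universal property of the stacked chain as a tensor product. -/
theorem exists_lift (S T : SpinChain) {A : Type*} [CStarAlgebra A] (f : S.Alg →⋆ₐ[ℂ] A)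
    (g : T.Alg →⋆ₐ[ℂ] A) (hc : ∀ a b, Commute (f a) (g b)) :
    ∃ θ : (S.stack T).Alg →⋆ₐ[ℂ] A, (∀ a, θ (S.inl T a) = f a) ∧ ∀ b, θ (S.inr T b) = g b := by
  have hex := fun F : Finset ℤ => Amplify.exists_finite_lift (S.localStackEquiv T F)
    ((S.localStackEquiv T F).trans (Equiv.prodComm _ _)) (fun _ => rfl)
    (f.comp (S.loc F)) (g.comp (T.loc F)) (fun a b => hc _ _)
  choose θ hθl hθr using hex
  obtain ⟨Θ, hΘ⟩ := (S.stack T).exists_extend θ (by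
    intro F G h k
    obtain ⟨z, rfl⟩ := (Amplify.tensorHom_bijective (S.localStackEquiv T F)
      ((S.localStackEquiv T F).trans (Equiv.prodComm _ _)) (fun _ => rfl)).2 k
    induction z with
    | zero => simp
    | add x y hx hy => simp only [map_add, hx, hy]
    | tmul a b =>
      have h1 : Amplify.tensorHom (S.localStackEquiv T F)
          ((S.localStackEquiv T F).trans (Equiv.prodComm _ _)) (fun _ => rfl) (a ⊗ₜ b) =
          amplify (S.localStackEquiv T F) a *
            amplify ((S.localStackEquiv T F).trans (Equiv.prodComm _ _)) b := by
        simp [Amplify.tensorHom]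
      have h2 : amplify ((S.stack T).splitLocal h) (amplify (S.localStackEquiv T F) a) =
          amplify (S.localStackEquiv T G) (amplify (S.splitLocal h) a) := by
        apply (S.stack T).loc_injective G
        rw [← loc_mono, ← inl_loc, ← inl_loc, ← loc_mono]
      have h3 : amplify ((S.stack T).splitLocal h)
            (amplify ((S.localStackEquiv T F).trans (Equiv.prodComm _ _)) b) =
          amplify ((S.localStackEquiv T G).trans (Equiv.prodComm _ _))
            (amplify (T.splitLocal h) b) := by
        apply (S.stack T).loc_injective G
        rw [← loc_mono, ← inr_loc, ← inr_loc, ← loc_mono]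
      rw [h1, map_mul, map_mul, map_mul, h2, h3, hθl, hθr, hθl, hθr]
      simp only [StarAlgHom.comp_apply, ← loc_mono])
  refine ⟨Θ, fun a => ?_, fun b => ?_⟩
  · refine S.obs_induction (X := Set.univ) (p := fun a => Θ (S.inl T a) = f a)
      (isClosed_eq ((continuous_hom Θ).comp (continuous_hom (S.inl T))) (continuous_hom f))
      (fun F _ a => ?_) (by rw [obs_univ]; trivial)
    rw [inl_loc, hΘ, hθl]; rfl
  · refine T.obs_induction (X := Set.univ) (p := fun b => Θ (S.inr T b) = g b)
      (isClosed_eq ((continuous_hom Θ).comp (continuous_hom (S.inr T))) (continuous_hom g))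
      (fun F _ b => ?_) (by rw [obs_univ]; trivial)
    rw [inr_loc, hΘ, hθr]; rfl

/-- The automorphisms of the quasi-local algebra. -/
abbrev Aut (S : SpinChain) : Type := S.Alg ≃⋆ₐ[ℂ] S.Alg

theorem exists_tensorAut (S T : SpinChain) (α : S.Aut) (α' : T.Aut) :
    ∃ γ : (S.stack T).Aut, (∀ a, γ (S.inl T a) = S.inl T (α a)) ∧
      ∀ b, γ (S.inr T b) = S.inr T (α' b) := by
  have hex := fun (α : S.Aut) (α' : T.Aut) => S.exists_lift T
    ((S.inl T).comp (α : S.Alg →⋆ₐ[ℂ] S.Alg)) ((S.inr T).comp (α' : T.Alg →⋆ₐ[ℂ] T.Alg))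
    (fun a b => S.inl_commute_inr T _ _)
  obtain ⟨f, hfl, hfr⟩ := hex α α'
  obtain ⟨g, hgl, hgr⟩ := hex α.symm α'.symm
  have hfg : f.comp g = StarAlgHom.id ℂ _ := S.hom_ext T
    (fun a => by
      change f (g _) = _
      rw [hgl]
      change f (S.inl T (α.symm a)) = _
      rw [hfl]
      change S.inl T (α (α.symm a)) = _
      simp)
    (fun b => by
      change f (g _) = _
      rw [hgr]
      change f (S.inr T (α'.symm b)) = _
      rw [hfr]
      change S.inr T (α' (α'.symm b)) = _
      simp)
  have hgf : g.comp f = StarAlgHom.id ℂ _ := S.hom_ext T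
    (fun a => by
      change g (f _) = _
      rw [hfl]
      change g (S.inl T (α a)) = _
      rw [hgl]
      change S.inl T (α.symm (α a)) = _
      simp)
    (fun b => by
      change g (f _) = _
      rw [hfr]
      change g (S.inr T (α' b)) = _
      rw [hgr]
      change S.inr T (α'.symm (α' b)) = _
      simp)
  exact ⟨StarAlgEquiv.ofStarAlgHom f g hgf hfg, hfl, hfr⟩

/-- The automorphism `α ⊗ α'` of the stacked chain, determined by `a ⊗ 1 ↦ α a ⊗ 1` and
`1 ⊗ b ↦ 1 ⊗ α' b`. -/
def tensorAut (S T : SpinChain) (α : S.Aut) (α' : T.Aut) : (S.stack T).Aut :=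
  (S.exists_tensorAut T α α').choose

theorem tensorAut_inl (S T : SpinChain) (α : S.Aut) (α' : T.Aut) (a : S.Alg) :
    S.tensorAut T α α' (S.inl T a) = S.inl T (α a) :=
  (S.exists_tensorAut T α α').choose_spec.1 a

theorem tensorAut_inr (S T : SpinChain) (α : S.Aut) (α' : T.Aut) (b : T.Alg) :
    S.tensorAut T α α' (S.inr T b) = S.inr T (α' b) :=
  (S.exists_tensorAut T α α').choose_spec.2 b

theorem aut_ext (S T : SpinChain) {γ γ' : (S.stack T).Aut}
    (hl : ∀ a, γ (S.inl T a) = γ' (S.inl T a)) (hr : ∀ b, γ (S.inr T b) = γ' (S.inr T b)) :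
    γ = γ' :=
  StarAlgEquiv.ext fun x => DFunLike.congr_fun (S.hom_ext T
    (f := (γ : (S.stack T).Alg →⋆ₐ[ℂ] (S.stack T).Alg))
    (g := (γ' : (S.stack T).Alg →⋆ₐ[ℂ] (S.stack T).Alg)) hl hr) x

theorem tensorAut_mul (S T : SpinChain) (α₁ α₂ : S.Aut) (α₁' α₂' : T.Aut) :
    S.tensorAut T (α₁ * α₂) (α₁' * α₂') = S.tensorAut T α₁ α₁' * S.tensorAut T α₂ α₂' :=
  S.aut_ext T (fun a => by simp [tensorAut_inl]) (fun b => by simp [tensorAut_inr])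

theorem tensorAut_one (S T : SpinChain) : S.tensorAut T 1 1 = 1 :=
  S.aut_ext T (fun a => by simp [tensorAut_inl]) (fun b => by simp [tensorAut_inr])

end SpinChain

namespace SpinChain

variable {G : Type} [Group G]

/-! ### Circuits and symmetries -/

/-- One layer of gates: a partition of `ℤ` into intervals `[m a, n a]` of bounded length and a
unitary gate supported on each of them. -/
structure Layer (S : SpinChain) where
  m : ℤ → ℤ
  n : ℤ → ℤ
  le : ∀ a, m a ≤ n a
  bounded : ∃ q : ℤ, ∀ a, n a - m a ≤ q
  partition : ∀ j, ∃! a, j ∈ Set.Icc (m a) (n a)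
  gate : ℤ → unitary S.Alg
  gate_mem : ∀ a, (gate a : S.Alg) ∈ S.obs (Set.Icc (m a) (n a))

/-- The automorphism `γ` is the block partitioned automorphism `⨂_a Ad(V_a)` given by the layer;
this condition determines `γ` on the local algebras, hence everywhere. -/
def Layer.Implements {S : SpinChain} (L : S.Layer) (γ : S.Aut) : Prop :=
  ∀ a, ∀ x ∈ S.obs (Set.Icc (L.m a) (L.n a)), γ x = L.gate a * x * star (L.gate a : S.Alg)

/-- Finite depth quantum circuits: finite compositions of block partitioned automorphisms. -/
def IsFDQC (S : SpinChain) (γ : S.Aut) : Prop :=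
  ∃ l : List S.Aut, γ = l.prod ∧ ∀ δ ∈ l, ∃ L : S.Layer, L.Implements δ

/-- Finite depth quantum circuits all of whose gates are fixed by the symmetry `β`. -/
def IsSymmetricFDQC (S : SpinChain) (β : G →* S.Aut) (γ : S.Aut) : Prop :=
  ∃ l : List S.Aut, γ = l.prod ∧
    ∀ δ ∈ l, ∃ L : S.Layer, L.Implements δ ∧ ∀ g a, β g (L.gate a) = L.gate a

/-- On-site symmetries: `β_g = ⨂_j Ad(U_j(g))` for unitary representations `U_j` of `G` on the
on-site Hilbert spaces. -/
def IsOnSite (S : SpinChain) (β : G →* S.Aut) : Prop :=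
  ∃ U : ℤ → G →* unitary S.Alg, (∀ j g, (U j g : S.Alg) ∈ S.obs {j}) ∧
    ∀ j g, ∀ x ∈ S.obs {j}, β g x = U j g * x * star (U j g : S.Alg)

/-- `γ(𝒜_X) ⊆ 𝒜_{X^{(r)}}` for all `X`, where `X^{(r)}` is the `r`-fattening of `X`. -/
def HasRange (S : SpinChain) (γ : S.Aut) (r : ℕ) : Prop :=
  ∀ X : Set ℤ, ∀ a ∈ S.obs X, γ a ∈ S.obs {j | ∃ i ∈ X, |j - i| ≤ r}

/-- The stack `β ⊗ β'` of two symmetries. -/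
def tensorSymmetry (S T : SpinChain) (β : G →* S.Aut) (β' : G →* T.Aut) :
    G →* (S.stack T).Aut where
  toFun g := S.tensorAut T (β g) (β' g)
  map_one' := by rw [map_one, map_one, tensorAut_one]
  map_mul' g h := by rw [map_mul, map_mul, tensorAut_mul]

/-- If two automorphisms of the factors act on `𝒜_X` and `𝒜'_X` by conjugation with `u`, `v` then
`α ⊗ α'` acts on `𝒜_X ⊗ 𝒜'_X` by conjugation with `u ⊗ v`. -/
theorem tensorAut_conj (S T : SpinChain) {X : Set ℤ} {α : S.Aut} {α' : T.Aut}
    (u : unitary S.Alg) (v : unitary T.Alg)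
    (hu : ∀ x ∈ S.obs X, α x = u * x * star (u : S.Alg))
    (hv : ∀ x ∈ T.obs X, α' x = v * x * star (v : T.Alg)) :
    ∀ x ∈ (S.stack T).obs X, S.tensorAut T α α' x =
      (S.inl T u * S.inr T v) * x * star (S.inl T (u : S.Alg) * S.inr T (v : T.Alg)) := by
  have hw : S.inl T (u : S.Alg) * S.inr T (v : T.Alg) ∈ unitary (S.stack T).Alg :=
    mul_mem (Unitary.map_mem (S.inl T) u.2) (Unitary.map_mem (S.inr T) v.2)
  have h1 := Unitary.mul_star_self_of_mem u.2
  have h2 := Unitary.mul_star_self_of_mem v.2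
  refine S.hom_eq_of_eq T
    (f := (S.tensorAut T α α' : (S.stack T).Alg →⋆ₐ[ℂ] (S.stack T).Alg))
    (g := ((Unitary.conjStarAlgAut ℂ (S.stack T).Alg ⟨_, hw⟩ : (S.stack T).Aut) :
      (S.stack T).Alg →⋆ₐ[ℂ] (S.stack T).Alg)) ?_ ?_
  · intro a ha
    change S.tensorAut T α α' (S.inl T a) =
      (S.inl T u * S.inr T v) * (S.inl T a) * star (S.inl T (u : S.Alg) * S.inr T (v : T.Alg))
    rw [tensorAut_inl, hu a ha, star_mul, ← map_star, ← map_star, map_mul, map_mul]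
    have c := (S.inl_commute_inr T a v).eq
    calc _ = S.inl T u * S.inl T a * (S.inr T v * S.inr T (star (v : T.Alg))) *
          S.inl T (star (u : S.Alg)) := by rw [← map_mul (S.inr T), h2]; simp
      _ = S.inl T u * (S.inl T a * S.inr T v) * S.inr T (star (v : T.Alg)) *
          S.inl T (star (u : S.Alg)) := by noncomm_ring
      _ = _ := by rw [c]; noncomm_ring
  · intro b hb
    change S.tensorAut T α α' (S.inr T b) =
      (S.inl T u * S.inr T v) * (S.inr T b) * star (S.inl T (u : S.Alg) * S.inr T (v : T.Alg))
    rw [tensorAut_inr, hv b hb, star_mul, ← map_star, ← map_star, map_mul, map_mul]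
    have c := (S.inl_commute_inr T u (v * b * star (v : T.Alg))).eq
    rw [map_mul, map_mul] at c
    calc _ = S.inr T v * S.inr T b * S.inr T (star (v : T.Alg)) *
          (S.inl T u * S.inl T (star (u : S.Alg))) := by rw [← map_mul (S.inl T), h1]; simp
      _ = (S.inr T v * S.inr T b * S.inr T (star (v : T.Alg)) *
          S.inl T u) * S.inl T (star (u : S.Alg)) := by noncomm_ring
      _ = _ := by rw [← c]; noncomm_ring

theorem IsOnSite.stack {S T : SpinChain} {β : G →* S.Aut} {β' : G →* T.Aut} (h : S.IsOnSite β)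
    (h' : T.IsOnSite β') : (S.stack T).IsOnSite (S.tensorSymmetry T β β') := by
  obtain ⟨U, hU, hβ⟩ := h
  obtain ⟨V, hV, hβ'⟩ := h'
  refine ⟨fun j =>
    { toFun := fun g => ⟨S.inl T (U j g) * S.inr T (V j g),
        mul_mem (Unitary.map_mem (S.inl T) (U j g).2) (Unitary.map_mem (S.inr T) (V j g).2)⟩
      map_one' := by ext1; simp
      map_mul' := fun g k => by
        ext1
        simp only [map_mul, Submonoid.coe_mul]
        have c := (S.inl_commute_inr T (U j k : S.Alg) (V j g)).eq
        calc _ = S.inl T (U j g) * (S.inl T (U j k) * S.inr T (V j g)) * S.inr T (V j k) := by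
              noncomm_ring
          _ = _ := by rw [c]; noncomm_ring }, fun j g => ?_, fun j g => ?_⟩
  · exact mul_mem (S.inl_mem_obs T (hU j g)) (S.inr_mem_obs T (hV j g))
  · exact S.tensorAut_conj T (U j g) (V j g) (hβ j g) (hβ' j g)

theorem IsFDQC.stack {S T : SpinChain} {α : S.Aut} {α' : T.Aut} (h : S.IsFDQC α)
    (h' : T.IsFDQC α') : (S.stack T).IsFDQC (S.tensorAut T α α') := by
  obtain ⟨l, rfl, hl⟩ := h
  obtain ⟨l', rfl, hl'⟩ := h'
  have e1 : ∀ l : List S.Aut, S.tensorAut T l.prod 1 = (l.map fun δ => S.tensorAut T δ 1).prod := by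
    intro l
    induction l with
    | nil => simp [tensorAut_one]
    | cons a l ih => rw [List.prod_cons, List.map_cons, List.prod_cons, ← ih, ← tensorAut_mul, one_mul]
  have e2 : ∀ l : List T.Aut, S.tensorAut T 1 l.prod = (l.map fun δ => S.tensorAut T 1 δ).prod := by
    intro l
    induction l with
    | nil => simp [tensorAut_one]
    | cons a l ih => rw [List.prod_cons, List.map_cons, List.prod_cons, ← ih, ← tensorAut_mul, one_mul]
  refine ⟨l.map (fun δ => S.tensorAut T δ 1) ++ l'.map (fun δ => S.tensorAut T 1 δ), ?_, ?_⟩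
  · rw [List.prod_append, ← e1, ← e2, ← tensorAut_mul, one_mul, mul_one]
  · intro δ hδ
    rw [List.mem_append, List.mem_map, List.mem_map] at hδ
    rcases hδ with ⟨δ, hδ, rfl⟩ | ⟨δ, hδ, rfl⟩
    · obtain ⟨L, hL⟩ := hl δ hδ
      refine ⟨{ L with
        gate := fun a => ⟨S.inl T (L.gate a) * S.inr T (1 : unitary T.Alg),
          mul_mem (Unitary.map_mem (S.inl T) (L.gate a).2) (Unitary.map_mem (S.inr T) (1 : unitary T.Alg).2)⟩
        gate_mem := fun a => mul_mem (S.inl_mem_obs T (L.gate_mem a))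
          (S.inr_mem_obs T (one_mem _)) }, fun a => ?_⟩
      exact S.tensorAut_conj T (L.gate a) 1 (hL a) (fun x _ => by simp)
    · obtain ⟨L, hL⟩ := hl' δ hδ
      refine ⟨{ L with
        gate := fun a => ⟨S.inl T (1 : unitary S.Alg) * S.inr T (L.gate a),
          mul_mem (Unitary.map_mem (S.inl T) (1 : unitary S.Alg).2) (Unitary.map_mem (S.inr T) (L.gate a).2)⟩
        gate_mem := fun a => mul_mem (S.inl_mem_obs T (one_mem _))
          (S.inr_mem_obs T (L.gate_mem a)) }, fun a => ?_⟩
      exact S.tensorAut_conj T 1 (L.gate a) (fun x _ => by simp) (hL a)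

end SpinChain

/-! ### Symmetric entanglers -/

/-- A symmetric entangler `(α, β, 𝒜)` on a spin chain. -/
structure SymmetricEntangler (G : Type) [Group G] where
  chain : SpinChain
  β : G →* chain.Aut
  α : chain.Aut
  onSite : chain.IsOnSite β
  isFDQC : chain.IsFDQC α
  equivariant : ∀ g, α * β g = β g * α

namespace SymmetricEntangler

variable {G : Type} [Group G]

/-- The stack `(α ⊗ α', β ⊗ β', 𝒜 ⊗ 𝒜')`. -/
def stack (E F : SymmetricEntangler G) : SymmetricEntangler G where
  chain := E.chain.stack F.chain
  β := E.chain.tensorSymmetry F.chain E.β F.β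
  α := E.chain.tensorAut F.chain E.α F.α
  onSite := E.onSite.stack F.onSite
  isFDQC := E.isFDQC.stack F.isFDQC
  equivariant g := by
    change _ * E.chain.tensorAut F.chain (E.β g) (F.β g) =
      E.chain.tensorAut F.chain (E.β g) (F.β g) * _
    rw [← SpinChain.tensorAut_mul, ← SpinChain.tensorAut_mul, E.equivariant, F.equivariant]

/-- The multiplication of symmetric entanglers is stacking. -/
instance : Mul (SymmetricEntangler G) := ⟨stack⟩

/-- The entangler `(id, β, 𝒜)` of an on-site symmetry. -/
def identity (S : SpinChain) (β : G →* S.Aut) (h : S.IsOnSite β) : SymmetricEntangler G where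
  chain := S
  β := β
  α := 1
  onSite := h
  isFDQC := ⟨[], by simp, by simp⟩
  equivariant g := by rw [one_mul, mul_one]

/-- Equivalence of symmetric entanglers: after identifying the two chains site by site, compatibly
with the symmetries, `α' = α ∘ γ` for a finite depth quantum circuit `γ` with symmetric gates. -/
def Equivalent (E F : SymmetricEntangler G) : Prop :=
  ∃ Φ : E.chain.Alg ≃⋆ₐ[ℂ] F.chain.Alg,
    (∀ j, ∀ a, a ∈ E.chain.obs {j} ↔ Φ a ∈ F.chain.obs {j}) ∧
    (∀ g a, Φ (E.β g a) = F.β g (Φ a)) ∧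
    ∃ γ : E.chain.Aut, E.chain.IsSymmetricFDQC E.β γ ∧ ∀ a, F.α (Φ a) = Φ (E.α (γ a))

/-- Stable equivalence: equivalence after stacking with identities on auxiliary chains carrying
on-site symmetries. -/
def StablyEquivalent (E F : SymmetricEntangler G) : Prop :=
  ∃ (S : SpinChain) (β : G →* S.Aut) (h : S.IsOnSite β)
    (T : SpinChain) (β' : G →* T.Aut) (h' : T.IsOnSite β'),
    Equivalent (E.stack (identity S β h)) (F.stack (identity T β' h'))

/-- The boundary algebra `α(𝒜_{L_x}) ∩ (𝒜_{L_{x-r}})'`, where `L_x = {i | i < x}`. -/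
def boundaryAlgebra (E : SymmetricEntangler G) (x : ℤ) (r : ℕ) : StarSubalgebra ℂ E.chain.Alg :=
  (E.chain.obs (Set.Iio x)).map (E.α : E.chain.Alg →⋆ₐ[ℂ] E.chain.Alg) ⊓
    StarSubalgebra.centralizer ℂ (E.chain.obs (Set.Iio (x - r)) : Set E.chain.Alg)

/-- The unitaries `W(g)` lie in the boundary algebra and implement the symmetry on it. -/
def ImplementsBoundary (E : SymmetricEntangler G) (x : ℤ) (r : ℕ)
    (W : G → unitary E.chain.Alg) : Prop :=
  ∀ g, (W g : E.chain.Alg) ∈ E.boundaryAlgebra x r ∧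
    ∀ p ∈ E.boundaryAlgebra x r, E.β g p = W g * p * star (W g : E.chain.Alg)

end SymmetricEntangler

/-- The trivial `G`-module `U(1)`, written additively. -/
abbrev U1Module (G : Type) [Group G] : Rep ℤ G := Rep.trivial ℤ G (Additive Circle)

/-- The group cohomology `H²(G, U(1))`, written additively. -/
abbrev H2U1 (G : Type) [Group G] : Type := groupCohomology.H2 (U1Module G)

/-- `κ` is the index of `E`: for every cut `x` and every `r` at least the range of `α`, the
symmetry on the boundary algebra is implemented by unitaries of that algebra, and any such choice
of unitaries is projective with a 2-cocycle of class `κ`. -/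
def SymmetricEntangler.HasIndex {G : Type} [Group G] (E : SymmetricEntangler G) (κ : H2U1 G) :
    Prop :=
  (∃ r : ℕ, E.chain.HasRange E.α r) ∧
  ∀ (x : ℤ) (r : ℕ), E.chain.HasRange E.α r →
    (∃ W, E.ImplementsBoundary x r W) ∧
    ∀ W, E.ImplementsBoundary x r W →
      ∃ μ : groupCohomology.cocycles₂ (U1Module G),
        (∀ g h, (W g * W h : E.chain.Alg) =
          ((Additive.toMul (μ.1 (g, h) : Additive Circle) : Circle) : ℂ) • (W (g * h) : E.chain.Alg)) ∧
        groupCohomology.H2π (U1Module G) μ = κ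

end

/-!
# The index of one-dimensional symmetric entanglers

The index of `(α, β, 𝒜)` is the obstruction to a linear action of `G` on the boundary algebra
`𝒫 = α(𝒜_{L_x}) ∩ 𝒜_{L_{x-r}}'`. A circuit preserves `𝒜_{L_x}` up to conjugation by a unitary `u`
supported near `x`, so `𝒫` is conjugate by `u` to the algebra of finitely many sites
(`boundary_eq_map`). It is thus a matrix algebra, the symmetry acts on it by inner automorphisms, and
the implementing unitaries are projective with a cocycle whose class is unique
(`HasClass.exists_of_isMatrix`, `HasClass.of_implements`). Enlarging `r` or moving `x` multiplies `𝒫`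
by a commuting matrix algebra which is the algebra of an interval or its image under `α`. There `G`
acts through a linear representation, so the class stays the same (`hasClass_boundary_iff`). The
computations with supports rest on Haag duality `𝒜_X' = 𝒜_{Xᶜ}` (`centralizer_obs`) and on the slicing
of an algebra along the matrix units of a matrix subalgebra (`matrixCoeff`).

The class is additive under stacking, since boundary algebras multiply (`HasIndexClass.stack`). It
changes sign under inversion, since the boundary algebras of `α` and `α⁻¹` are mutual commutants in
the algebra of an interval, up to applying `α` (`HasIndexClass.inv`). It does not change under
composition with a circuit of symmetric gates, because such a circuit can be cut by a symmetric
unitary (`HasIndexClass.mul_symmetric`). Hence it is an invariant of stable equivalence, compatible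
with stacking.

For injectivity, let `E` and `F` have the same index. After stacking with the chain of `F` and with a
chain carrying the regular representation of `G` at each site, `E⁻¹ ⊗ F ⊗ 1` has index zero, and all
its gates commute with the projections onto the basis vectors of the regular representations, a
`TranslationFrame`. As the index vanishes, the action on the boundary algebra comes from a
representation. The frame makes this representation equivalent to the on-site one, and the unitaries
cutting the circuit can be chosen symmetric (`exists_symmetric_cut`). Once the circuit is cut at
equidistant points there remains a product of unitaries on disjoint intervals, on each of which `G`
acts by a character. Diagonal unitaries of the frame carry such characters, and with them the charges
are passed from one interval to the next, until all gates are symmetric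
(`isSymmetricFDQC_of_index_zero`). Composing `E ⊗ 1` with this circuit and exchanging the chains of
`E` and `F` gives `F ⊗ 1` (`stablyEquivalent_of_index_eq`). In particular stable equivalence is
equality of indices, and so a congruence.

For surjectivity, a cocycle `μ` gives commuting gates `D_j = ∑ μ(a, a⁻¹b) f_j(a) f_{j+1}(b)`, diagonal
in a translation frame `f`. Their product commutes with the symmetry by the cocycle identity, though
the single gates do not, and its boundary algebra carries the class of `μ`
(`TranslationFrame.exists_circuit`).
-/

noncomputable section

/-! ### Cocycles with values in `U(1)` -/

/-- The function `μ` on pairs of group elements is a 2-cocycle with values in `U(1)`, of class `κ`. -/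
def IsClass {G : Type} [Group G] (μ : G → G → Circle) (κ : H2U1 G) : Prop :=
  ∃ c : groupCohomology.cocycles₂ (U1Module G),
    (∀ g h, c.1 (g, h) = Additive.ofMul (μ g h)) ∧ groupCohomology.H2π (U1Module G) c = κ

namespace IsClass

variable {G : Type} [Group G] {μ ν : G → G → Circle} {κ κ' : H2U1 G}

theorem cocycle (h : IsClass μ κ) (a b c : G) :
    μ (a * b) c * μ a b = μ b c * μ a (b * c) := by
  obtain ⟨z, hz, -⟩ := h
  have h1 := (groupCohomology.mem_cocycles₂_iff (A := U1Module G) z.1).1 z.2 a b c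
  simp only [hz] at h1
  exact Additive.ofMul.injective h1

theorem of_cocycle (h : ∀ a b c, μ (a * b) c * μ a b = μ b c * μ a (b * c)) :
    ∃ κ : H2U1 G, IsClass μ κ := by
  refine ⟨_, ⟨fun p => Additive.ofMul (μ p.1 p.2), ?_⟩, fun _ _ => rfl, rfl⟩
  refine (groupCohomology.mem_cocycles₂_iff (A := U1Module G) _).2 fun a b c => ?_
  exact congrArg Additive.ofMul (h a b c)

theorem exists_cocycle (κ : H2U1 G) : ∃ μ : G → G → Circle, IsClass μ κ := by
  induction κ using groupCohomology.H2_induction_on with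
  | h x => exact ⟨fun g h => Additive.toMul (x.1 (g, h)), x, fun _ _ => rfl, rfl⟩

theorem unique (h : IsClass μ κ) (h' : IsClass μ κ') : κ = κ' := by
  obtain ⟨c, hc, rfl⟩ := h
  obtain ⟨c', hc', rfl⟩ := h'
  congr 1
  exact groupCohomology.cocycles₂_ext fun g h => (hc g h).trans (hc' g h).symm

theorem mul (h : IsClass μ κ) (h' : IsClass ν κ') :
    IsClass (fun g h => μ g h * ν g h) (κ + κ') := by
  obtain ⟨c, hc, rfl⟩ := h
  obtain ⟨c', hc', rfl⟩ := h'
  refine ⟨c + c', fun g h => ?_, map_add _ _ _⟩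
  exact congrArg₂ (· + ·) (hc g h) (hc' g h)

theorem inv (h : IsClass μ κ) : IsClass (fun g h => (μ g h)⁻¹) (-κ) := by
  obtain ⟨c, hc, rfl⟩ := h
  refine ⟨-c, fun g h => ?_, map_neg _ _⟩
  exact congrArg Neg.neg (hc g h)

theorem one : IsClass (fun _ _ : G => 1) (0 : H2U1 G) :=
  ⟨0, fun _ _ => rfl, map_zero _⟩

theorem coboundary (φ : G → Circle) :
    IsClass (fun g h => φ g * φ h * (φ (g * h))⁻¹) (0 : H2U1 G) := by
  refine ⟨⟨_, groupCohomology.d₁₂_apply_mem_cocycles₂ (A := U1Module G)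
    fun g => Additive.ofMul (φ g)⟩, fun g h => ?_, ?_⟩
  · change Additive.ofMul (φ h) - Additive.ofMul (φ (g * h)) + Additive.ofMul (φ g) = _
    apply Additive.toMul.injective
    change φ h / φ (g * h) * φ g = φ g * φ h * (φ (g * h))⁻¹
    rw [div_eq_mul_inv]
    ac_rfl
  · exact (groupCohomology.H2π_eq_zero_iff _).2 ⟨_, rfl⟩

theorem exists_of_zero (h : IsClass μ 0) :
    ∃ φ : G → Circle, ∀ g h, μ g h = φ g * φ h * (φ (g * h))⁻¹ := by
  obtain ⟨c, hc, h0⟩ := h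
  obtain ⟨φ, hφ⟩ := (groupCohomology.H2π_eq_zero_iff _).1 h0
  let ψ : G → Circle := fun g => Additive.toMul (α := Circle) (φ g)
  refine ⟨ψ, fun g h => ?_⟩
  have h1 : φ h - φ (g * h) + φ g = Additive.ofMul (μ g h) := by
    rw [← hc]; exact congrFun hφ (g, h)
  have h2 : ψ h / ψ (g * h) * ψ g = μ g h := congrArg (Additive.toMul (α := Circle)) h1
  rw [← h2, div_eq_mul_inv]
  ac_rfl

end IsClass

/-! ### Matrix units -/

namespace Amplify

variable {X : Type}

theorem matrixUnit_mul [DecidableEq X] (a b c d : X) :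
    matrixUnit a b * matrixUnit c d = if b = c then matrixUnit a d else 0 := by
  refine op_ext fun x => ?_
  rw [mul_apply_eq_comp, matrixUnit_ket]
  by_cases hd : d = x
  · rw [if_pos hd, matrixUnit_ket]
    by_cases hb : b = c
    · rw [if_pos hb, if_pos hb, matrixUnit_ket, if_pos hd]
    · rw [if_neg hb, if_neg hb]; simp
  · rw [if_neg hd, map_zero]
    by_cases hb : b = c
    · rw [if_pos hb, matrixUnit_ket, if_neg hd]
    · rw [if_neg hb]; simp

theorem sum_matrixUnit [Fintype X] : ∑ x : X, matrixUnit x x = 1 := by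
  classical
  refine op_ext fun x => ?_
  rw [sum_apply]
  simp [matrixUnit_ket]

theorem star_matrixUnit (a b : X) : star (matrixUnit a b) = matrixUnit b a := by
  refine ((ContinuousLinearMap.eq_adjoint_iff _ _).2 fun φ ψ => ?_).symm
  simp [matrixUnit, inner_smul_left, inner_smul_right, mul_comm]

theorem matrixUnit_mul_mul (a : Op X) (i j k l : X) :
    matrixUnit i j * a * matrixUnit k l = a (ket k) j • matrixUnit i l := by
  classical
  refine op_ext fun x => ?_
  rw [mul_apply_eq_comp, mul_apply_eq_comp, matrixUnit_ket, smul_apply, matrixUnit_ket]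
  by_cases h : l = x
  · rw [if_pos h, if_pos h]
    simp only [matrixUnit, ContinuousLinearMap.smulRight_apply, innerSL_apply_apply, ket]
    rw [lp.inner_single_left]
    simp
  · simp [h]

end Amplify

open Amplify in
/-- Slicing an element of an algebra along the matrix units of a matrix subalgebra: the sums
`∑ₖ eₖᵢ b eⱼₖ` are the coefficients of `b` in the commutant of the matrix subalgebra. -/
def matrixCoeff {A : Type*} [CStarAlgebra A] {X : Type} [Fintype X] (f : Op X →⋆ₐ[ℂ] A) (i j : X)
    (b : A) : A := ∑ k, f (matrixUnit k i) * b * f (matrixUnit j k)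

section MatrixCoeff

open Amplify

variable {A : Type*} [CStarAlgebra A] {X : Type} [Fintype X] (f : Op X →⋆ₐ[ℂ] A)

theorem matrixCoeff_commute_unit (i j p q : X) (b : A) :
    matrixCoeff f i j b * f (matrixUnit p q) = f (matrixUnit p q) * matrixCoeff f i j b := by
  classical
  rw [matrixCoeff, Finset.sum_mul, Finset.mul_sum]
  have h1 : ∀ k, f (matrixUnit k i) * b * f (matrixUnit j k) * f (matrixUnit p q) =
      if k = p then f (matrixUnit k i) * b * f (matrixUnit j q) else 0 := fun k => by
    rw [mul_assoc, ← map_mul, matrixUnit_mul]; split_ifs <;> simp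
  have h2 : ∀ k, f (matrixUnit p q) * (f (matrixUnit k i) * b * f (matrixUnit j k)) =
      if q = k then f (matrixUnit p i) * b * f (matrixUnit j k) else 0 := fun k => by
    rw [← mul_assoc, ← mul_assoc, ← map_mul, matrixUnit_mul]; split_ifs <;> simp
  rw [Finset.sum_congr rfl fun k _ => h1 k, Finset.sum_congr rfl fun k _ => h2 k]
  simp

theorem matrixCoeff_commute (i j : X) (b : A) (a : Op X) :
    matrixCoeff f i j b * f a = f a * matrixCoeff f i j b := by
  rw [op_eq_sum a]
  simp only [map_sum, map_smul, Finset.sum_mul, Finset.mul_sum, smul_mul_assoc, mul_smul_comm,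
    matrixCoeff_commute_unit]

theorem matrixCoeff_mem_centralizer (i j : X) (b : A) :
    matrixCoeff f i j b ∈ StarSubalgebra.centralizer ℂ (f.range : Set A) := by
  rw [StarSubalgebra.mem_centralizer_iff]
  rintro _ ⟨a, rfl⟩
  refine ⟨(matrixCoeff_commute f i j b a).symm, ?_⟩
  change star (f a) * _ = _ * star (f a)
  rw [← map_star]
  exact (matrixCoeff_commute f i j b (star a)).symm

theorem eq_sum_matrixCoeff (b : A) :
    b = ∑ i, ∑ j, matrixCoeff f i j b * f (matrixUnit i j) := by
  classical
  have h1 : ∀ i j, matrixCoeff f i j b * f (matrixUnit i j) =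
      f (matrixUnit i i) * b * f (matrixUnit j j) := fun i j => by
    rw [matrixCoeff, Finset.sum_mul, Finset.sum_eq_single i]
    · rw [mul_assoc, ← map_mul, matrixUnit_mul, if_pos rfl]
    · intro k _ hk
      rw [mul_assoc, ← map_mul, matrixUnit_mul, if_neg hk, map_zero, mul_zero]
    · simp
  simp only [h1]
  simp only [← Finset.mul_sum, ← Finset.sum_mul, ← map_sum, sum_matrixUnit, map_one, one_mul,
    mul_one]

theorem matrixCoeff_of_commute (i : X) {b : A}
    (hb : ∀ a, b * f a = f a * b) : matrixCoeff f i i b = b := by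
  classical
  have h1 : ∀ k, f (matrixUnit k i) * b * f (matrixUnit i k) = f (matrixUnit k k) * b := fun k => by
    rw [mul_assoc, hb, ← mul_assoc, ← map_mul, matrixUnit_mul, if_pos rfl]
  rw [matrixCoeff, Finset.sum_congr rfl fun k _ => h1 k, ← Finset.sum_mul, ← map_sum,
    sum_matrixUnit, map_one, one_mul]

theorem matrixCoeff_map (i j : X) (a : Op X) :
    matrixCoeff f i j (f a) = a (ket j) i • (1 : A) := by
  classical
  simp only [matrixCoeff, ← map_mul, matrixUnit_mul_mul, map_smul, ← Finset.smul_sum, ← map_sum,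
    sum_matrixUnit, map_one]

theorem matrixCoeff_map_mul (i j : X) (a : Op X) {b : A} (hb : ∀ a, b * f a = f a * b) :
    matrixCoeff f i j (f a * b) = a (ket j) i • b := by
  classical
  have : matrixCoeff f i j (f a * b) = matrixCoeff f i j (f a) * b := by
    rw [matrixCoeff, matrixCoeff, Finset.sum_mul]
    refine Finset.sum_congr rfl fun k _ => ?_
    rw [mul_assoc, mul_assoc, hb, ← mul_assoc, ← mul_assoc]
  rw [this, matrixCoeff_map, smul_mul_assoc, one_mul]

theorem injective_of_matrix [Nontrivial A] : Function.Injective f := by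
  classical
  refine (injective_iff_map_eq_zero f).2 fun a ha => ?_
  rw [op_eq_sum a]
  refine Finset.sum_eq_zero fun i _ => Finset.sum_eq_zero fun j _ => ?_
  have := matrixCoeff_map f i j a
  rw [ha] at this
  have h0 : matrixCoeff f i j (0 : A) = 0 := by simp [matrixCoeff]
  rw [h0, eq_comm, smul_eq_zero] at this
  rw [this.resolve_right one_ne_zero, zero_smul]

/-- Slicing at a diagonal matrix unit is a contraction. -/
theorem norm_matrixCoeff_le [Nontrivial A] (i : X) (b : A) : ‖matrixCoeff f i i b‖ ≤ ‖b‖ := by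
  classical
  set e := f (matrixUnit i i) with he
  have hee : e * e = e := by rw [he, ← map_mul, matrixUnit_mul, if_pos rfl]
  have hse : star e = e := by rw [he, ← map_star, star_matrixUnit]
  have hle : ‖e‖ ≤ 1 := by
    have h := CStarRing.norm_star_mul_self (x := e)
    rw [hse, hee] at h
    by_contra hc
    nlinarith [norm_nonneg e]
  set C := StarSubalgebra.centralizer ℂ (f.range : Set A) with hC
  have hCc : IsClosed (C : Set A) := by
    have : (C : Set A) = ⋂ a : Op X, ({x | f a * x = x * f a} ∩ {x | star (f a) * x = x * star (f a)}) := by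
      ext x
      simp only [SetLike.mem_coe, hC, StarSubalgebra.mem_centralizer_iff, Set.mem_iInter]
      exact ⟨fun h a => h _ ⟨a, rfl⟩, by rintro h _ ⟨a, rfl⟩; exact h a⟩
    rw [this]
    refine isClosed_iInter fun a => IsClosed.inter ?_ ?_ <;>
    exact isClosed_eq (by fun_prop) (by fun_prop)
  let : CStarAlgebra C := StarSubalgebra.cstarAlgebra _ (h_closed := hCc)
  have hcomm : ∀ c : C, ∀ a, (c : A) * f a = f a * c := fun c a =>
    ((StarSubalgebra.mem_centralizer_iff ℂ).1 c.2 _ ⟨a, rfl⟩).1.symm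
  -- compression of the commutant to the corner of a minimal projection is isometric
  let φ : C →⋆ₙₐ[ℂ] A :=
    { toFun := fun c => c * e
      map_smul' := fun r c => by simp
      map_zero' := by simp
      map_add' := fun a b => by simp [add_mul]
      map_mul' := fun a b => by
        change (a : A) * b * e = a * e * (b * e)
        rw [mul_assoc (a : A) e, ← mul_assoc e, ← hcomm b, mul_assoc (b : A), hee, mul_assoc]
      map_star' := fun a => by
        change star (a : A) * e = star ((a : A) * e)
        rw [star_mul, hse]
        exact hcomm (star a) _ }
  have hφ : Function.Injective φ := by
    refine (injective_iff_map_eq_zero φ).2 fun c hc => Subtype.ext ?_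
    have hc' : (c : A) * e = 0 := hc
    have : (c : A) = ∑ k, f (matrixUnit k i) * ((c : A) * e) * f (matrixUnit i k) := by
      have h1 : ∀ k, f (matrixUnit k i) * ((c : A) * e) * f (matrixUnit i k) =
          f (matrixUnit k k) * c := fun k => by
        rw [hcomm, mul_assoc, mul_assoc, hcomm, ← mul_assoc, ← mul_assoc, ← map_mul, ← map_mul,
          matrixUnit_mul, if_pos rfl, matrixUnit_mul, if_pos rfl]
      rw [Finset.sum_congr rfl fun k _ => h1 k, ← Finset.sum_mul, ← map_sum, sum_matrixUnit,
        map_one, one_mul]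
    rw [this, hc']
    simp
  have hn := NonUnitalStarAlgHom.norm_map φ hφ ⟨_, matrixCoeff_mem_centralizer f i i b⟩
  have h1 : ‖matrixCoeff f i i b‖ = ‖matrixCoeff f i i b * e‖ := hn.symm
  have h2 : matrixCoeff f i i b * e = e * b * e := by
    rw [matrixCoeff, Finset.sum_mul, Finset.sum_eq_single i]
    · rw [he, mul_assoc, ← map_mul, matrixUnit_mul, if_pos rfl]
    · intro k _ hk
      rw [he, mul_assoc, ← map_mul, matrixUnit_mul, if_neg hk, map_zero, mul_zero]
    · simp
  rw [h1, h2]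
  calc ‖e * b * e‖ ≤ ‖e‖ * ‖b‖ * ‖e‖ := (norm_mul_le _ _).trans (by gcongr; exact norm_mul_le _ _)
    _ ≤ 1 * ‖b‖ * 1 := by gcongr
    _ = ‖b‖ := by ring

end MatrixCoeff

/-! ### Matrix subalgebras of a C⋆-algebra -/

section Matrix

open Amplify

variable {A : Type*} [CStarAlgebra A]

/-- A star subalgebra is a matrix algebra if it is the image of the operators on a
finite-dimensional Hilbert space under a unital homomorphism. -/
def IsMatrix (B : StarSubalgebra ℂ A) : Prop :=
  ∃ (X : Type) (_ : Fintype X) (f : Op X →⋆ₐ[ℂ] A), f.range = B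

/-- The center of a star subalgebra consists of scalars. -/
def HasTrivialCenter (B : StarSubalgebra ℂ A) : Prop :=
  ∀ z ∈ B, (∀ b ∈ B, z * b = b * z) → ∃ c : ℂ, z = c • 1

theorem mem_centralizer_of_comm {B : StarSubalgebra ℂ A} {z : A} (h : ∀ b ∈ B, b * z = z * b) :
    z ∈ StarSubalgebra.centralizer ℂ (B : Set A) :=
  (StarSubalgebra.mem_centralizer_iff ℂ).2 fun b hb => ⟨h b hb, h _ (star_mem hb)⟩

theorem comm_of_mem_centralizer {B : StarSubalgebra ℂ A} {z b : A}
    (h : z ∈ StarSubalgebra.centralizer ℂ (B : Set A)) (hb : b ∈ B) : b * z = z * b :=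
  ((StarSubalgebra.mem_centralizer_iff ℂ).1 h b hb).1

theorem IsMatrix.map {A' : Type*} [CStarAlgebra A'] {B : StarSubalgebra ℂ A} (h : IsMatrix B)
    (Φ : A →⋆ₐ[ℂ] A') : IsMatrix (B.map Φ) := by
  obtain ⟨X, hX, f, rfl⟩ := h
  refine ⟨X, hX, Φ.comp f, ?_⟩
  ext y
  constructor
  · rintro ⟨a, rfl⟩; exact ⟨f a, ⟨a, rfl⟩, rfl⟩
  · rintro ⟨_, ⟨a, rfl⟩, rfl⟩; exact ⟨a, rfl⟩

theorem IsMatrix.nonempty [Nontrivial A] {X : Type} (f : Op X →⋆ₐ[ℂ] A) : Nonempty X := by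
  by_contra h
  rw [not_nonempty_iff] at h
  have h1 : (1 : Op X) = 0 := op_ext fun x => (h.false x).elim
  have := congrArg f h1
  rw [map_one, map_zero] at this
  exact one_ne_zero this

theorem IsMatrix.hasTrivialCenter [Nontrivial A] {B : StarSubalgebra ℂ A} (h : IsMatrix B) :
    HasTrivialCenter B := by
  obtain ⟨X, hX, f, rfl⟩ := h
  rintro _ ⟨a, rfl⟩ hc
  obtain ⟨i⟩ := IsMatrix.nonempty f
  refine ⟨a (ket i) i, ?_⟩
  rw [← matrixCoeff_map f i i a]
  exact (matrixCoeff_of_commute f i fun b => hc _ ⟨b, rfl⟩).symm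

/-- An algebra containing a matrix algebra `M` is generated by `M` and the relative commutant
of `M`. -/
theorem IsMatrix.le_of_le {M B K : StarSubalgebra ℂ A} (hM : IsMatrix M) (hMB : M ≤ B)
    (hMK : M ≤ K) (hK : B ⊓ StarSubalgebra.centralizer ℂ (M : Set A) ≤ K) : B ≤ K := by
  obtain ⟨X, hX, f, rfl⟩ := hM
  intro b hb
  rw [eq_sum_matrixCoeff f b]
  refine sum_mem fun i _ => sum_mem fun j _ => mul_mem (hK ⟨?_, ?_⟩) (hMK ⟨_, rfl⟩)
  · exact sum_mem fun k _ => mul_mem (mul_mem (hMB ⟨_, rfl⟩) hb) (hMB ⟨_, rfl⟩)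
  · exact matrixCoeff_mem_centralizer f i j b

/-- Every endomorphism of a matrix algebra is inner. -/
theorem IsMatrix.exists_unitary [Nontrivial A] {B : StarSubalgebra ℂ A} (h : IsMatrix B)
    (θ : A →⋆ₐ[ℂ] A) (hθ : ∀ b ∈ B, θ b ∈ B) :
    ∃ u : unitary A, (u : A) ∈ B ∧ ∀ b ∈ B, θ b = u * b * star (u : A) := by
  obtain ⟨X, hX, f, rfl⟩ := h
  have hf := injective_of_matrix f
  let E : Op X ≃⋆ₐ[ℂ] f.range := StarAlgEquiv.ofInjective f hf
  have hE : ∀ a, (E a : A) = f a := fun a => rfl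
  let φ : Op X →⋆ₐ[ℂ] Op X :=
    (E.symm : f.range →⋆ₐ[ℂ] Op X).comp ((θ.comp f).codRestrict f.range fun a => hθ _ ⟨a, rfl⟩)
  have hφ : ∀ a, f (φ a) = θ (f a) := fun a => by
    rw [← hE]
    change ((E (E.symm _) : f.range) : A) = _
    rw [E.apply_symm_apply]
    rfl
  have hnt : Nontrivial (Op X) := ⟨1, 0, fun h => one_ne_zero (α := A) (by
    rw [← map_one f, h, map_zero])⟩
  have hinj : Function.Injective φ := injective_of_matrix φ
  have hsurj : Function.Surjective φ :=
    (LinearMap.injective_iff_surjective (f := φ.toAlgHom.toLinearMap)).1 hinj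
  obtain ⟨U, hU⟩ := StarAlgEquiv.eq_linearIsometryEquivConjStarAlgEquiv
    (StarAlgEquiv.ofBijective φ ⟨hinj, hsurj⟩) (SpinChain.continuous_hom φ)
  rw [← Unitary.conjStarAlgAut_symm_unitaryLinearIsometryEquiv] at hU
  set V := Unitary.linearIsometryEquiv.symm U
  have hV : ∀ a, φ a = V * a * star (V : Op X) := fun a => DFunLike.congr_fun hU a
  refine ⟨⟨f V, Unitary.map_mem f V.2⟩, ⟨_, rfl⟩, ?_⟩
  rintro _ ⟨a, rfl⟩
  change θ (f a) = f V * f a * star (f V)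
  rw [← hφ, hV, map_mul, map_mul, map_star]

/-- An element which commutes with `z` elementwise on a star subalgebra also commutes with `z*`, so
that the subalgebra lies in the star-closed centralizer of `{z}`. -/
theorem le_centralizer_of_generate {B : StarSubalgebra ℂ A} {z : A}
    (h : ∀ b ∈ B, b * z = z * b) : B ≤ StarSubalgebra.centralizer ℂ ({z} : Set A) := by
  intro b hb
  rw [StarSubalgebra.mem_centralizer_iff]
  rintro _ rfl
  refine ⟨(h b hb).symm, ?_⟩
  have := congrArg star (h _ (star_mem hb))
  rwa [star_mul, star_mul, star_star] at this

end Matrix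

/-! ### Projective implementation of a group action on a subalgebra -/

section Projective

variable {G : Type} [Group G] {A : Type*} [CStarAlgebra A]

/-- The automorphism `x ↦ u x u*`. -/
abbrev conjAut (u : unitary A) : A ≃⋆ₐ[ℂ] A := Unitary.conjStarAlgAut ℂ A u

/-- Unitaries `W(g)` of `B` implementing the action `β` on `B`. -/
def Implements (β : G →* (A ≃⋆ₐ[ℂ] A)) (B : StarSubalgebra ℂ A) (W : G → unitary A) : Prop :=
  ∀ g, (W g : A) ∈ B ∧ ∀ p ∈ B, β g p = W g * p * star (W g : A)

/-- The unitaries `W(g)` are multiplicative up to the phases `μ(g, h)`. -/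
def IsProjective (W : G → unitary A) (μ : G → G → Circle) : Prop :=
  ∀ g h, (W g * W h : A) = ((μ g h : Circle) : ℂ) • (W (g * h) : A)

/-- The subalgebra `B` has trivial center, and the action `β` on it is implemented by unitaries of
`B` which are projective with a 2-cocycle of class `κ`. -/
def HasClass (β : G →* (A ≃⋆ₐ[ℂ] A)) (B : StarSubalgebra ℂ A) (κ : H2U1 G) : Prop :=
  HasTrivialCenter B ∧ ∃ W μ, Implements β B W ∧ IsProjective W μ ∧ IsClass μ κ

theorem star_mul_val (u : unitary A) : star (u : A) * u = 1 := Unitary.star_mul_self_of_mem u.2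

theorem mul_star_val (u : unitary A) : (u : A) * star (u : A) = 1 := Unitary.mul_star_self_of_mem u.2

theorem circle_star_mul (c : Circle) : star (c : ℂ) * c = 1 := by
  have h := Circle.coe_inv_eq_conj c
  change (starRingEnd ℂ) (c : ℂ) * c = 1
  rw [← h, ← Circle.coe_mul, inv_mul_cancel, Circle.coe_one]

theorem star_mul_self_cancel (u : unitary A) (x : A) : star (u : A) * ((u : A) * x) = x := by
  rw [← mul_assoc, star_mul_val, one_mul]

theorem mul_star_self_cancel (u : unitary A) (x : A) : (u : A) * (star (u : A) * x) = x := by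
  rw [← mul_assoc, mul_star_val, one_mul]

theorem mul_star_self_cancel_right (u : unitary A) (x : A) : x * (u : A) * star (u : A) = x := by
  rw [mul_assoc, mul_star_val, mul_one]

theorem star_mul_self_cancel_right (u : unitary A) (x : A) : x * star (u : A) * (u : A) = x := by
  rw [mul_assoc, star_mul_val, mul_one]

theorem unitary_smul_inj [Nontrivial A] (u : unitary A) {c d : ℂ} (h : c • (u : A) = d • (u : A)) :
    c = d := by
  have h1 := congrArg (· * star (u : A)) h
  simp only [smul_mul_assoc, mul_star_val] at h1
  exact smul_left_injective ℂ (one_ne_zero (α := A)) h1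

theorem exists_circle_of_smul_one [Nontrivial A] {c : ℂ} {z : A} (hz : z ∈ unitary A)
    (h : z = c • 1) : ∃ φ : Circle, z = (φ : ℂ) • (1 : A) := by
  have h1 : star z * z = 1 := Unitary.star_mul_self_of_mem hz
  rw [h, star_smul, star_one, smul_mul_smul_comm, mul_one] at h1
  have h2 : star c * c = 1 := by
    have := smul_left_injective ℂ (one_ne_zero (α := A)) (h1.trans (one_smul ℂ (1 : A)).symm)
    simpa using this
  have h3 : ‖c‖ = 1 := by
    have := congrArg norm h2
    rw [norm_mul, norm_star, norm_one] at this
    nlinarith [norm_nonneg c]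
  exact ⟨⟨c, mem_sphere_zero_iff_norm.2 h3⟩, h⟩

theorem Implements.apply_mem {β : G →* (A ≃⋆ₐ[ℂ] A)} {B : StarSubalgebra ℂ A} {W : G → unitary A}
    (h : Implements β B W) (g : G) {p : A} (hp : p ∈ B) : β g p ∈ B := by
  rw [(h g).2 p hp]
  exact mul_mem (mul_mem (h g).1 hp) (star_mem (h g).1)

/-- Two unitaries of `B` implementing the same automorphism differ by a phase. -/
theorem exists_phase [Nontrivial A] {B : StarSubalgebra ℂ A} (hB : HasTrivialCenter B)
    (u v : unitary A) (hu : (u : A) ∈ B) (hv : (v : A) ∈ B)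
    (h : ∀ p ∈ B, (u : A) * p * star (u : A) = v * p * star (v : A)) :
    ∃ φ : Circle, (v : A) = (φ : ℂ) • (u : A) := by
  have hz : star (u : A) * v ∈ B := mul_mem (star_mem hu) hv
  obtain ⟨c, hc⟩ := hB _ hz fun b hb => by
    have h1 := congrArg (fun x => star (u : A) * x * v) (h b hb)
    simp only [mul_assoc, star_mul_self_cancel, star_mul_val, mul_one] at h1
    simpa only [mul_assoc] using h1.symm
  obtain ⟨φ, hφ⟩ := exists_circle_of_smul_one
    (mul_mem (Unitary.star_mem u.2) v.2) hc
  refine ⟨φ, ?_⟩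
  rw [← mul_star_self_cancel u (v : A), hφ, mul_smul_comm, mul_one]

/-- The class does not depend on the choice of the implementing unitaries. -/
theorem HasClass.of_implements [Nontrivial A] {β : G →* (A ≃⋆ₐ[ℂ] A)} {B : StarSubalgebra ℂ A}
    {κ : H2U1 G} (h : HasClass β B κ) {W : G → unitary A} (hW : Implements β B W) :
    ∃ μ, IsProjective W μ ∧ IsClass μ κ := by
  obtain ⟨hB, V, ν, hV, hν, hκ⟩ := h
  have hφ : ∀ g, ∃ φ : Circle, (W g : A) = (φ : ℂ) • (V g : A) := fun g =>
    exists_phase hB (V g) (W g) (hV g).1 (hW g).1 fun p hp => by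
      rw [← (hV g).2 p hp, ← (hW g).2 p hp]
  choose φ hφ using hφ
  refine ⟨fun g h => φ g * φ h * (φ (g * h))⁻¹ * ν g h, fun g h => ?_, ?_⟩
  · rw [hφ g, hφ h, hφ (g * h), smul_mul_smul_comm, hν, smul_smul, smul_smul]
    congr 1
    push_cast
    have : ((φ (g * h) : Circle) : ℂ) ≠ 0 := Circle.coe_ne_zero _
    field_simp
  · simpa using (IsClass.coboundary φ).mul hκ

theorem HasClass.unique [Nontrivial A] {β : G →* (A ≃⋆ₐ[ℂ] A)} {B : StarSubalgebra ℂ A}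
    {κ κ' : H2U1 G} (h : HasClass β B κ) (h' : HasClass β B κ') : κ = κ' := by
  obtain ⟨hB, V, ν, hV, hν, hκ⟩ := h'
  obtain ⟨μ, hμ, hμ'⟩ := h.of_implements hV
  have : μ = ν := by
    funext a b
    exact Circle.ext (unitary_smul_inj _ ((hμ a b).symm.trans (hν a b)))
  exact hμ'.unique (this ▸ hκ)

/-- Unitaries implementing a group action on a subalgebra with trivial center are projective: the
phases comparing `W(g) W(h)` with `W(gh)` form a cocycle by associativity. -/
theorem HasClass.exists_of_implements [Nontrivial A] {β : G →* (A ≃⋆ₐ[ℂ] A)}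
    {B : StarSubalgebra ℂ A} (hB : HasTrivialCenter B) {W : G → unitary A}
    (hW : Implements β B W) : ∃ κ, HasClass β B κ := by
  have hμ : ∀ g h, ∃ μ : Circle, (W g * W h : A) = ((μ : Circle) : ℂ) • (W (g * h) : A) :=
    fun g h => exists_phase hB (W (g * h)) (W g * W h) (hW _).1 (mul_mem (hW _).1 (hW _).1)
      fun p hp => by
        rw [← (hW (g * h)).2 p hp, map_mul]
        change β g (β h p) = _
        rw [(hW g).2 _ (hW.apply_mem h hp), (hW h).2 p hp]
        simp only [Submonoid.coe_mul, star_mul, mul_assoc]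
  choose μ hμ using hμ
  obtain ⟨κ, hκ⟩ := IsClass.of_cocycle (μ := μ) fun a b c => by
    have h1 : (W a * W b * W c : A) = W a * (W b * W c) := mul_assoc _ _ _
    rw [hμ a b, hμ b c, smul_mul_assoc, mul_smul_comm, hμ, hμ, smul_smul, smul_smul,
      mul_assoc a b c] at h1
    have := unitary_smul_inj _ h1
    apply Circle.ext
    push_cast
    rw [mul_comm, this]
  exact ⟨κ, hB, W, μ, hW, hμ, hκ⟩

theorem HasClass.exists_of_isMatrix [Nontrivial A] {β : G →* (A ≃⋆ₐ[ℂ] A)}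
    {B : StarSubalgebra ℂ A} (hB : IsMatrix B) (hβ : ∀ g, ∀ b ∈ B, β g b ∈ B) :
    ∃ κ, HasClass β B κ := by
  choose W hW using fun g => hB.exists_unitary (β g : A →⋆ₐ[ℂ] A) (hβ g)
  exact HasClass.exists_of_implements hB.hasTrivialCenter (W := W) hW

/-- A linear implementation by unitaries of the subalgebra exists when the class vanishes. -/
theorem HasClass.exists_hom [Nontrivial A] {β : G →* (A ≃⋆ₐ[ℂ] A)} {B : StarSubalgebra ℂ A}
    (h : HasClass β B 0) : ∃ W : G →* unitary A, Implements β B W := by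
  obtain ⟨-, W, μ, hW, hμ, hκ⟩ := h
  obtain ⟨φ, hφ⟩ := hκ.exists_of_zero
  have hu : ∀ c : Circle, ∀ u : unitary A, (c : ℂ) • (u : A) ∈ unitary A := fun c u => by
    rw [Unitary.mem_iff]
    have hc := circle_star_mul c
    constructor <;> rw [star_smul, smul_mul_smul_comm]
    · rw [hc, star_mul_val, one_smul]
    · rw [mul_comm, hc, mul_star_val, one_smul]
  refine ⟨MonoidHom.mk' (fun g => ⟨_, hu (φ g)⁻¹ (W g)⟩) fun a b => Subtype.ext ?_, fun g => ⟨?_, ?_⟩⟩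
  · change (((φ (a * b))⁻¹ : Circle) : ℂ) • (W (a * b) : A) =
      (((φ a)⁻¹ : Circle) : ℂ) • (W a : A) * (((φ b)⁻¹ : Circle) : ℂ) • (W b : A)
    rw [smul_mul_smul_comm, hμ, smul_smul, hφ]
    congr 1
    have h1 := Circle.coe_ne_zero (φ a)
    have h2 := Circle.coe_ne_zero (φ b)
    push_cast
    field_simp
  · exact StarSubalgebra.smul_mem _ (hW g).1 _
  · intro p hp
    change β g p = (((φ g)⁻¹ : Circle) : ℂ) • (W g : A) * p *
      star ((((φ g)⁻¹ : Circle) : ℂ) • (W g : A))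
    have hc : (((φ g)⁻¹ : Circle) : ℂ) * star (((φ g)⁻¹ : Circle) : ℂ) = 1 := by
      rw [mul_comm, circle_star_mul]
    rw [star_smul, smul_mul_assoc, smul_mul_smul_comm, hc, one_smul, (hW g).2 p hp]

/-- Classes of commuting subalgebras `M`, `C` add up to the class of the algebra they generate. -/
theorem HasClass.add {β : G →* (A ≃⋆ₐ[ℂ] A)} {M C B : StarSubalgebra ℂ A}
    {κ κ' : H2U1 G} (hM : HasClass β M κ) (hC : HasClass β C κ') (hB : HasTrivialCenter B)
    (hMB : M ≤ B) (hCB : C ≤ B) (hcomm : ∀ m ∈ M, ∀ c ∈ C, m * c = c * m)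
    (hgen : ∀ K : StarSubalgebra ℂ A, IsClosed (K : Set A) → M ≤ K → C ≤ K → B ≤ K) :
    HasClass β B (κ + κ') := by
  obtain ⟨-, U, μ, hU, hμ, hκ⟩ := hM
  obtain ⟨-, V, ν, hV, hν, hκ'⟩ := hC
  refine ⟨hB, fun g => U g * V g, fun g h => μ g h * ν g h, fun g => ⟨?_, ?_⟩, fun g h => ?_,
    hκ.mul hκ'⟩
  · exact mul_mem (hMB (hU g).1) (hCB (hV g).1)
  · let φ : A →⋆ₐ[ℂ] A := (β g : A →⋆ₐ[ℂ] A)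
    let ψ : A →⋆ₐ[ℂ] A := (conjAut (U g * V g) : A →⋆ₐ[ℂ] A)
    refine hgen (StarAlgHom.equalizer φ ψ) ?_ ?_ ?_
    · exact isClosed_eq (SpinChain.continuous_hom φ) (SpinChain.continuous_hom ψ)
    · intro m hm
      change β g m = (U g * V g : A) * m * star (U g * V g : A)
      rw [(hU g).2 m hm, star_mul, mul_assoc (U g : A) (V g : A), ← hcomm m hm _ (hV g).1]
      simp only [mul_assoc, mul_star_self_cancel]
    · intro c hc
      change β g c = (U g * V g : A) * c * star (U g * V g : A)
      have h1 : (V g : A) * c * star (V g : A) ∈ C :=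
        mul_mem (mul_mem (hV g).1 hc) (star_mem (hV g).1)
      rw [(hV g).2 c hc, star_mul]
      calc (V g : A) * c * star (V g : A) = (V g * c * star (V g : A)) * U g * star (U g : A) := by
            rw [mul_star_self_cancel_right]
        _ = _ := by rw [← hcomm _ (hU g).1 _ h1]; simp only [mul_assoc]
  · change (U g * V g : A) * (U h * V h : A) = _ • (U (g * h) * V (g * h) : A)
    calc (U g * V g : A) * (U h * V h : A) = U g * (V g * U h) * V h := by simp only [mul_assoc]
      _ = (U g * U h) * (V g * V h) := by
        rw [← hcomm _ (hU h).1 _ (hV g).1]; simp only [mul_assoc]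
      _ = _ := by
        rw [hμ, hν, smul_mul_smul_comm]
        push_cast
        rfl

/-- The class of the relative commutant of a matrix subalgebra. -/
theorem HasClass.sub {β : G →* (A ≃⋆ₐ[ℂ] A)} {M B : StarSubalgebra ℂ A}
    {κ κ' : H2U1 G} (hMm : IsMatrix M) (hM : HasClass β M κ) (hB : HasClass β B κ') (hMB : M ≤ B) :
    HasClass β (B ⊓ StarSubalgebra.centralizer ℂ (M : Set A)) (κ' - κ) := by
  obtain ⟨-, U, μ, hU, hμ, hκ⟩ := hM
  obtain ⟨hBc, W, ν, hW, hν, hκ'⟩ := hB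
  have hV : ∀ g, ((star (U g) * W g : unitary A) : A) ∈
      B ⊓ StarSubalgebra.centralizer ℂ (M : Set A) := fun g => by
    refine ⟨mul_mem (star_mem (hMB (hU g).1)) (hW g).1, mem_centralizer_of_comm fun m hm => ?_⟩
    have h1 := ((hU g).2 m hm).symm.trans ((hW g).2 m (hMB hm))
    have h2 := congrArg (fun x => star (U g : A) * x * W g) h1
    simp only [mul_assoc, star_mul_self_cancel, star_mul_val, mul_one] at h2
    change m * (star (U g : A) * W g) = star (U g : A) * W g * m
    simpa only [mul_assoc] using h2
  refine ⟨?_, fun g => star (U g) * W g, fun g h => ν g h * (μ g h)⁻¹, fun g => ⟨hV g, ?_⟩,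
    fun g h => ?_, ?_⟩
  · intro z hz hzc
    refine hBc z hz.1 fun b hb => ?_
    have := hMm.le_of_le (K := StarSubalgebra.centralizer ℂ ({z} : Set A)) hMB
      (le_centralizer_of_generate fun m hm => comm_of_mem_centralizer hz.2 hm)
      (le_centralizer_of_generate fun c hc => (hzc c hc).symm) hb
    exact ((StarSubalgebra.mem_centralizer_iff ℂ).1 this z rfl).1
  · intro p hp
    have h1 : β g p = (U g : A) * ((star (U g : A) * W g) * p * star (star (U g : A) * W g)) *
        star (U g : A) := by
      rw [(hW g).2 p hp.1, star_mul, star_star]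
      simp only [mul_assoc, mul_star_self_cancel, mul_star_val, mul_one]
    rw [h1]
    have h2 := comm_of_mem_centralizer
      (mul_mem (mul_mem (hV g) hp) (star_mem (hV g))).2 (hU g).1
    change (U g : A) * ((star (U g : A) * W g) * p * star (star (U g : A) * W g)) =
      ((star (U g : A) * W g) * p * star (star (U g : A) * W g)) * U g at h2
    rw [h2, mul_star_self_cancel_right]
    rfl
  · have h2 := comm_of_mem_centralizer (hV g).2 (hU h).1
    change (U h : A) * (star (U g : A) * W g) = (star (U g : A) * W g) * U h at h2
    have e1 : (W g * W h : A) = U g * ((star (U g : A) * W g) * U h) * (star (U h : A) * W h) := by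
      simp only [mul_assoc, mul_star_self_cancel]
    rw [← h2, hν] at e1
    have e2 : (((ν g h : Circle)) : ℂ) • (W (g * h) : A) = ((μ g h : Circle) : ℂ) •
        (U (g * h) * ((star (U g : A) * W g) * (star (U h : A) * W h))) := by
      rw [e1, ← smul_mul_assoc, ← hμ]; simp only [mul_assoc]
    have e3 := congrArg (fun x => (((μ g h)⁻¹ : Circle) : ℂ) • (star (U (g * h) : A) * x)) e2
    simp only [mul_smul_comm, star_mul_self_cancel, smul_smul] at e3
    rw [← Circle.coe_mul, ← Circle.coe_mul, inv_mul_cancel, Circle.coe_one, one_smul] at e3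
    change (star (U g : A) * W g) * (star (U h : A) * W h) = _ • (star (U (g * h) : A) * W (g * h))
    rw [← e3, mul_comm]
  · rw [sub_eq_add_neg]; exact hκ'.mul hκ.inv

/-- Transport of the class along an injective equivariant homomorphism. -/
theorem HasClass.map {A' : Type*} [CStarAlgebra A'] {β : G →* (A ≃⋆ₐ[ℂ] A)}
    {β' : G →* (A' ≃⋆ₐ[ℂ] A')} {B : StarSubalgebra ℂ A} {κ : H2U1 G} (h : HasClass β B κ)
    (Φ : A →⋆ₐ[ℂ] A') (hΦ : Function.Injective Φ) (hβ : ∀ g, ∀ a ∈ B, Φ (β g a) = β' g (Φ a)) :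
    HasClass β' (B.map Φ) κ := by
  obtain ⟨hB, W, μ, hW, hμ, hκ⟩ := h
  refine ⟨?_, fun g => ⟨Φ (W g), Unitary.map_mem Φ (W g).2⟩, μ, fun g => ⟨⟨_, (hW g).1, rfl⟩, ?_⟩,
    fun g h => ?_, hκ⟩
  · rintro _ ⟨z, hz, rfl⟩ hc
    obtain ⟨c, hc⟩ := hB z hz fun b hb => hΦ (by
      rw [map_mul, map_mul]; exact hc _ ⟨b, hb, rfl⟩)
    refine ⟨c, ?_⟩
    change Φ z = _
    rw [hc, map_smul, map_one]
  · rintro _ ⟨p, hp, rfl⟩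
    change β' g (Φ p) = Φ (W g) * Φ p * star (Φ (W g))
    rw [← hβ g p hp, (hW g).2 p hp, map_mul, map_mul, map_star]
  · change Φ (W g) * Φ (W h) = _ • Φ (W (g * h))
    rw [← map_mul, hμ, map_smul]

end Projective

/-! ### Supports of observables -/

theorem isClosed_centralizer_singleton {A : Type*} [CStarAlgebra A] (a : A) :
    IsClosed (StarSubalgebra.centralizer ℂ ({a} : Set A) : Set A) := by
  have : (StarSubalgebra.centralizer ℂ ({a} : Set A) : Set A) =
      {x | a * x = x * a} ∩ {x | star a * x = x * star a} := by
    ext x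
    rw [SetLike.mem_coe, StarSubalgebra.mem_centralizer_iff]
    simp
  rw [this]
  exact (isClosed_eq (by fun_prop) (by fun_prop)).inter (isClosed_eq (by fun_prop) (by fun_prop))

namespace SpinChain

open Amplify

instance (S : SpinChain) : Nontrivial S.Alg := by
  refine ⟨1, 0, fun h => ?_⟩
  have h1 : (1 : Op S.Config) = 0 := congrArg Subtype.val h
  let x : S.Config := fun j => Classical.arbitrary _
  have h2 : (ket x : HilbertOf S.Config) = 0 := DFunLike.congr_fun h1 (ket x)
  have h3 : (ket x : HilbertOf S.Config) x = 0 := by rw [h2]; rfl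
  simp [ket] at h3

variable (S : SpinChain)

theorem isClosed_obs (X : Set ℤ) : IsClosed (S.obs X : Set S.Alg) :=
  StarSubalgebra.isClosed_topologicalClosure _

/-- Splitting a configuration of a disjoint union. -/
def unionEquiv {F F' : Finset ℤ} (h : Disjoint F F') :
    S.LocalConfig (F ∪ F') ≃ S.LocalConfig F × S.LocalConfig F' where
  toFun c := (fun j => c ⟨j, Finset.mem_union_left _ j.2⟩,
    fun j => c ⟨j, Finset.mem_union_right _ j.2⟩)
  invFun p j := if hj : (j : ℤ) ∈ F then p.1 ⟨j, hj⟩ else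
    p.2 ⟨j, (Finset.mem_union.1 j.2).resolve_left hj⟩
  left_inv c := by ext j; simp
  right_inv p := by
    ext j
    · simp
    · have := Finset.disjoint_right.1 h j.2; simp [this]

theorem loc_union_left {F F' : Finset ℤ} (h : Disjoint F F') (a : Op (S.LocalConfig F)) :
    S.loc (F ∪ F') (amplify (S.unionEquiv h) a) = S.loc F a := by
  rw [S.loc_mono Finset.subset_union_left a]
  refine congrArg (S.loc _) (amplify_congr (S.unionEquiv h)
    (S.splitLocal Finset.subset_union_left) (fun x => by rfl) (fun x y hxy => ?_) a)
  refine funext fun j => ?_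
  exact congrFun hxy ⟨j, (Finset.mem_union.1 j.1.2).resolve_left j.2⟩

theorem loc_union_right {F F' : Finset ℤ} (h : Disjoint F F') (a : Op (S.LocalConfig F')) :
    S.loc (F ∪ F') (amplify ((S.unionEquiv h).trans (Equiv.prodComm _ _)) a) = S.loc F' a := by
  rw [S.loc_mono Finset.subset_union_right a]
  refine congrArg (S.loc _) (amplify_congr ((S.unionEquiv h).trans (Equiv.prodComm _ _))
    (S.splitLocal Finset.subset_union_right) (fun x => by rfl) (fun x y hxy => ?_) a)
  refine funext fun j => ?_
  exact congrFun hxy ⟨j, (Finset.mem_union.1 j.1.2).resolve_right j.2⟩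

theorem loc_commute {F F' : Finset ℤ} (h : Disjoint F F') (a : Op (S.LocalConfig F))
    (b : Op (S.LocalConfig F')) : S.loc F a * S.loc F' b = S.loc F' b * S.loc F a := by
  rw [← S.loc_union_left h a, ← S.loc_union_right h b, ← map_mul, ← map_mul]
  congr 1
  exact (amplify_commute (S.unionEquiv h) ((S.unionEquiv h).trans (Equiv.prodComm _ _))
    (fun _ => rfl) a b).eq

/-- Observables on a disjoint union are sums of products. -/
theorem loc_union_induction {F F' : Finset ℤ} (h : Disjoint F F') {p : S.Alg → Prop}
    (hadd : ∀ x y, p x → p y → p (x + y)) (hzero : p 0)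
    (hmul : ∀ a b, p (S.loc F a * S.loc F' b)) (k : Op (S.LocalConfig (F ∪ F'))) :
    p (S.loc (F ∪ F') k) := by
  obtain ⟨z, rfl⟩ := (tensorHom_bijective (S.unionEquiv h)
    ((S.unionEquiv h).trans (Equiv.prodComm _ _)) (fun _ => rfl)).2 k
  induction z with
  | zero => rw [map_zero, map_zero]; exact hzero
  | add x y hx hy => rw [map_add, map_add]; exact hadd _ _ hx hy
  | tmul a b =>
    have : tensorHom (S.unionEquiv h)
        ((S.unionEquiv h).trans (Equiv.prodComm _ _)) (fun _ => rfl) (a ⊗ₜ b) =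
        amplify (S.unionEquiv h) a * amplify ((S.unionEquiv h).trans (Equiv.prodComm _ _)) b := by
      simp [tensorHom]
    rw [this, map_mul, loc_union_left, loc_union_right]
    exact hmul a b

theorem op_eq_smul_of_subsingleton {X : Type} [Unique X] (a : Op X) :
    a = (a (ket default) default) • 1 := by
  conv_lhs => rw [op_eq_sum a]
  have := sum_matrixUnit (X := X)
  simp only [Fintype.sum_unique] at this ⊢
  rw [this]

/-- The algebra of observables on `X` is generated by the on-site algebras. -/
theorem obs_le_of_site {X : Set ℤ} {K : StarSubalgebra ℂ S.Alg} (hK : IsClosed (K : Set S.Alg))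
    (h : ∀ j ∈ X, S.obs {j} ≤ K) : S.obs X ≤ K := by
  classical
  intro a ha
  refine S.obs_induction (p := fun a => a ∈ K) hK (fun F hF => ?_) ha
  clear ha a
  induction F using Finset.induction with
  | empty =>
    intro a
    have : Unique (S.LocalConfig ∅) :=
      ⟨⟨fun j => absurd j.2 (Finset.notMem_empty _)⟩, fun _ => funext fun j =>
        absurd j.2 (Finset.notMem_empty _)⟩
    rw [op_eq_smul_of_subsingleton a, map_smul, map_one]
    exact StarSubalgebra.smul_mem _ (one_mem _) _
  | insert j F hj ih =>
    intro k
    rw [Finset.coe_insert, Set.insert_subset_iff] at hF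
    revert k
    rw [Finset.insert_eq]
    have hd : Disjoint {j} F := Finset.disjoint_singleton_left.2 hj
    refine S.loc_union_induction hd (p := fun a => a ∈ K) (fun x y => add_mem) (zero_mem _)
      (fun a b => mul_mem ?_ (ih hF.2 b))
    exact h j hF.1 (S.loc_mem_obs (by simp) a)

theorem obs_mono {X Y : Set ℤ} (h : X ⊆ Y) : S.obs X ≤ S.obs Y := fun _ ha =>
  S.obs_induction (p := fun a => a ∈ S.obs Y) (S.isClosed_obs Y)
    (fun _ hF a => S.loc_mem_obs (hF.trans h) a) ha

theorem obs_union_le {X Y : Set ℤ} {K : StarSubalgebra ℂ S.Alg} (hK : IsClosed (K : Set S.Alg))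
    (hX : S.obs X ≤ K) (hY : S.obs Y ≤ K) : S.obs (X ∪ Y) ≤ K :=
  S.obs_le_of_site hK fun _ hj => hj.elim
    (fun h => (S.obs_mono (Set.singleton_subset_iff.2 h)).trans hX)
    (fun h => (S.obs_mono (Set.singleton_subset_iff.2 h)).trans hY)

/-- Observables with disjoint supports commute. -/
theorem obs_commute {X Y : Set ℤ} (h : Disjoint X Y) {a b : S.Alg} (ha : a ∈ S.obs X)
    (hb : b ∈ S.obs Y) : a * b = b * a := by
  refine S.obs_induction (p := fun a => a * b = b * a)
    (isClosed_eq (by fun_prop) (by fun_prop)) (fun F hF a => ?_) ha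
  refine S.obs_induction (p := fun b => S.loc F a * b = b * S.loc F a)
    (isClosed_eq (by fun_prop) (by fun_prop)) (fun F' hF' b => ?_) hb
  exact S.loc_commute (Finset.disjoint_coe.1 (h.mono hF hF')) a b

theorem obs_finset (F : Finset ℤ) : S.obs F = (S.loc F).range := by
  refine le_antisymm (fun a ha => ?_) ?_
  · refine S.obs_induction (p := fun a => a ∈ (S.loc F).range) ?_ (fun F' hF' a => ?_) ha
    · have : FiniteDimensional ℂ (LinearMap.range (S.loc F).toAlgHom.toLinearMap) := inferInstance
      exact (LinearMap.range (S.loc F).toAlgHom.toLinearMap).closed_of_finiteDimensional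
    · exact S.range_loc_mono (Finset.coe_subset.1 hF') ⟨a, rfl⟩
  · rintro _ ⟨a, rfl⟩
    exact S.loc_mem_obs le_rfl a

theorem isMatrix_obs {X : Set ℤ} (hX : X.Finite) : IsMatrix (S.obs X) := by
  obtain ⟨F, rfl⟩ := hX.exists_finset_coe
  have : Fintype (S.LocalConfig F) := Fintype.ofFinite _
  exact ⟨_, inferInstance, S.loc F, (S.obs_finset F).symm⟩

/-- Haag duality: the commutant of the observables on `X` is the algebra of the complement. -/
theorem centralizer_obs (X : Set ℤ) :
    StarSubalgebra.centralizer ℂ (S.obs X : Set S.Alg) = S.obs Xᶜ := by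
  classical
  refine le_antisymm (fun a ha => ?_) fun a ha => mem_centralizer_of_comm fun b hb =>
    S.obs_commute disjoint_compl_right hb ha
  have key : ∀ x ∈ S.obs Set.univ, ∀ ε > 0, ∃ F : Finset ℤ, ∃ k, ‖x - S.loc F k‖ < ε := by
    intro x hx ε hε
    have hcl : IsClosed {x : S.Alg | x ∈ closure (⋃ F : Finset ℤ, Set.range (S.loc F))} :=
      isClosed_closure
    have : x ∈ closure (⋃ F : Finset ℤ, Set.range (S.loc F)) :=
      S.obs_induction hcl (fun F _ k => subset_closure (Set.mem_iUnion.2 ⟨F, k, rfl⟩)) hx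
    obtain ⟨y, hy, hxy⟩ := Metric.mem_closure_iff.1 this ε hε
    obtain ⟨F, k, rfl⟩ := Set.mem_iUnion.1 hy
    exact ⟨F, k, by rwa [← dist_eq_norm]⟩
  change a ∈ (S.obs Xᶜ : Set S.Alg)
  rw [← (S.isClosed_obs _).closure_eq, Metric.mem_closure_iff]
  intro ε hε
  obtain ⟨F, k, hk⟩ := key a (by rw [obs_univ]; trivial) ε hε
  -- average the approximation over the sites of `F` inside `X`
  let F₁ := F.filter (· ∈ X)
  let F₂ := F.filter (· ∉ X)
  have hd : Disjoint F₁ F₂ := Finset.disjoint_filter_filter_not _ _ _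
  have hF : F = F₁ ∪ F₂ := (Finset.filter_union_filter_not_eq _ _).symm
  have hF₁ : (F₁ : Set ℤ) ⊆ X := fun j hj => (Finset.mem_filter.1 hj).2
  have hF₂ : (F₂ : Set ℤ) ⊆ Xᶜ := fun j hj => (Finset.mem_filter.1 hj).2
  have : Fintype (S.LocalConfig F₁) := Fintype.ofFinite _
  let i : S.LocalConfig F₁ := fun j => Classical.arbitrary _
  refine ⟨matrixCoeff (S.loc F₁) i i (S.loc F k), ?_, ?_⟩
  · revert k
    rw [hF]
    intro k hk
    clear hk
    revert k
    refine S.loc_union_induction hd (p := fun y => matrixCoeff (S.loc F₁) i i y ∈ S.obs Xᶜ)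
      (fun x y hx hy => ?_) ?_ fun a b => ?_
    · have : matrixCoeff (S.loc F₁) i i (x + y) =
          matrixCoeff (S.loc F₁) i i x + matrixCoeff (S.loc F₁) i i y := by
        simp [matrixCoeff, mul_add, add_mul, Finset.sum_add_distrib]
      rw [this]; exact add_mem hx hy
    · have : matrixCoeff (S.loc F₁) i i (0 : S.Alg) = 0 := by simp [matrixCoeff]
      rw [this]; exact zero_mem _
    · rw [matrixCoeff_map_mul _ _ _ _ fun c => (S.loc_commute hd c b).symm]
      exact StarSubalgebra.smul_mem _ (S.loc_mem_obs hF₂ b) _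
  · have h1 : matrixCoeff (S.loc F₁) i i a = a := matrixCoeff_of_commute _ _ fun b =>
      (comm_of_mem_centralizer ha (S.loc_mem_obs hF₁ b)).symm
    have h2 : a - matrixCoeff (S.loc F₁) i i (S.loc F k) =
        matrixCoeff (S.loc F₁) i i (a - S.loc F k) := by
      conv_lhs => rw [← h1]
      simp [matrixCoeff, mul_sub, sub_mul, Finset.sum_sub_distrib]
    rw [dist_eq_norm, h2]
    exact (norm_matrixCoeff_le _ _ _).trans_lt hk

theorem mem_obs_iff {X : Set ℤ} {a : S.Alg} :
    a ∈ S.obs X ↔ ∀ b ∈ S.obs Xᶜ, b * a = a * b := by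
  refine ⟨fun ha b hb => (S.obs_commute disjoint_compl_right ha hb).symm, fun h => ?_⟩
  rw [← compl_compl X, ← centralizer_obs]
  exact mem_centralizer_of_comm h

theorem obs_inter (X Y : Set ℤ) : S.obs (X ∩ Y) = S.obs X ⊓ S.obs Y := by
  refine le_antisymm (le_inf (S.obs_mono Set.inter_subset_left) (S.obs_mono Set.inter_subset_right))
    fun a ha => ?_
  refine S.mem_obs_iff.2 fun b hb => ?_
  rw [Set.compl_inter] at hb
  have := S.obs_union_le (isClosed_centralizer_singleton a)
    (le_centralizer_of_generate fun c hc => S.mem_obs_iff.1 ha.1 c hc)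
    (le_centralizer_of_generate fun c hc => S.mem_obs_iff.1 ha.2 c hc) hb
  exact (((StarSubalgebra.mem_centralizer_iff ℂ).1 this a rfl).1).symm

theorem obs_empty {a : S.Alg} (ha : a ∈ S.obs ∅) : ∃ c : ℂ, a = c • 1 :=
  (S.isMatrix_obs Set.finite_empty).hasTrivialCenter a ha fun _ hb =>
    S.obs_commute (Set.disjoint_empty _) ha hb

end SpinChain

/-! ### Automorphisms and supports -/

namespace SpinChain

variable (S : SpinChain)

/-- Homomorphisms which agree on the on-site algebras in `X` agree on `𝒜_X`. -/
theorem hom_eq_of_site {A : Type*} [CStarAlgebra A] (f g : S.Alg →⋆ₐ[ℂ] A) {X : Set ℤ}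
    (h : ∀ j ∈ X, ∀ a ∈ S.obs {j}, f a = g a) : ∀ a ∈ S.obs X, f a = g a :=
  S.obs_le_of_site (K := StarAlgHom.equalizer f g)
    (isClosed_eq (continuous_hom f) (continuous_hom g)) h

theorem aut_eq_of_site {γ δ : S.Aut} (h : ∀ j, ∀ a ∈ S.obs {j}, γ a = δ a) : γ = δ :=
  StarAlgEquiv.ext fun a => S.hom_eq_of_site (X := Set.univ) (γ : S.Alg →⋆ₐ[ℂ] S.Alg)
    (δ : S.Alg →⋆ₐ[ℂ] S.Alg) (fun j _ => h j) a (by rw [obs_univ]; trivial)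

theorem map_mem_of_site {A : Type*} [CStarAlgebra A] (f : S.Alg →⋆ₐ[ℂ] A) {X : Set ℤ}
    {K : StarSubalgebra ℂ A} (hK : IsClosed (K : Set A))
    (h : ∀ j ∈ X, ∀ a ∈ S.obs {j}, f a ∈ K) {a : S.Alg} (ha : a ∈ S.obs X) : f a ∈ K :=
  S.obs_le_of_site (K := K.comap f) (hK.preimage (continuous_hom f)) h ha

theorem aut_mem_of_site (γ : S.Aut) {X Y : Set ℤ}
    (h : ∀ j ∈ X, ∀ a ∈ S.obs {j}, γ a ∈ S.obs Y) {a : S.Alg} (ha : a ∈ S.obs X) : γ a ∈ S.obs Y :=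
  S.map_mem_of_site (γ : S.Alg →⋆ₐ[ℂ] S.Alg) (S.isClosed_obs Y) h ha

theorem obs_site_le {X : Set ℤ} {j : ℤ} (hj : j ∈ X) : S.obs {j} ≤ S.obs X :=
  S.obs_mono (Set.singleton_subset_iff.2 hj)

theorem aut_injective (γ : S.Aut) : Function.Injective γ := EquivLike.injective γ

theorem aut_inv_apply (γ : S.Aut) (a : S.Alg) : γ⁻¹ (γ a) = a := γ.symm_apply_apply a

theorem aut_apply_inv (γ : S.Aut) (a : S.Alg) : γ (γ⁻¹ a) = a := γ.apply_symm_apply a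

/-- The automorphism maps `𝒜_X` onto itself. -/
def Preserves (θ : S.Aut) (X : Set ℤ) : Prop := ∀ a, a ∈ S.obs X ↔ θ a ∈ S.obs X

variable {S}

theorem Preserves.of_le {θ : S.Aut} {X : Set ℤ} (h : ∀ a ∈ S.obs X, θ a ∈ S.obs X)
    (h' : ∀ a ∈ S.obs Xᶜ, θ a ∈ S.obs Xᶜ) : S.Preserves θ X := by
  refine fun a => ⟨h a, fun ha => S.mem_obs_iff.2 fun b hb => ?_⟩
  apply S.aut_injective θ
  rw [map_mul, map_mul]
  exact S.mem_obs_iff.1 ha _ (h' b hb)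

theorem Preserves.compl {θ : S.Aut} {X : Set ℤ} (h : S.Preserves θ X) : S.Preserves θ Xᶜ := by
  have key : ∀ b, b ∈ S.obs X ↔ θ b ∈ S.obs X := h
  intro a
  rw [S.mem_obs_iff, S.mem_obs_iff, compl_compl]
  constructor
  · intro ha b hb
    have hb' : θ⁻¹ b ∈ S.obs X := by rw [key, aut_apply_inv]; exact hb
    have := congrArg θ (ha _ hb')
    rwa [map_mul, map_mul, aut_apply_inv] at this
  · intro ha b hb
    apply S.aut_injective θ
    rw [map_mul, map_mul]
    exact ha _ ((key b).1 hb)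

theorem Preserves.mul {θ θ' : S.Aut} {X : Set ℤ} (h : S.Preserves θ X) (h' : S.Preserves θ' X) :
    S.Preserves (θ * θ') X := fun a => (h' a).trans (h _)

theorem Preserves.inv {θ : S.Aut} {X : Set ℤ} (h : S.Preserves θ X) : S.Preserves θ⁻¹ X := fun a => by
  rw [h (θ⁻¹ a), aut_apply_inv]

theorem Preserves.one {X : Set ℤ} : S.Preserves 1 X := fun _ => Iff.rfl

theorem Preserves.inter {θ : S.Aut} {X Y : Set ℤ} (h : S.Preserves θ X) (h' : S.Preserves θ Y) :
    S.Preserves θ (X ∩ Y) := fun a => by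
  rw [obs_inter]; exact and_congr (h a) (h' a)

theorem preserves_conj {u : unitary S.Alg} {X : Set ℤ} (hu : (u : S.Alg) ∈ S.obs X) :
    S.Preserves (conjAut u) X := fun a => by
  refine ⟨fun ha => mul_mem (mul_mem hu ha) (star_mem hu), fun ha => ?_⟩
  have h : a = star (u : S.Alg) * (u * a * star (u : S.Alg)) * u := by
    simp only [mul_assoc, star_mul_self_cancel, star_mul_val, mul_one]
  rw [h]
  exact mul_mem (mul_mem (star_mem hu) ha) hu

theorem conj_eq_of_commute {u : unitary S.Alg} {a : S.Alg} (h : (u : S.Alg) * a = a * u) :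
    conjAut u a = a := by
  change (u : S.Alg) * a * star (u : S.Alg) = a
  rw [h, mul_star_self_cancel_right]

theorem conjAut_one : (conjAut 1 : S.Aut) = 1 := map_one (Unitary.conjStarAlgAut ℂ S.Alg)

theorem conj_inv_apply (u : unitary S.Alg) (a : S.Alg) :
    (conjAut u)⁻¹ a = star (u : S.Alg) * a * u := rfl

/-- The image of a unitary under an automorphism. -/
def mapU (γ : S.Aut) (u : unitary S.Alg) : unitary S.Alg := ⟨γ u, Unitary.map_mem γ u.2⟩

theorem mul_conj (γ : S.Aut) (u : unitary S.Alg) : γ * conjAut u = conjAut (mapU γ u) * γ := by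
  refine StarAlgEquiv.ext fun a => ?_
  change γ (u * a * star (u : S.Alg)) = γ u * γ a * star (γ u)
  rw [map_mul, map_mul, map_star]

/-! ### Ranges -/

theorem HasRange.of_site {γ : S.Aut} {r : ℕ}
    (h : ∀ j, ∀ a ∈ S.obs {j}, γ a ∈ S.obs (Set.Icc (j - r) (j + r))) : S.HasRange γ r := by
  intro X a ha
  refine S.aut_mem_of_site γ (fun j hj a ha => ?_) ha
  refine S.obs_mono ?_ (h j a ha)
  refine fun i hi => ⟨j, hj, ?_⟩
  rw [abs_le]
  constructor <;> linarith [hi.1, hi.2]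

theorem HasRange.site {γ : S.Aut} {r : ℕ} (h : S.HasRange γ r) {j : ℤ} {a : S.Alg}
    (ha : a ∈ S.obs {j}) : γ a ∈ S.obs (Set.Icc (j - r) (j + r)) := by
  refine S.obs_mono ?_ (h _ a ha)
  rintro i ⟨k, rfl, hi⟩
  rw [abs_le] at hi
  constructor <;> linarith [hi.1, hi.2]

theorem HasRange.mono {γ : S.Aut} {r r' : ℕ} (h : S.HasRange γ r) (hr : r ≤ r') :
    S.HasRange γ r' := HasRange.of_site fun j a ha => by
  refine S.obs_mono (Set.Icc_subset_Icc ?_ ?_) (h.site ha) <;>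
  · have : (r : ℤ) ≤ r' := by exact_mod_cast hr
    linarith

theorem HasRange.of_subset {γ : S.Aut} {r : ℕ} (h : S.HasRange γ r) {X Y : Set ℤ}
    (hXY : ∀ i ∈ X, Set.Icc (i - r) (i + r) ⊆ Y) {a : S.Alg} (ha : a ∈ S.obs X) :
    γ a ∈ S.obs Y :=
  S.aut_mem_of_site γ (fun j hj _ ha => S.obs_mono (hXY j hj) (h.site ha)) ha

theorem HasRange.mul {γ δ : S.Aut} {r r' : ℕ} (h : S.HasRange γ r) (h' : S.HasRange δ r') :
    S.HasRange (γ * δ) (r + r') := HasRange.of_site fun j a ha => by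
  refine h.of_subset (fun i hi => ?_) (h'.site ha)
  push_cast
  exact Set.Icc_subset_Icc (by linarith [hi.1]) (by linarith [hi.2])

theorem HasRange.inv {γ : S.Aut} {r : ℕ} (h : S.HasRange γ r) : S.HasRange γ⁻¹ r :=
  HasRange.of_site fun j a ha => by
  refine S.mem_obs_iff.2 fun b hb => ?_
  apply S.aut_injective γ
  rw [map_mul, map_mul, aut_apply_inv]
  have hb' : γ b ∈ S.obs {j}ᶜ := by
    refine h.of_subset (fun i hi k hk => ?_) hb
    rintro rfl
    apply hi
    constructor <;> linarith [hk.1, hk.2]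
  exact S.obs_commute (by simp) hb' ha

theorem HasRange.one : S.HasRange 1 0 := HasRange.of_site fun j a ha => by simpa using ha

/-! ### Layers -/

namespace Layer

variable (L : S.Layer)

/-- The index of the interval containing the site `j`. -/
def idx (j : ℤ) : ℤ := (L.partition j).choose

theorem mem_idx (j : ℤ) : j ∈ Set.Icc (L.m (L.idx j)) (L.n (L.idx j)) :=
  (L.partition j).choose_spec.1

theorem eq_idx {a j : ℤ} (h : j ∈ Set.Icc (L.m a) (L.n a)) : a = L.idx j :=
  (L.partition j).choose_spec.2 a h

theorem disjoint_block {a b : ℤ} (h : a ≠ b) :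
    Disjoint (Set.Icc (L.m a) (L.n a)) (Set.Icc (L.m b) (L.n b)) :=
  Set.disjoint_left.2 fun _ hj hj' => h ((L.eq_idx hj).trans (L.eq_idx hj').symm)

/-- The layer of the adjoint gates. -/
def inv : S.Layer := { L with gate := fun a => star (L.gate a), gate_mem := fun a => star_mem (L.gate_mem a) }

variable {L}

theorem Implements.site {γ : S.Aut} (h : L.Implements γ) {j : ℤ} {x : S.Alg} (hx : x ∈ S.obs {j}) :
    γ x = L.gate (L.idx j) * x * star (L.gate (L.idx j) : S.Alg) :=
  h _ x (S.obs_site_le (L.mem_idx j) hx)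

theorem implements_of_site {γ : S.Aut} (h : ∀ j, ∀ x ∈ S.obs {j},
    γ x = L.gate (L.idx j) * x * star (L.gate (L.idx j) : S.Alg)) : L.Implements γ := fun a =>
  S.hom_eq_of_site (γ : S.Alg →⋆ₐ[ℂ] S.Alg) (conjAut (L.gate a) : S.Alg →⋆ₐ[ℂ] S.Alg)
    fun _ hj x hx => (h _ x hx).trans (by rw [← L.eq_idx hj]; rfl)

theorem Implements.preserves_block {γ : S.Aut} (h : L.Implements γ) (a : ℤ) {x : S.Alg}
    (hx : x ∈ S.obs (Set.Icc (L.m a) (L.n a))) : γ x ∈ S.obs (Set.Icc (L.m a) (L.n a)) := by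
  rw [h a x hx]
  exact mul_mem (mul_mem (L.gate_mem a) hx) (star_mem (L.gate_mem a))

theorem Implements.inv {γ : S.Aut} (h : L.Implements γ) : L.inv.Implements γ⁻¹ := fun a x hx => by
  apply S.aut_injective γ
  change S.Alg at x
  have hg := L.gate_mem a
  change x ∈ S.obs (Set.Icc (L.m a) (L.n a)) at hx
  rw [aut_apply_inv]
  change x = γ (star (L.gate a : S.Alg) * x * star (star (L.gate a : S.Alg)))
  rw [h a _ (mul_mem (mul_mem (star_mem hg) hx) (star_mem (star_mem hg))), star_star]
  simp only [mul_assoc, mul_star_self_cancel, mul_star_val, mul_one]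

/-- Finitely many of the gates, multiplied together. -/
theorem exists_prod (L : S.Layer) (T : Finset ℤ) : ∃ w : unitary S.Alg,
    (w : S.Alg) ∈ S.obs (⋃ a ∈ T, Set.Icc (L.m a) (L.n a)) ∧
    ∀ a ∈ T, ∀ x ∈ S.obs (Set.Icc (L.m a) (L.n a)),
      (w : S.Alg) * x * star (w : S.Alg) = L.gate a * x * star (L.gate a : S.Alg) := by
  classical
  induction T using Finset.induction with
  | empty => exact ⟨1, one_mem _, by simp⟩
  | insert b T hb ih =>
    obtain ⟨w, hw, hwT⟩ := ih
    have hsub : Set.Icc (L.m b) (L.n b) ⊆ ⋃ a ∈ insert b T, Set.Icc (L.m a) (L.n a) :=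
      Set.subset_biUnion_of_mem (u := fun a => Set.Icc (L.m a) (L.n a)) (Finset.mem_insert_self b T)
    have hdis : Disjoint (⋃ a ∈ T, Set.Icc (L.m a) (L.n a)) (Set.Icc (L.m b) (L.n b)) := by
      rw [Set.disjoint_iUnion₂_left]
      exact fun a ha => L.disjoint_block fun h => hb (h ▸ ha)
    refine ⟨L.gate b * w, mul_mem (S.obs_mono hsub (L.gate_mem b)) (S.obs_mono ?_ hw), ?_⟩
    · exact Set.biUnion_subset_biUnion_left fun a ha => Finset.mem_insert_of_mem ha
    · intro a ha x hx
      change (L.gate b : S.Alg) * w * x * star (L.gate b * w : S.Alg) = _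
      rw [star_mul]
      rcases Finset.mem_insert.1 ha with rfl | ha'
      · rw [mul_assoc _ (w : S.Alg) x, S.obs_commute hdis hw hx]
        simp only [mul_assoc, mul_star_self_cancel]
      · have hne : a ≠ b := fun h => hb (h ▸ ha')
        have h2 := hwT a ha' x hx
        have h3 : (w : S.Alg) * x * star (w : S.Alg) ∈ S.obs (Set.Icc (L.m a) (L.n a)) := by
          rw [h2]
          exact mul_mem (mul_mem (L.gate_mem a) hx) (star_mem (L.gate_mem a))
        have h4 := S.obs_commute (L.disjoint_block hne.symm) (L.gate_mem b) h3
        calc _ = (L.gate b : S.Alg) * (w * x * star (w : S.Alg)) * star (L.gate b : S.Alg) := by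
              simp only [mul_assoc]
          _ = _ := by rw [h4, mul_star_self_cancel_right, h2]

theorem exists_hom (L : S.Layer) : ∃ θ : S.Alg →⋆ₐ[ℂ] S.Alg, ∀ j, ∀ x ∈ S.obs {j},
    θ x = L.gate (L.idx j) * x * star (L.gate (L.idx j) : S.Alg) := by
  classical
  choose w hw hwT using fun F : Finset ℤ => L.exists_prod (F.image L.idx)
  have key : ∀ F : Finset ℤ, ∀ j ∈ F, ∀ x ∈ S.obs {j},
      (w F : S.Alg) * x * star (w F : S.Alg) =
        L.gate (L.idx j) * x * star (L.gate (L.idx j) : S.Alg) := fun F j hj x hx =>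
    hwT F (L.idx j) (Finset.mem_image_of_mem _ hj) x (S.obs_site_le (L.mem_idx j) hx)
  obtain ⟨Θ, hΘ⟩ := S.exists_extend
    (fun F => (conjAut (w F) : S.Alg →⋆ₐ[ℂ] S.Alg).comp (S.loc F)) (by
      intro F F' h k
      change conjAut (w F') (S.loc F' _) = conjAut (w F) (S.loc F k)
      rw [← S.loc_mono h]
      exact S.hom_eq_of_site (X := F) (conjAut (w F') : S.Alg →⋆ₐ[ℂ] S.Alg)
        (conjAut (w F) : S.Alg →⋆ₐ[ℂ] S.Alg) (fun j hj x hx =>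
          (key F' j (h hj) x hx).trans (key F j hj x hx).symm) _ (S.loc_mem_obs le_rfl k))
  refine ⟨Θ, fun j x hx => ?_⟩
  rw [← Finset.coe_singleton, obs_finset] at hx
  obtain ⟨k, rfl⟩ := hx
  change Θ (S.loc {j} k) = _
  rw [hΘ]
  exact key {j} j (Finset.mem_singleton_self j) _ (S.loc_mem_obs (by simp) k)

/-- Every layer of gates is implemented by an automorphism. -/
theorem exists_implements (L : S.Layer) : ∃ γ : S.Aut, L.Implements γ := by
  obtain ⟨f, hf⟩ := L.exists_hom
  obtain ⟨g, hg⟩ := L.inv.exists_hom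
  have key : ∀ (L : S.Layer) (f g : S.Alg →⋆ₐ[ℂ] S.Alg), (∀ j, ∀ x ∈ S.obs {j},
      f x = L.gate (L.idx j) * x * star (L.gate (L.idx j) : S.Alg)) → (∀ j, ∀ x ∈ S.obs {j},
      g x = star (L.gate (L.idx j) : S.Alg) * x * (L.gate (L.idx j) : S.Alg)) →
      g.comp f = StarAlgHom.id ℂ _ := by
    intro L f g hf hg
    refine StarAlgHom.ext fun a => S.hom_eq_of_site (X := Set.univ) _ _ (fun j _ x hx => ?_) a
      (by rw [obs_univ]; trivial)
    have h2 : ∀ y ∈ S.obs (Set.Icc (L.m (L.idx j)) (L.n (L.idx j))), g y =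
        star (L.gate (L.idx j) : S.Alg) * y * (L.gate (L.idx j) : S.Alg) := by
      have := S.hom_eq_of_site (X := Set.Icc (L.m (L.idx j)) (L.n (L.idx j))) g
        (((conjAut (L.gate (L.idx j)))⁻¹ : S.Aut) : S.Alg →⋆ₐ[ℂ] S.Alg) (fun i hi y hy => by
          rw [hg i y hy, ← L.eq_idx hi]; rfl)
      exact this
    change g (f x) = x
    rw [hf j x hx, h2 _ (mul_mem (mul_mem (L.gate_mem _) (S.obs_site_le (L.mem_idx j) hx))
      (star_mem (L.gate_mem _)))]
    simp only [mul_assoc, star_mul_self_cancel, star_mul_val, mul_one]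
  have hg' : ∀ j, ∀ x ∈ S.obs {j},
      g x = star (L.gate (L.idx j) : S.Alg) * x * (L.gate (L.idx j) : S.Alg) := fun j x hx =>
    (hg j x hx).trans (by
      change star (L.gate (L.idx j) : S.Alg) * x * star (star (L.gate (L.idx j) : S.Alg)) = _
      rw [star_star])
  have h1 := key L f g hf hg'
  have h2 := key L.inv g f hg (fun j x hx => (hf j x hx).trans (by
    change _ = star (star (L.gate (L.idx j) : S.Alg)) * x * star (L.gate (L.idx j) : S.Alg)
    rw [star_star]))
  exact ⟨StarAlgEquiv.ofStarAlgHom f g h1 h2, implements_of_site hf⟩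

theorem Implements.hasRange {γ : S.Aut} (h : L.Implements γ) {q : ℤ} (hq : ∀ a, L.n a - L.m a ≤ q) :
    S.HasRange γ q.toNat := HasRange.of_site fun j a ha => by
  refine S.obs_mono (Set.Icc_subset_Icc ?_ ?_)
    (h.preserves_block (L.idx j) (S.obs_site_le (L.mem_idx j) ha)) <;>
  · have h1 := L.mem_idx j
    have h2 := hq (L.idx j)
    have h3 := Int.self_le_toNat q
    linarith [h1.1, h1.2]

theorem Implements.exists_cut {γ : S.Aut} (h : L.Implements γ) {B : StarSubalgebra ℂ S.Alg} {x : ℤ}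
    {q : ℤ} (hq : ∀ a, L.n a - L.m a ≤ q)
    (hB : ∀ a, (L.gate a : S.Alg) ∈ B) : ∃ u : unitary S.Alg, (u : S.Alg) ∈ B ∧
      (u : S.Alg) ∈ S.obs (Set.Ico (x - q.toNat) (x + q.toNat)) ∧
      S.Preserves ((conjAut u)⁻¹ * γ) (Set.Iio x) ∧
      (∀ a, x - 1 ∈ Set.Icc (L.m a) (L.n a) → x ∈ Set.Icc (L.m a) (L.n a) → u = L.gate a) ∧
      ((∀ a, x - 1 ∈ Set.Icc (L.m a) (L.n a) → x ∉ Set.Icc (L.m a) (L.n a)) → u = 1) := by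
  classical
  have hq' := Int.self_le_toNat q
  -- the only gate that matters is the one whose interval contains both `x - 1` and `x`
  by_cases hx : x ∈ Set.Icc (L.m (L.idx (x - 1))) (L.n (L.idx (x - 1)))
  · obtain ⟨b, hb⟩ : ∃ b, b = L.idx (x - 1) := ⟨_, rfl⟩
    have hx1 := L.mem_idx (x - 1)
    rw [← hb] at hx hx1
    have hside : ∀ j, L.idx j ≠ b → ∀ y ∈ S.obs {j}, (conjAut (L.gate b))⁻¹ (γ y) ∈
        S.obs (Set.Icc (L.m (L.idx j)) (L.n (L.idx j))) := by
      intro j hj y hy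
      have h1 := h.preserves_block _ (S.obs_site_le (L.mem_idx j) hy)
      have h2 := S.obs_commute (L.disjoint_block hj.symm) (L.gate_mem b) h1
      rw [conj_inv_apply, mul_assoc, ← h2, star_mul_self_cancel]
      exact h1
    have hin : ∀ j, L.idx j = b → ∀ y ∈ S.obs {j}, (conjAut (L.gate b))⁻¹ (γ y) = y := by
      rintro j hj y hy
      rw [h.site hy, hj, conj_inv_apply]
      simp only [mul_assoc, star_mul_self_cancel, star_mul_val, mul_one]
    refine ⟨L.gate b, hB b, S.obs_mono (fun i hi => ?_) (L.gate_mem b), Preserves.of_le ?_ ?_,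
      fun a ha _ => ?_, fun hn => absurd hx (hn b hx1)⟩
    · have h2 := hq b
      constructor <;> linarith [hi.1, hi.2, hx.1, hx.2, hx1.1]
    · refine fun a => S.aut_mem_of_site _ fun j hj y hy => ?_
      change (conjAut (L.gate b))⁻¹ (γ y) ∈ _
      by_cases hjb : L.idx j = b
      · rw [hin j hjb y hy]; exact S.obs_site_le hj hy
      · refine S.obs_mono (fun i hi => ?_) (hside j hjb y hy)
        by_contra hc
        refine hjb ((L.eq_idx ?_).trans (L.eq_idx hx).symm)
        exact ⟨(L.mem_idx j).1.trans (le_of_lt hj), (not_lt.1 hc).trans hi.2⟩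
    · refine fun a => S.aut_mem_of_site _ fun j hj y hy => ?_
      change (conjAut (L.gate b))⁻¹ (γ y) ∈ _
      by_cases hjb : L.idx j = b
      · rw [hin j hjb y hy]; exact S.obs_site_le hj hy
      · refine S.obs_mono ?_ (hside j hjb y hy)
        intro i hi hc
        refine hjb ((L.eq_idx ?_).trans (L.eq_idx hx).symm)
        exact ⟨hi.1.trans (le_of_lt hc), (Set.notMem_Iio.1 hj).trans (L.mem_idx j).2⟩
    · rw [L.eq_idx ha, ← hb]
  · refine ⟨1, one_mem _, one_mem _, ?_, fun a ha hxa => absurd ?_ hx, fun _ => rfl⟩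
    · rw [conjAut_one, inv_one, one_mul]
      refine Preserves.of_le ?_ ?_
      · refine fun a => S.aut_mem_of_site _ fun j hj y hy => ?_
        refine S.obs_mono (fun i hi => ?_) (h.preserves_block _ (S.obs_site_le (L.mem_idx j) hy))
        by_contra hc
        have h1 : x ∈ Set.Icc (L.m (L.idx j)) (L.n (L.idx j)) :=
          ⟨(L.mem_idx j).1.trans (le_of_lt hj), (not_lt.1 hc).trans hi.2⟩
        have h2 : x - 1 ∈ Set.Icc (L.m (L.idx j)) (L.n (L.idx j)) :=
          ⟨(L.mem_idx j).1.trans (Int.le_sub_one_of_lt hj), by linarith [h1.2]⟩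
        rw [L.eq_idx h2] at h1
        exact hx h1
      · refine fun a => S.aut_mem_of_site _ fun j hj y hy => ?_
        refine S.obs_mono ?_ (h.preserves_block _ (S.obs_site_le (L.mem_idx j) hy))
        intro i hi hc
        have h1 : x ∈ Set.Icc (L.m (L.idx j)) (L.n (L.idx j)) :=
          ⟨hi.1.trans (le_of_lt hc), (Set.notMem_Iio.1 hj).trans (L.mem_idx j).2⟩
        have h2 : x - 1 ∈ Set.Icc (L.m (L.idx j)) (L.n (L.idx j)) :=
          ⟨hi.1.trans (Int.le_sub_one_of_lt hc), by linarith [h1.2]⟩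
        rw [L.eq_idx h2] at h1
        exact hx h1
    · rwa [L.eq_idx ha] at hxa

end Layer

end SpinChain

/-! ### Circuits with gates in a subalgebra, and on-site symmetries -/

namespace SpinChain

variable {S : SpinChain} {G : Type} [Group G]

/-- Finite depth quantum circuits all of whose gates lie in the subalgebra `B`. -/
def IsCircuitIn (S : SpinChain) (B : StarSubalgebra ℂ S.Alg) (γ : S.Aut) : Prop :=
  ∃ l : List S.Aut, γ = l.prod ∧
    ∀ δ ∈ l, ∃ L : S.Layer, L.Implements δ ∧ ∀ a, (L.gate a : S.Alg) ∈ B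

/-- The fixed points of a group action. -/
def fixedAlg (β : G →* S.Aut) : StarSubalgebra ℂ S.Alg where
  carrier := {a | ∀ g, β g a = a}
  mul_mem' ha hb g := by rw [map_mul, ha g, hb g]
  add_mem' ha hb g := by rw [map_add, ha g, hb g]
  algebraMap_mem' r g := by
    rw [Algebra.algebraMap_eq_smul_one, map_smul]
    exact congrArg (r • ·) (map_one (β g))
  star_mem' ha g := by rw [map_star, ha g]

theorem isCircuitIn_top_iff {γ : S.Aut} : S.IsCircuitIn ⊤ γ ↔ S.IsFDQC γ := by
  constructor <;> rintro ⟨l, hl, h⟩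
  · exact ⟨l, hl, fun δ hδ => (h δ hδ).imp fun _ h => h.1⟩
  · exact ⟨l, hl, fun δ hδ => (h δ hδ).imp fun _ h => ⟨h, fun _ => trivial⟩⟩

theorem isCircuitIn_fixedAlg_iff {β : G →* S.Aut} {γ : S.Aut} :
    S.IsCircuitIn (fixedAlg β) γ ↔ S.IsSymmetricFDQC β γ := by
  constructor <;> rintro ⟨l, hl, h⟩
  · exact ⟨l, hl, fun δ hδ => (h δ hδ).imp fun _ h => ⟨h.1, fun g a => h.2 a g⟩⟩
  · exact ⟨l, hl, fun δ hδ => (h δ hδ).imp fun _ h => ⟨h.1, fun a g => h.2 g a⟩⟩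

namespace IsCircuitIn

variable {B : StarSubalgebra ℂ S.Alg} {γ γ' : S.Aut}

theorem one : S.IsCircuitIn B 1 := ⟨[], by simp, by simp⟩

theorem of_layer {L : S.Layer} (h : L.Implements γ) (hB : ∀ a, (L.gate a : S.Alg) ∈ B) :
    S.IsCircuitIn B γ := ⟨[γ], by simp, fun δ hδ => by
  rw [List.mem_singleton] at hδ; subst hδ; exact ⟨L, h, hB⟩⟩

theorem mul (h : S.IsCircuitIn B γ) (h' : S.IsCircuitIn B γ') : S.IsCircuitIn B (γ * γ') := by
  obtain ⟨l, rfl, hl⟩ := h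
  obtain ⟨l', rfl, hl'⟩ := h'
  refine ⟨l ++ l', by rw [List.prod_append], fun δ hδ => ?_⟩
  rcases List.mem_append.1 hδ with h | h
  exacts [hl δ h, hl' δ h]

theorem induction {p : S.Aut → Prop} (h1 : p 1)
    (hmul : ∀ (L : S.Layer) (δ γ : S.Aut), L.Implements δ → (∀ a, (L.gate a : S.Alg) ∈ B) → p γ →
      p (δ * γ)) (h : S.IsCircuitIn B γ) : p γ := by
  obtain ⟨l, rfl, hl⟩ := h
  induction l with
  | nil => exact h1
  | cons δ l ih =>
    rw [List.prod_cons]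
    obtain ⟨L, hL, hLB⟩ := hl δ List.mem_cons_self
    exact hmul L δ _ hL hLB (ih fun δ' h => hl δ' (List.mem_cons_of_mem _ h))

theorem inv (h : S.IsCircuitIn B γ) : S.IsCircuitIn B γ⁻¹ := by
  refine h.induction (p := fun γ => S.IsCircuitIn B γ⁻¹) (by rw [inv_one]; exact one) ?_
  intro L δ γ hL hB ih
  rw [mul_inv_rev]
  exact ih.mul (of_layer hL.inv fun a => star_mem (hB a))

theorem exists_hasRange (h : S.IsCircuitIn B γ) : ∃ r : ℕ, S.HasRange γ r := by
  refine h.induction (p := fun γ => ∃ r : ℕ, S.HasRange γ r) ⟨0, HasRange.one⟩ ?_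
  rintro L δ γ hL - ⟨r, hr⟩
  obtain ⟨q, hq⟩ := L.bounded
  exact ⟨_, (hL.hasRange hq).mul hr⟩

/-- Cutting a circuit at `x`: up to conjugation with a unitary supported near `x`, it preserves the
observables to the left of `x`. -/
theorem exists_cut (hB : ∀ (L : S.Layer) (δ : S.Aut), L.Implements δ →
      (∀ a, (L.gate a : S.Alg) ∈ B) → ∀ b ∈ B, δ b ∈ B) (h : S.IsCircuitIn B γ) :
    ∃ R : ℕ, ∀ x : ℤ, ∃ u : unitary S.Alg, (u : S.Alg) ∈ B ∧
      (u : S.Alg) ∈ S.obs (Set.Ico (x - R) (x + R)) ∧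
      S.Preserves ((conjAut u)⁻¹ * γ) (Set.Iio x) := by
  refine h.induction (p := fun γ => ∃ R : ℕ, ∀ x : ℤ, ∃ u : unitary S.Alg, (u : S.Alg) ∈ B ∧
    (u : S.Alg) ∈ S.obs (Set.Ico (x - R) (x + R)) ∧
      S.Preserves ((conjAut u)⁻¹ * γ) (Set.Iio x)) ⟨0, fun x => ⟨1, one_mem _, one_mem _, ?_⟩⟩ ?_
  · rw [conjAut_one, inv_one, one_mul]; exact Preserves.one
  · rintro L δ γ hL hLB ⟨R, ih⟩
    obtain ⟨q, hq⟩ := L.bounded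
    refine ⟨q.toNat + R, fun x => ?_⟩
    obtain ⟨u, huB, hux, hu, -⟩ := hL.exists_cut (x := x) hq hLB
    obtain ⟨v, hvB, hvx, hv⟩ := ih x
    have hq' : (0 : ℤ) ≤ q.toNat := Int.natCast_nonneg _
    have hR' : (0 : ℤ) ≤ R := Int.natCast_nonneg _
    refine ⟨mapU δ v * u, mul_mem (hB L δ hL hLB _ hvB) huB,
      mul_mem ((hL.hasRange hq).of_subset ?_ hvx) (S.obs_mono ?_ hux), ?_⟩
    · intro i hi k hk
      push_cast
      constructor <;> linarith [hi.1, hi.2, hk.1, hk.2]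
    · push_cast
      exact Set.Ico_subset_Ico (by linarith) (by linarith)
    · have h1 : (conjAut (mapU δ v * u))⁻¹ * (δ * γ) =
          ((conjAut u)⁻¹ * δ) * ((conjAut v)⁻¹ * γ) := by
        have h2 : (conjAut (mapU δ v * u) : S.Aut) = δ * conjAut v * δ⁻¹ * conjAut u := by
          rw [mul_conj δ v, mul_inv_cancel_right]
          exact map_mul (Unitary.conjStarAlgAut ℂ S.Alg) _ _
        rw [h2]
        group
      rw [h1]
      exact hu.mul hv

end IsCircuitIn

/-! ### On-site symmetries -/

variable {β : G →* S.Aut}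

theorem IsOnSite.apply_mem (h : S.IsOnSite β) (g : G) {X : Set ℤ} {a : S.Alg} (ha : a ∈ S.obs X) :
    β g a ∈ S.obs X := by
  obtain ⟨U, hU, hβ⟩ := h
  refine S.aut_mem_of_site (β g) (fun j hj a ha => S.obs_site_le hj ?_) ha
  rw [hβ j g a ha]
  exact mul_mem (mul_mem (hU j g) ha) (star_mem (hU j g))

/-- On finitely many sites, an on-site symmetry is implemented by a unitary representation. -/
theorem IsOnSite.exists_rep (h : S.IsOnSite β) (F : Finset ℤ) :
    ∃ U : G →* unitary S.Alg, Implements β (S.obs F) U := by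
  classical
  have hmem := fun (g : G) {X : Set ℤ} {a : S.Alg} (ha : a ∈ S.obs X) => h.apply_mem g ha
  obtain ⟨U, hU, hβ⟩ := h
  induction F using Finset.induction with
  | empty =>
    refine ⟨1, fun g => ⟨one_mem _, fun p hp => ?_⟩⟩
    rw [Finset.coe_empty] at hp
    obtain ⟨c, rfl⟩ := S.obs_empty hp
    rw [map_smul]
    have h1 : β g 1 = 1 := map_one (β g)
    rw [h1]
    simp
  | insert j F hj ih =>
    obtain ⟨V, hV⟩ := ih
    have hd : Disjoint ({j} : Set ℤ) (F : Set ℤ) := by simpa using hj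
    have hsub : (F : Set ℤ) ⊆ (insert j F : Finset ℤ) := by
      rw [Finset.coe_insert]; exact Set.subset_insert _ _
    have hjm : j ∈ ((insert j F : Finset ℤ) : Set ℤ) := by simp
    refine ⟨MonoidHom.mk' (fun g => U j g * V g) fun g k => ?_, fun g => ⟨?_, ?_⟩⟩
    · apply Subtype.ext
      change ((U j (g * k) : S.Alg) * (V (g * k) : S.Alg)) = U j g * V g * (U j k * V k)
      rw [map_mul, map_mul]
      change ((U j g : S.Alg) * U j k) * (V g * V k) = _
      rw [mul_assoc (U j g : S.Alg), ← mul_assoc (U j k : S.Alg),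
        S.obs_commute hd (hU j k) (hV g).1]
      simp only [mul_assoc]
    · exact mul_mem (S.obs_site_le hjm (hU j g)) (S.obs_mono hsub (hV g).1)
    · refine S.hom_eq_of_site (β g : S.Alg →⋆ₐ[ℂ] S.Alg)
        (conjAut (U j g * V g) : S.Alg →⋆ₐ[ℂ] S.Alg) fun i hi x hx => ?_
      change β g x = (U j g * V g : S.Alg) * x * star (U j g * V g : S.Alg)
      rw [star_mul]
      rw [Finset.coe_insert] at hi
      rcases hi with rfl | hi
      · rw [hβ i g x hx, mul_assoc (U i g : S.Alg) (V g : S.Alg) x,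
          ← S.obs_commute hd hx (hV g).1]
        simp only [mul_assoc, mul_star_self_cancel]
      · have hx' := S.obs_site_le hi hx
        have h1 := S.obs_commute hd (hU j g) (hmem g hx')
        rw [(hV g).2 x hx'] at h1 ⊢
        calc (V g : S.Alg) * x * star (V g : S.Alg) =
              (U j g : S.Alg) * (V g * x * star (V g : S.Alg)) * star (U j g : S.Alg) := by
              rw [h1, mul_star_self_cancel_right]
          _ = _ := by simp only [mul_assoc]

theorem IsOnSite.exists_rep_of_finite (h : S.IsOnSite β) {X : Set ℤ} (hX : X.Finite) :
    ∃ U : G →* unitary S.Alg, Implements β (S.obs X) U := by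
  obtain ⟨F, rfl⟩ := hX.exists_finset_coe
  exact h.exists_rep F

theorem IsOnSite.hasClass (h : S.IsOnSite β) {X : Set ℤ} (hX : X.Finite) :
    HasClass β (S.obs X) 0 := by
  obtain ⟨U, hU⟩ := h.exists_rep_of_finite hX
  exact ⟨(S.isMatrix_obs hX).hasTrivialCenter, U, fun _ _ => 1, hU, fun g k => by simp,
    IsClass.one⟩

/-- A layer of symmetric gates commutes with the symmetry. -/
theorem Layer.Implements.comm_symmetry (hβ : S.IsOnSite β) {L : S.Layer} {δ : S.Aut}
    (h : L.Implements δ) (hL : ∀ a, (L.gate a : S.Alg) ∈ fixedAlg β) (g : G) :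
    δ * β g = β g * δ := by
  refine S.aut_eq_of_site fun j x hx => ?_
  change δ (β g x) = β g (δ x)
  rw [h.site hx, h.site (hβ.apply_mem g hx), map_mul, map_mul, map_star, hL _ g]

theorem IsCircuitIn.comm_symmetry (hβ : S.IsOnSite β) {γ : S.Aut}
    (h : S.IsCircuitIn (fixedAlg β) γ) (g : G) : γ * β g = β g * γ := by
  refine h.induction (p := fun γ => γ * β g = β g * γ) (by simp) ?_
  intro L δ γ hL hLB ih
  rw [mul_assoc, ih, ← mul_assoc, hL.comm_symmetry hβ hLB, mul_assoc]

theorem apply_mem_fixedAlg {γ : S.Aut} (h : ∀ g, γ * β g = β g * γ) {a : S.Alg}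
    (ha : a ∈ fixedAlg β) : γ a ∈ fixedAlg β := fun g => by
  have h1 := DFunLike.congr_fun (h g) a
  change γ (β g a) = β g (γ a) at h1
  rw [← h1, ha g]

end SpinChain

/-! ### The boundary algebra -/

/-- Removing a matrix factor on which the action comes from a representation does not change the
class. -/
theorem HasClass.centralizer_iff {G : Type} [Group G] {A : Type*} [CStarAlgebra A] [Nontrivial A]
    {β : G →* (A ≃⋆ₐ[ℂ] A)} {M B : StarSubalgebra ℂ A} {κ : H2U1 G} (hMm : IsMatrix M)
    (hM : HasClass β M 0) (hMB : M ≤ B) :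
    HasClass β (B ⊓ StarSubalgebra.centralizer ℂ (M : Set A)) κ ↔ HasClass β B κ := by
  constructor
  · intro h
    have hgen : ∀ K : StarSubalgebra ℂ A, IsClosed (K : Set A) → M ≤ K →
        B ⊓ StarSubalgebra.centralizer ℂ (M : Set A) ≤ K → B ≤ K :=
      fun K _ h1 h2 => hMm.le_of_le hMB h1 h2
    have hc : HasTrivialCenter B := fun z hz hzc => by
      refine h.1 z ⟨hz, mem_centralizer_of_comm fun m hm => (hzc m (hMB hm)).symm⟩ fun b hb => ?_
      exact hzc b hb.1
    have := hM.add h hc hMB inf_le_left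
      (fun m hm c hc => comm_of_mem_centralizer hc.2 hm) hgen
    rwa [zero_add] at this
  · intro h
    simpa using HasClass.sub hMm hM h hMB

namespace SpinChain

variable {S : SpinChain} {G : Type} [Group G]

theorem mem_map_aut {B : StarSubalgebra ℂ S.Alg} (γ : S.Aut) {y : S.Alg} :
    y ∈ B.map (γ : S.Alg →⋆ₐ[ℂ] S.Alg) ↔ γ⁻¹ y ∈ B := by
  constructor
  · rintro ⟨a, ha, rfl⟩
    change γ⁻¹ (γ a) ∈ B
    rwa [aut_inv_apply]
  · exact fun h => ⟨_, h, S.aut_apply_inv γ y⟩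

/-- The boundary algebra `α(𝒜_{L_x}) ∩ (𝒜_{L_{x-r}})'` of an automorphism. -/
def boundary (α : S.Aut) (x : ℤ) (r : ℕ) : StarSubalgebra ℂ S.Alg :=
  (S.obs (Set.Iio x)).map (α : S.Alg →⋆ₐ[ℂ] S.Alg) ⊓
    StarSubalgebra.centralizer ℂ (S.obs (Set.Iio (x - r)) : Set S.Alg)

theorem mem_boundary {α : S.Aut} {x : ℤ} {r : ℕ} {y : S.Alg} :
    y ∈ boundary α x r ↔ α⁻¹ y ∈ S.obs (Set.Iio x) ∧ y ∈ S.obs (Set.Ici (x - r)) := by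
  rw [boundary, StarSubalgebra.mem_inf, mem_map_aut, centralizer_obs, Set.compl_Iio]

/-- If `α` preserves `𝒜_{L_x}` up to conjugation by a unitary near `x`, then the boundary algebra is
conjugate to the algebra of the `r` sites left of the cut. -/
theorem boundary_eq_map {α : S.Aut} {x : ℤ} {r : ℕ} {u : unitary S.Alg}
    (hu : (u : S.Alg) ∈ S.obs (Set.Ici (x - r)))
    (h : S.Preserves ((conjAut u)⁻¹ * α) (Set.Iio x)) :
    boundary α x r =
      (S.obs (Set.Ico (x - r) x)).map (conjAut u : S.Alg →⋆ₐ[ℂ] S.Alg) := by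
  ext y
  have h1 := h (α⁻¹ y)
  have h2 : ((conjAut u)⁻¹ * α) (α⁻¹ y) = (conjAut u)⁻¹ y :=
    congrArg (fun z => (conjAut u : S.Aut)⁻¹ z) (S.aut_apply_inv α y)
  rw [h2] at h1
  rw [mem_boundary, h1, mem_map_aut, ← Set.Ici_inter_Iio, obs_inter, (preserves_conj hu).inv y]
  exact and_comm

/-- Increasing the range by `R - r` at a fixed cut adds the algebra of `R - r` sites. -/
theorem boundary_inf_left {α : S.Aut} {x : ℤ} {r R : ℕ} (h : r ≤ R) :
    boundary α x R ⊓ StarSubalgebra.centralizer ℂ (S.obs (Set.Ico (x - R) (x - r)) : Set S.Alg) =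
      boundary α x r := by
  ext y
  have hs : Set.Ici (x - (r : ℤ)) = Set.Ici (x - (R : ℤ)) ∩ (Set.Ico (x - R : ℤ) (x - r))ᶜ := by
    ext j
    have : (r : ℤ) ≤ R := by exact_mod_cast h
    simp only [Set.mem_Ici, Set.mem_inter_iff, Set.mem_compl_iff, Set.mem_Ico]
    omega
  rw [StarSubalgebra.mem_inf, mem_boundary, mem_boundary, hs, obs_inter, StarSubalgebra.mem_inf,
    centralizer_obs, and_assoc]

/-- Moving the cut to the right by `m`, with the left end fixed, adds the image under `α` of the
algebra of `m` sites. -/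
theorem boundary_inf_right {α : S.Aut} {x : ℤ} {r m : ℕ} :
    boundary α (x + m) (r + m) ⊓ StarSubalgebra.centralizer ℂ
      ((S.obs (Set.Ico x (x + m))).map (α : S.Alg →⋆ₐ[ℂ] S.Alg) : Set S.Alg) =
      boundary α x r := by
  ext y
  have hs : Set.Iio x = Set.Iio (x + (m : ℤ)) ∩ (Set.Ico x (x + m))ᶜ := by
    ext j
    simp only [Set.mem_Iio, Set.mem_inter_iff, Set.mem_compl_iff, Set.mem_Ico]
    omega
  have hm : x + (m : ℤ) - ((r + m : ℕ) : ℤ) = x - r := by push_cast; ring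
  have hc : y ∈ StarSubalgebra.centralizer ℂ
      ((S.obs (Set.Ico x (x + m))).map (α : S.Alg →⋆ₐ[ℂ] S.Alg) : Set S.Alg) ↔
      α⁻¹ y ∈ S.obs (Set.Ico x (x + m))ᶜ := by
    rw [← centralizer_obs]
    constructor
    · refine fun h => mem_centralizer_of_comm fun b hb => ?_
      apply S.aut_injective α
      rw [map_mul, map_mul, aut_apply_inv]
      exact comm_of_mem_centralizer h ⟨b, hb, rfl⟩
    · refine fun h => mem_centralizer_of_comm ?_
      rintro _ ⟨b, hb, rfl⟩
      have := congrArg α (comm_of_mem_centralizer h hb)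
      rwa [map_mul, map_mul, aut_apply_inv] at this
  rw [StarSubalgebra.mem_inf, mem_boundary, mem_boundary, hc, hm, hs, obs_inter,
    StarSubalgebra.mem_inf, and_right_comm]

variable {β : G →* S.Aut} {α : S.Aut} {κ : H2U1 G}

theorem HasClass.map_aut {B : StarSubalgebra ℂ S.Alg} {κ : H2U1 G} (h : HasClass β B κ) (γ : S.Aut)
    (hγ : ∀ g, γ * β g = β g * γ) : HasClass β (B.map (γ : S.Alg →⋆ₐ[ℂ] S.Alg)) κ :=
  h.map (γ : S.Alg →⋆ₐ[ℂ] S.Alg) (S.aut_injective γ) fun g a _ => DFunLike.congr_fun (hγ g) a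

theorem hasClass_boundary_left (hβ : S.IsOnSite β) {x : ℤ} {r R : ℕ} (hr : S.HasRange α r)
    (h : r ≤ R) : HasClass β (boundary α x r) κ ↔ HasClass β (boundary α x R) κ := by
  rw [← boundary_inf_left h]
  refine HasClass.centralizer_iff (S.isMatrix_obs (Set.finite_Ico _ _))
    (hβ.hasClass (Set.finite_Ico _ _)) fun a ha => mem_boundary.2 ⟨?_, ?_⟩
  · refine hr.inv.of_subset (fun i hi k hk => ?_) ha
    simp only [Set.mem_Iio]
    linarith [hi.2, hk.2]
  · exact S.obs_mono Set.Ico_subset_Ici_self ha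

theorem hasClass_boundary_right (hβ : S.IsOnSite β) (hα : ∀ g, α * β g = β g * α) {x : ℤ} {r : ℕ}
    (hr : S.HasRange α r) (m : ℕ) :
    HasClass β (boundary α x r) κ ↔ HasClass β (boundary α (x + m) (r + m)) κ := by
  rw [← boundary_inf_right (m := m)]
  refine HasClass.centralizer_iff ((S.isMatrix_obs (Set.finite_Ico _ _)).map _)
    (HasClass.map_aut (hβ.hasClass (Set.finite_Ico _ _)) α hα) ?_
  rintro _ ⟨a, ha, rfl⟩
  refine mem_boundary.2 ⟨?_, ?_⟩
  · change α⁻¹ (α a) ∈ _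
    rw [aut_inv_apply]
    exact S.obs_mono Set.Ico_subset_Iio_self ha
  · refine hr.of_subset (fun i hi k hk => ?_) ha
    have h1 := hi.1
    have h2 := hk.1
    simp only [Set.mem_Ici]
    push_cast
    linarith

/-- The class of the boundary algebra depends neither on the cut nor on the range. -/
theorem hasClass_boundary_iff (hβ : S.IsOnSite β) (hα : ∀ g, α * β g = β g * α) {x x' : ℤ}
    {r r' : ℕ} (hr : S.HasRange α r) (hr' : S.HasRange α r') :
    HasClass β (boundary α x r) κ ↔ HasClass β (boundary α x' r') κ := by
  have key : ∀ {x x' : ℤ} {r r' : ℕ}, x ≤ x' → S.HasRange α r → S.HasRange α r' →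
      (HasClass β (boundary α x r) κ ↔ HasClass β (boundary α x' r') κ) := by
    intro x x' r r' hx hr hr'
    obtain ⟨m, rfl⟩ := Int.le.dest hx
    rw [hasClass_boundary_right hβ hα hr m,
      hasClass_boundary_left hβ (hr.mono (Nat.le_add_right r m)) (le_max_left _ r'),
      hasClass_boundary_left hβ hr' (le_max_right (r + m) _)]
  rcases le_total x x' with h | h
  · exact key h hr hr'
  · exact (key h hr' hr).symm

variable (β α κ) in
/-- `κ` is the class of the boundary algebra at every cut. -/
def HasIndexClass : Prop := ∀ (x : ℤ) (r : ℕ), S.HasRange α r → HasClass β (boundary α x r) κ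

theorem HasIndexClass.of_cut (hβ : S.IsOnSite β) (hα : ∀ g, α * β g = β g * α) {x : ℤ} {r : ℕ}
    (hr : S.HasRange α r) (h : HasClass β (boundary α x r) κ) : HasIndexClass β α κ :=
  fun _ _ hr' => (hasClass_boundary_iff hβ hα hr hr').1 h

theorem HasIndexClass.unique {κ' : H2U1 G} {r : ℕ} (hr : S.HasRange α r)
    (h : HasIndexClass β α κ) (h' : HasIndexClass β α κ') : κ = κ' :=
  (h 0 r hr).unique (h' 0 r hr)

/-- A finite depth circuit has a range and, up to conjugation by unitaries near the cuts, it
preserves the half-chains; both with the same, arbitrarily large, distance. -/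
theorem IsFDQC.exists_range_cut (h : S.IsFDQC α) : ∃ R₀ : ℕ, ∀ R, R₀ ≤ R → S.HasRange α R ∧
    ∀ x : ℤ, ∃ u : unitary S.Alg, (u : S.Alg) ∈ S.obs (Set.Ico (x - R) (x + R)) ∧
      S.Preserves ((conjAut u)⁻¹ * α) (Set.Iio x) := by
  rw [← isCircuitIn_top_iff] at h
  have hB : ∀ (L : S.Layer) (δ : S.Aut), L.Implements δ →
      (∀ a, (L.gate a : S.Alg) ∈ (⊤ : StarSubalgebra ℂ S.Alg)) →
      ∀ b ∈ (⊤ : StarSubalgebra ℂ S.Alg), δ b ∈ (⊤ : StarSubalgebra ℂ S.Alg) :=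
    fun _ _ _ _ _ _ => StarSubalgebra.mem_top
  obtain ⟨r, hr⟩ := h.exists_hasRange
  obtain ⟨R, hR⟩ := h.exists_cut hB
  refine ⟨max r R, fun R' hR' => ⟨hr.mono ((le_max_left _ _).trans hR'), fun x => ?_⟩⟩
  obtain ⟨u, -, hu, hux⟩ := hR x
  have : (R : ℤ) ≤ R' := by exact_mod_cast (le_max_right _ _).trans hR'
  exact ⟨u, S.obs_mono (Set.Ico_subset_Ico (by linarith) (by linarith)) hu, hux⟩

theorem boundary_apply_mem (hβ : S.IsOnSite β) (hα : ∀ g, α * β g = β g * α) {x : ℤ} {r : ℕ} (g : G)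
    {y : S.Alg} (hy : y ∈ boundary α x r) : β g y ∈ boundary α x r := by
  rw [mem_boundary] at hy ⊢
  refine ⟨?_, hβ.apply_mem g hy.2⟩
  have h1 : α⁻¹ (β g y) = β g (α⁻¹ y) := by
    apply S.aut_injective α
    rw [aut_apply_inv]
    have := DFunLike.congr_fun (hα g) (α⁻¹ y)
    change α (β g (α⁻¹ y)) = β g (α (α⁻¹ y)) at this
    rw [this, aut_apply_inv]
  rw [h1]
  exact hβ.apply_mem g hy.1

theorem exists_hasIndexClass (hβ : S.IsOnSite β) (hα : ∀ g, α * β g = β g * α) (h : S.IsFDQC α) :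
    ∃ κ, HasIndexClass β α κ := by
  obtain ⟨R, hR⟩ := h.exists_range_cut
  obtain ⟨hr, hcut⟩ := hR R le_rfl
  obtain ⟨u, hu, hux⟩ := hcut 0
  have hm : IsMatrix (boundary α 0 R) := by
    rw [boundary_eq_map (S.obs_mono Set.Ico_subset_Ici_self hu) hux]
    exact (S.isMatrix_obs (Set.finite_Ico _ _)).map _
  obtain ⟨κ, hκ⟩ := HasClass.exists_of_isMatrix hm fun g b hb => boundary_apply_mem hβ hα g hb
  exact ⟨κ, .of_cut hβ hα hr hκ⟩

end SpinChain

open SpinChain in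
theorem SymmetricEntangler.hasIndex_of_class {G : Type} [Group G] (E : SymmetricEntangler G)
    (κ : H2U1 G) : HasIndexClass E.β E.α κ → E.HasIndex κ := by
  intro h
  refine ⟨?_, fun x r hr => ?_⟩
  · obtain ⟨R, hR⟩ := E.isFDQC.exists_range_cut
    exact ⟨R, (hR R le_rfl).1⟩
  · have h1 := h x r hr
    obtain ⟨-, W, -, hW, -⟩ := id h1
    refine ⟨⟨W, hW⟩, fun V hV => ?_⟩
    obtain ⟨μ, hμ, c, hc, hκ⟩ := h1.of_implements hV
    refine ⟨c, fun g h => ?_, hκ⟩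
    rw [hc]
    exact hμ g h

/-! ### Stacking -/

namespace SpinChain

variable {S T : SpinChain} {G : Type} [Group G]

/-- The observables of a stacked chain are generated by those of the two chains. -/
theorem stack_obs_le {X : Set ℤ} {K : StarSubalgebra ℂ (S.stack T).Alg}
    (hK : IsClosed (K : Set (S.stack T).Alg)) (hl : ∀ a ∈ S.obs X, S.inl T a ∈ K)
    (hr : ∀ b ∈ T.obs X, S.inr T b ∈ K) : (S.stack T).obs X ≤ K := by
  intro x hx
  refine obs_induction _ (p := fun x => x ∈ K) hK (fun F hF k => ?_) hx
  obtain ⟨z, rfl⟩ := (Amplify.tensorHom_bijective (S.localStackEquiv T F)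
    ((S.localStackEquiv T F).trans (Equiv.prodComm _ _)) (fun _ => rfl)).2 k
  induction z with
  | zero => rw [map_zero, map_zero]; exact zero_mem _
  | add x y hx hy => rw [map_add, map_add]; exact add_mem hx hy
  | tmul a b =>
    have : Amplify.tensorHom (S.localStackEquiv T F)
        ((S.localStackEquiv T F).trans (Equiv.prodComm _ _)) (fun _ => rfl) (a ⊗ₜ b) =
        amplify (S.localStackEquiv T F) a *
          amplify ((S.localStackEquiv T F).trans (Equiv.prodComm _ _)) b := by
      simp [Amplify.tensorHom]
    rw [this, map_mul, ← inl_loc, ← inr_loc]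
    exact mul_mem (hl _ (S.loc_mem_obs hF a)) (hr _ (T.loc_mem_obs hF b))

theorem stack_map_mem {A : Type*} [CStarAlgebra A] (f : (S.stack T).Alg →⋆ₐ[ℂ] A) {X : Set ℤ}
    {K : StarSubalgebra ℂ A} (hK : IsClosed (K : Set A)) (hl : ∀ a ∈ S.obs X, f (S.inl T a) ∈ K)
    (hr : ∀ b ∈ T.obs X, f (S.inr T b) ∈ K) {a : (S.stack T).Alg} (ha : a ∈ (S.stack T).obs X) :
    f a ∈ K :=
  stack_obs_le (K := K.comap f) (hK.preimage (continuous_hom f)) hl hr ha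

theorem inl_injective (S T : SpinChain) : Function.Injective (S.inl T) := fun _ _ h =>
  Subtype.ext (Amplify.amplify_injective (S.stackEquiv T) (congrArg Subtype.val h))

theorem inr_injective (S T : SpinChain) : Function.Injective (S.inr T) := fun _ _ h =>
  Subtype.ext (Amplify.amplify_injective (S.stackEquiv' T) (congrArg Subtype.val h))

theorem Preserves.tensorAut {θ : S.Aut} {θ' : T.Aut} {X : Set ℤ} (h : S.Preserves θ X)
    (h' : T.Preserves θ' X) : (S.stack T).Preserves (S.tensorAut T θ θ') X := by
  have key : ∀ {X : Set ℤ}, S.Preserves θ X → T.Preserves θ' X → ∀ a ∈ (S.stack T).obs X,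
      S.tensorAut T θ θ' a ∈ (S.stack T).obs X := by
    intro X h h' a ha
    refine stack_map_mem (S.tensorAut T θ θ' : (S.stack T).Alg →⋆ₐ[ℂ] (S.stack T).Alg)
      (isClosed_obs _ X) (fun a ha => ?_) (fun b hb => ?_) ha
    · change S.tensorAut T θ θ' (S.inl T a) ∈ _
      rw [tensorAut_inl]
      exact S.inl_mem_obs T ((h a).1 ha)
    · change S.tensorAut T θ θ' (S.inr T b) ∈ _
      rw [tensorAut_inr]
      exact S.inr_mem_obs T ((h' b).1 hb)
  exact Preserves.of_le (key h h') (key h.compl h'.compl)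

/-- The unitary `u ⊗ v`. -/
def tensorU (u : unitary S.Alg) (v : unitary T.Alg) : unitary (S.stack T).Alg :=
  ⟨S.inl T u * S.inr T v, mul_mem (Unitary.map_mem (S.inl T) u.2) (Unitary.map_mem (S.inr T) v.2)⟩

theorem tensorAut_conjAut (u : unitary S.Alg) (v : unitary T.Alg) :
    S.tensorAut T (conjAut u) (conjAut v) = conjAut (tensorU u v) :=
  StarAlgEquiv.ext fun x => S.tensorAut_conj T (X := Set.univ) u v (fun _ _ => rfl)
    (fun _ _ => rfl) x (by rw [obs_univ]; trivial)

theorem tensorAut_inv (α : S.Aut) (α' : T.Aut) :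
    (S.tensorAut T α α')⁻¹ = S.tensorAut T α⁻¹ α'⁻¹ := by
  rw [inv_eq_iff_mul_eq_one, ← tensorAut_mul, mul_inv_cancel, mul_inv_cancel, tensorAut_one]

variable {β : G →* S.Aut} {β' : G →* T.Aut} {α : S.Aut} {α' : T.Aut} {κ κ' : H2U1 G}

/-- The index class is additive under stacking. -/
theorem HasIndexClass.stack (hβ : S.IsOnSite β) (hβ' : T.IsOnSite β') (hα : ∀ g, α * β g = β g * α)
    (hα' : ∀ g, α' * β' g = β' g * α') (hF : S.IsFDQC α) (hF' : T.IsFDQC α')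
    (h : HasIndexClass β α κ) (h' : HasIndexClass β' α' κ') :
    HasIndexClass (S.tensorSymmetry T β β') (S.tensorAut T α α') (κ + κ') := by
  obtain ⟨R₁, hR₁⟩ := hF.exists_range_cut
  obtain ⟨R₂, hR₂⟩ := hF'.exists_range_cut
  obtain ⟨R₃, hR₃⟩ := (hF.stack hF').exists_range_cut
  obtain ⟨R, h₁, h₂, h₃⟩ : ∃ R, R₁ ≤ R ∧ R₂ ≤ R ∧ R₃ ≤ R :=
    ⟨max R₁ (max R₂ R₃), by omega, by omega, by omega⟩
  obtain ⟨hr, hc⟩ := hR₁ R h₁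
  obtain ⟨hr', hc'⟩ := hR₂ R h₂
  obtain ⟨hr'', -⟩ := hR₃ R h₃
  obtain ⟨u, hu, hux⟩ := hc 0
  obtain ⟨v, hv, hvx⟩ := hc' 0
  replace hu := S.obs_mono Set.Ico_subset_Ici_self hu
  replace hv := T.obs_mono Set.Ico_subset_Ici_self hv
  have hw : ((tensorU u v : unitary (S.stack T).Alg) : (S.stack T).Alg) ∈
      (S.stack T).obs (Set.Ici (0 - (R : ℤ))) :=
    mul_mem (S.inl_mem_obs T hu) (S.inr_mem_obs T hv)
  have hwx : (S.stack T).Preserves ((conjAut (tensorU u v))⁻¹ * S.tensorAut T α α')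
      (Set.Iio 0) := by
    rw [← tensorAut_conjAut, tensorAut_inv, ← tensorAut_mul]
    exact hux.tensorAut hvx
  refine HasIndexClass.of_cut (hβ.stack hβ') (fun g => ?_) (x := 0) hr'' ?_
  · change _ * S.tensorAut T (β g) (β' g) = S.tensorAut T (β g) (β' g) * _
    rw [← tensorAut_mul, ← tensorAut_mul, hα, hα']
  have hM : HasClass (S.tensorSymmetry T β β') ((boundary α 0 R).map (S.inl T)) κ :=
    (h 0 R hr).map _ (S.inl_injective T) fun g a _ => (S.tensorAut_inl T (β g) (β' g) a).symm
  have hC : HasClass (S.tensorSymmetry T β β') ((boundary α' 0 R).map (S.inr T)) κ' :=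
    (h' 0 R hr').map _ (S.inr_injective T) fun g a _ => (S.tensorAut_inr T (β g) (β' g) a).symm
  have hl : ∀ a, conjAut (tensorU u v) (S.inl T a) = S.inl T (conjAut u a) := fun a => by
    rw [← tensorAut_conjAut, tensorAut_inl]
  have hr : ∀ b, conjAut (tensorU u v) (S.inr T b) = S.inr T (conjAut v b) := fun b => by
    rw [← tensorAut_conjAut, tensorAut_inr]
  refine hM.add hC ?_ ?_ ?_ ?_ ?_
  · rw [boundary_eq_map hw hwx]
    exact ((isMatrix_obs _ (Set.finite_Ico _ _)).map _).hasTrivialCenter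
  · rw [boundary_eq_map hw hwx, boundary_eq_map hu hux]
    rintro _ ⟨_, ⟨a, ha, rfl⟩, rfl⟩
    exact ⟨S.inl T a, S.inl_mem_obs T ha, hl a⟩
  · rw [boundary_eq_map hw hwx, boundary_eq_map hv hvx]
    rintro _ ⟨_, ⟨a, ha, rfl⟩, rfl⟩
    exact ⟨S.inr T a, S.inr_mem_obs T ha, hr a⟩
  · rintro _ ⟨a, -, rfl⟩ _ ⟨b, -, rfl⟩
    exact S.inl_commute_inr T a b
  · intro K hK hMK hCK
    rw [boundary_eq_map hw hwx]
    rw [boundary_eq_map hu hux] at hMK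
    rw [boundary_eq_map hv hvx] at hCK
    rintro _ ⟨y, hy, rfl⟩
    refine stack_map_mem (conjAut (tensorU u v) : (S.stack T).Alg →⋆ₐ[ℂ] (S.stack T).Alg) hK
      (fun a ha => ?_) (fun b hb => ?_) hy
    · exact hMK ⟨_, ⟨a, ha, rfl⟩, (hl a).symm⟩
    · exact hCK ⟨_, ⟨b, hb, rfl⟩, (hr b).symm⟩

/-! ### Inverses, identities and symmetric circuits -/

theorem HasIndexClass.one (hβ : S.IsOnSite β) : HasIndexClass β (1 : S.Aut) 0 := by
  refine HasIndexClass.of_cut hβ (fun g => by rw [one_mul, mul_one]) (x := 0) HasRange.one ?_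
  have h1 : ((1 : unitary S.Alg) : S.Alg) ∈ S.obs (Set.Ici (0 - ((0 : ℕ) : ℤ))) := one_mem _
  rw [boundary_eq_map h1 (by rw [conjAut_one, inv_one, one_mul]; exact Preserves.one)]
  exact HasClass.map_aut (hβ.hasClass (Set.finite_Ico _ _)) _ fun g => by
    rw [conjAut_one, one_mul, mul_one]

theorem IsFDQC.inv (h : S.IsFDQC α) : S.IsFDQC α⁻¹ :=
  isCircuitIn_top_iff.1 (isCircuitIn_top_iff.2 h).inv

theorem inv_comm (hα : ∀ g, α * β g = β g * α) (g : G) : α⁻¹ * β g = β g * α⁻¹ :=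
  (Commute.inv_left (hα g)).eq

/-- The relative commutant of the boundary algebra of `α⁻¹` in the algebra of an interval consists
of the images under `α⁻¹` of the elements of a boundary algebra of `α`. -/
theorem relativeCommutant_le {R : ℕ} {u : unitary S.Alg}
    (hu : (u : S.Alg) ∈ S.obs (Set.Ici (0 - (R : ℤ))))
    (hux : S.Preserves ((conjAut u)⁻¹ * α⁻¹) (Set.Iio 0)) :
    S.obs (Set.Ico (0 - R : ℤ) R) ⊓
      StarSubalgebra.centralizer ℂ (boundary α⁻¹ 0 R : Set S.Alg) ≤
      (boundary α R R).map ((α⁻¹ : S.Aut) : S.Alg →⋆ₐ[ℂ] S.Alg) := by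
  rintro c ⟨hcB, hcM⟩
  refine ⟨α c, mem_boundary.2 ⟨?_, ?_⟩, S.aut_inv_apply α c⟩
  · rw [aut_inv_apply]; exact S.obs_mono Set.Ico_subset_Iio_self hcB
  rw [sub_self]
  refine S.mem_obs_iff.2 fun b hb => ?_
  rw [Set.compl_Ici] at hb
  apply S.aut_injective α⁻¹
  rw [map_mul, map_mul, aut_inv_apply]
  have h1 : conjAut u * ((conjAut u)⁻¹ * α⁻¹) = α⁻¹ := mul_inv_cancel_left _ _
  have h2 := (hux b).1 hb
  rw [← DFunLike.congr_fun h1 b]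
  change conjAut u (((conjAut u)⁻¹ * α⁻¹) b) * c = c * conjAut u (((conjAut u)⁻¹ * α⁻¹) b)
  generalize ((conjAut u)⁻¹ * α⁻¹) b = y at h2
  have hs : Set.Iio (0 : ℤ) ⊆ Set.Iio (0 - (R : ℤ)) ∪ Set.Ico (0 - (R : ℤ)) 0 := by
    intro j hj
    simp only [Set.mem_union, Set.mem_Iio, Set.mem_Ico] at hj ⊢
    omega
  have h3 : conjAut u y ∈ StarSubalgebra.centralizer ℂ ({c} : Set S.Alg) := by
    refine S.map_mem_of_site (conjAut u : S.Alg →⋆ₐ[ℂ] S.Alg) (isClosed_centralizer_singleton c)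
      (fun j hj a ha => ?_) h2
    change conjAut u a ∈ _
    rcases hs hj with hj | hj
    · have ha' := S.obs_site_le hj ha
      have hd : Disjoint (Set.Iio (0 - (R : ℤ))) (Set.Ici (0 - (R : ℤ))) :=
        Set.Iio_disjoint_Ici le_rfl
      rw [conj_eq_of_commute (S.obs_commute hd.symm hu ha')]
      exact le_centralizer_of_generate (B := S.obs (Set.Iio (0 - (R : ℤ)))) (fun b hb =>
        S.obs_commute (hd.mono_right Set.Ico_subset_Ici_self) hb hcB) ha'
    · refine le_centralizer_of_generate (B := boundary α⁻¹ 0 R)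
        (fun b hb => comm_of_mem_centralizer hcM hb) ?_
      rw [boundary_eq_map hu hux]
      exact ⟨a, S.obs_site_le hj ha, rfl⟩
  exact (((StarSubalgebra.mem_centralizer_iff ℂ).1 h3 c rfl).1).symm

/-- The boundary algebras of `α` and of `α⁻¹` are, up to applying `α`, mutual commutants in the
algebra of an interval; hence their classes are opposite. -/
theorem HasIndexClass.inv (hβ : S.IsOnSite β) (hα : ∀ g, α * β g = β g * α) (hF : S.IsFDQC α)
    (h : HasIndexClass β α κ) : HasIndexClass β α⁻¹ (-κ) := by
  obtain ⟨κ', hκ'⟩ := exists_hasIndexClass hβ (inv_comm hα) hF.inv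
  obtain ⟨R₁, hR₁⟩ := hF.exists_range_cut
  obtain ⟨R₂, hR₂⟩ := hF.inv.exists_range_cut
  obtain ⟨hr, -⟩ := hR₁ (max R₁ R₂) (le_max_left _ _)
  obtain ⟨hr', hc⟩ := hR₂ (max R₁ R₂) (le_max_right _ _)
  generalize max R₁ R₂ = R at hr hr' hc
  obtain ⟨u, hu, hux⟩ := hc 0
  replace hu := S.obs_mono Set.Ico_subset_Ici_self hu
  have hM := hκ' 0 R hr'
  have hC := HasClass.map_aut (h R R hr) α⁻¹ (inv_comm hα)
  have hRR : (R : ℤ) - R = 0 := sub_self _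
  have hbm := boundary_eq_map hu hux
  have hMm : IsMatrix (boundary α⁻¹ 0 R) := by
    rw [hbm]; exact (S.isMatrix_obs (Set.finite_Ico _ _)).map _
  have hMB : boundary α⁻¹ 0 R ≤ S.obs (Set.Ico (0 - R : ℤ) R) := by
    intro m hm
    rw [mem_boundary, inv_inv] at hm
    rw [← Set.Ici_inter_Iio, obs_inter]
    refine ⟨hm.2, ?_⟩
    rw [← S.aut_inv_apply α m]
    refine hr'.of_subset (fun i hi k hk => ?_) hm.1
    simp only [Set.mem_Iio] at hi ⊢
    linarith [hk.2]
  have hCB : (boundary α R R).map ((α⁻¹ : S.Aut) : S.Alg →⋆ₐ[ℂ] S.Alg) ≤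
      S.obs (Set.Ico (0 - R : ℤ) R) := by
    rintro _ ⟨p, hp, rfl⟩
    change α⁻¹ p ∈ _
    replace hp := mem_boundary.1 hp
    rw [hRR] at hp
    rw [← Set.Ici_inter_Iio, obs_inter]
    refine ⟨hr'.of_subset (fun i hi k hk => ?_) hp.2, hp.1⟩
    simp only [Set.mem_Ici] at hi ⊢
    linarith [hk.1]
  have hcomm : ∀ m ∈ boundary α⁻¹ 0 R,
      ∀ c ∈ (boundary α R R).map ((α⁻¹ : S.Aut) : S.Alg →⋆ₐ[ℂ] S.Alg), m * c = c * m := by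
    rintro m hm _ ⟨p, hp, rfl⟩
    change m * α⁻¹ p = α⁻¹ p * m
    rw [mem_boundary, inv_inv] at hm
    replace hp := mem_boundary.1 hp
    rw [hRR] at hp
    apply S.aut_injective α
    rw [map_mul, map_mul, aut_apply_inv]
    have hd : Disjoint (Set.Iio (0 : ℤ)) (Set.Ici (0 : ℤ)) := Set.Iio_disjoint_Ici le_rfl
    exact S.obs_commute hd hm.1 hp.2
  have hle := relativeCommutant_le hu hux
  have hB := hβ.hasClass (Set.finite_Ico (0 - R : ℤ) R)
  have hsum := hM.add hC hB.1 hMB hCB hcomm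
    fun K _ h1 h2 => hMm.le_of_le hMB h1 (hle.trans h2)
  have h0 : -κ = κ' := (eq_neg_of_add_eq_zero_left (hsum.unique hB)).symm
  rw [h0]
  exact hκ'

/-- The index class does not change under composition with a circuit of symmetric gates. -/
theorem HasIndexClass.mul_symmetric (hβ : S.IsOnSite β) (hα : ∀ g, α * β g = β g * α)
    (hF : S.IsFDQC α) {γ : S.Aut} (hγ : S.IsSymmetricFDQC β γ) (h : HasIndexClass β α κ) :
    HasIndexClass β (α * γ) κ := by
  rw [← isCircuitIn_fixedAlg_iff] at hγ
  obtain ⟨R, hR⟩ := hγ.exists_cut fun L δ hL hLB b hb =>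
    apply_mem_fixedAlg (hL.comm_symmetry hβ hLB) hb
  obtain ⟨r', hr'⟩ := hγ.exists_hasRange
  obtain ⟨r, hr⟩ := (isCircuitIn_top_iff.2 hF).exists_hasRange
  have hγβ := hγ.comm_symmetry hβ
  obtain ⟨s, hsβ, hs, hsx⟩ := hR 0
  have hr1 := hr.mono (show r ≤ r + r' + R by omega)
  have hr2 := (hr.mul hr').mono (show r + r' ≤ r + r' + R by omega)
  refine HasIndexClass.of_cut hβ (fun g => ?_) (x := 0) hr2 ?_
  · rw [mul_assoc, hγβ, ← mul_assoc, hα, mul_assoc]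
  have hsα : (mapU α s : S.Alg) ∈ S.obs (Set.Ici (0 - ((r + r' + R : ℕ) : ℤ))) := by
    refine hr.of_subset (fun i hi k hk => ?_) hs
    have h1 := hi.1
    have h2 := hk.1
    simp only [Set.mem_Ici]
    push_cast
    have : (0 : ℤ) ≤ r' := Int.natCast_nonneg _
    linarith
  have hb : boundary (α * γ) 0 (r + r' + R) =
      (boundary α 0 (r + r' + R)).map (conjAut (mapU α s) : S.Alg →⋆ₐ[ℂ] S.Alg) := by
    ext y
    rw [mem_map_aut, mem_boundary, mem_boundary, ← (preserves_conj hsα).inv y]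
    refine and_congr_left fun _ => ?_
    have h1 := hsx ((α * γ)⁻¹ y)
    have h2 : ((conjAut s)⁻¹ * γ) ((α * γ)⁻¹ y) = α⁻¹ ((conjAut (mapU α s))⁻¹ y) := by
      have h3 : ((conjAut s)⁻¹ * γ) * (α * γ)⁻¹ = α⁻¹ * (conjAut (mapU α s))⁻¹ := by
        rw [mul_inv_rev, ← mul_inv_rev (conjAut (mapU α s)), ← mul_conj]
        group
      exact DFunLike.congr_fun h3 y
    rw [h1, h2]
  rw [hb]
  refine HasClass.map_aut (h 0 _ hr1) _ fun g => ?_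
  rw [mul_conj (β g)]
  congr 2
  exact Subtype.ext (apply_mem_fixedAlg hα hsβ g).symm

/-- The index class is invariant under identifications of chains site by site. -/
theorem HasIndexClass.congr
    (hβ' : T.IsOnSite β') (hα' : ∀ g, α' * β' g = β' g * α') (hF : S.IsFDQC α) (hF' : T.IsFDQC α')
    (Φ : S.Alg ≃⋆ₐ[ℂ] T.Alg) (hΦ : ∀ j, ∀ a, a ∈ S.obs {j} ↔ Φ a ∈ T.obs {j})
    (hΦβ : ∀ g a, Φ (β g a) = β' g (Φ a)) (hΦα : ∀ a, α' (Φ a) = Φ (α a))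
    (h : HasIndexClass β α κ) : HasIndexClass β' α' κ := by
  obtain ⟨R₁, hR₁⟩ := hF.exists_range_cut
  obtain ⟨R₂, hR₂⟩ := hF'.exists_range_cut
  obtain ⟨hr, -⟩ := hR₁ (max R₁ R₂) (le_max_left _ _)
  obtain ⟨hr', -⟩ := hR₂ (max R₁ R₂) (le_max_right _ _)
  generalize max R₁ R₂ = R at hr hr'
  have h1 : ∀ X : Set ℤ, ∀ a ∈ S.obs X, Φ a ∈ T.obs X := fun X a ha =>
    S.map_mem_of_site (Φ : S.Alg →⋆ₐ[ℂ] T.Alg) (T.isClosed_obs X)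
      (fun j hj a ha => T.obs_site_le hj ((hΦ j a).1 ha)) ha
  have h2 : ∀ X : Set ℤ, ∀ a ∈ T.obs X, Φ.symm a ∈ S.obs X := fun X a ha =>
    T.map_mem_of_site (Φ.symm : T.Alg →⋆ₐ[ℂ] S.Alg) (S.isClosed_obs X)
      (fun j hj a ha => S.obs_site_le hj ((hΦ j _).2 (by
        change Φ (Φ.symm a) ∈ _
        rwa [Φ.apply_symm_apply]))) ha
  refine HasIndexClass.of_cut hβ' hα' (x := 0) hr' ?_
  have hb : boundary α' 0 R = (boundary α 0 R).map (Φ : S.Alg →⋆ₐ[ℂ] T.Alg) := by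
    have key : ∀ y : S.Alg, Φ y ∈ boundary α' 0 R ↔ y ∈ boundary α 0 R := by
      intro y
      have h3 : α'⁻¹ (Φ y) = Φ (α⁻¹ y) := by
        apply T.aut_injective α'
        rw [aut_apply_inv, hΦα, aut_apply_inv]
      have h4 : ∀ X : Set ℤ, ∀ z, Φ z ∈ T.obs X ↔ z ∈ S.obs X := fun X z =>
        ⟨fun hz => by simpa using h2 X _ hz, h1 X z⟩
      rw [mem_boundary, mem_boundary, h3, h4, h4]
    ext y
    constructor
    · intro hy
      refine ⟨Φ.symm y, (key _).1 ?_, Φ.apply_symm_apply y⟩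
      rwa [Φ.apply_symm_apply]
    · rintro ⟨z, hz, rfl⟩
      exact (key z).2 hz
  rw [hb]
  exact (h 0 R hr).map (Φ : S.Alg →⋆ₐ[ℂ] T.Alg) (EquivLike.injective Φ) fun g a _ => hΦβ g a

end SpinChain

/-! ### Symmetric cuts of circuits with vanishing index -/

/-- Two representations which permute the same projections `f h` simply transitively are intertwined
by the unitary `∑ₕ U(h) f(1) w(h)*`. -/
theorem exists_intertwiner {G : Type} [Group G] [Fintype G] [DecidableEq G] {A : Type*}
    [CStarAlgebra A] {B : StarSubalgebra ℂ A} (U w : G →* unitary A) (f : G → A)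
    (hU : ∀ g, (U g : A) ∈ B) (hw : ∀ g, (w g : A) ∈ B) (hf : ∀ h, f h ∈ B)
    (hstar : ∀ h, star (f h) = f h) (hmul : ∀ h k, f h * f k = if h = k then f h else 0)
    (hsum : ∑ h, f h = 1) (hUf : ∀ g h, (U g : A) * f h * star (U g : A) = f (g * h))
    (hwf : ∀ g h, (w g : A) * f h * star (w g : A) = f (g * h)) :
    ∃ c : unitary A, (c : A) ∈ B ∧ ∀ g, (c : A) * w g = U g * c := by
  have hU1 : ∀ h, (U h : A) * f 1 = f h * U h := fun h => by
    have := hUf h 1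
    rw [mul_one] at this
    rw [← this, star_mul_self_cancel_right]
  have hw1 : ∀ h, f 1 * star (w h : A) = star (w h : A) * f h := fun h => by
    have := hwf h 1
    rw [mul_one] at this
    rw [← this, mul_assoc, star_mul_self_cancel]
  obtain ⟨c, hc⟩ : ∃ c, c = ∑ h, (U h : A) * f 1 * star (w h : A) := ⟨_, rfl⟩
  have hcs : star c = ∑ h, (w h : A) * f 1 * star (U h : A) := by
    rw [hc, star_sum]
    exact Finset.sum_congr rfl fun h _ => by
      rw [star_mul, star_mul, star_star, hstar, mul_assoc]
  have h1 : c * star c = 1 := by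
    have : ∀ h k, (U h : A) * f 1 * star (w h : A) * ((w k : A) * f 1 * star (U k : A)) =
        if h = k then f h else 0 := fun h k => by
      have e1 : f 1 * star (w h : A) * ((w k : A) * f 1) =
          star (w h : A) * (f h * f k) * w k := by
        have e2 : (w k : A) * f 1 = f k * w k := by
          have := congrArg star (hw1 k)
          rwa [star_mul, star_mul, star_star, hstar, hstar] at this
        rw [e2, hw1]; simp only [mul_assoc]
      calc _ = (U h : A) * (f 1 * star (w h : A) * ((w k : A) * f 1)) * star (U k : A) := by
            simp only [mul_assoc]
        _ = _ := by
          rw [e1, hmul]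
          split_ifs with hk
          · subst hk
            rw [← hw1, mul_assoc (f 1), star_mul_val, mul_one, hUf, mul_one]
          · simp
    rw [hcs, hc, Finset.sum_mul_sum]
    simp only [this, Finset.sum_ite_eq, Finset.mem_univ, if_true, hsum]
  have h2 : star c * c = 1 := by
    have : ∀ h k, (w h : A) * f 1 * star (U h : A) * ((U k : A) * f 1 * star (w k : A)) =
        if h = k then f h else 0 := fun h k => by
      have e1 : f 1 * star (U h : A) * ((U k : A) * f 1) =
          star (U h : A) * (f h * f k) * U k := by
        have e2 : f 1 * star (U h : A) = star (U h : A) * f h := by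
          have := congrArg star (hU1 h)
          rwa [star_mul, star_mul, hstar, hstar] at this
        rw [hU1, e2]; simp only [mul_assoc]
      calc _ = (w h : A) * (f 1 * star (U h : A) * ((U k : A) * f 1)) * star (w k : A) := by
            simp only [mul_assoc]
        _ = _ := by
          rw [e1, hmul]
          split_ifs with hk
          · subst hk
            rw [mul_assoc (star (U h : A)), ← hU1, star_mul_self_cancel, hwf, mul_one]
          · simp
    rw [hcs, hc, Finset.sum_mul_sum]
    simp only [this, Finset.sum_ite_eq, Finset.mem_univ, if_true, hsum]
  refine ⟨⟨c, Unitary.mem_iff.2 ⟨h2, h1⟩⟩, ?_, fun g => ?_⟩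
  · change c ∈ B
    rw [hc]
    exact sum_mem fun h _ => mul_mem (mul_mem (hU h) (hf 1)) (star_mem (hw h))
  · change c * w g = U g * c
    rw [hc, Finset.sum_mul, Finset.mul_sum, ← Equiv.sum_comp (Equiv.mulLeft g)]
    refine Finset.sum_congr rfl fun h _ => ?_
    change (U (g * h) : A) * f 1 * star (w (g * h) : A) * w g = _
    rw [map_mul, map_mul]
    change (U g * U h : A) * f 1 * star (w g * w h : A) * w g = _
    rw [star_mul]
    simp only [mul_assoc, star_mul_val, mul_one]

namespace SpinChain

variable {S : SpinChain} {G : Type} [Group G]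

/-- Projections `f j h`, `h ∈ G`, on the site `j`, summing to one and permuted by the
symmetry like the points of `G` under left translation. -/
structure TranslationFrame [Fintype G] [DecidableEq G] (β : G →* S.Aut) where
  f : ℤ → G → S.Alg
  mem : ∀ j h, f j h ∈ S.obs {j}
  star_eq : ∀ j h, star (f j h) = f j h
  mul_eq : ∀ j h k, f j h * f j k = if h = k then f j h else 0
  sum_eq : ∀ j, ∑ h, f j h = 1
  apply_eq : ∀ j g h, β g (f j h) = f j (g * h)

/-- The complementary factor of a representation on an interval, relative to a representation of
the same group on the left part. -/
theorem exists_right_factor {x : ℤ} {R : ℕ} (V w : G →* unitary S.Alg)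
    (hV : ∀ g, (V g : S.Alg) ∈ S.obs (Set.Ico (x - R) (x + R)))
    (hw : ∀ g, (w g : S.Alg) ∈ S.obs (Set.Ico (x - R) x))
    (hVw : ∀ g, ∀ a ∈ S.obs (Set.Ico (x - R) x),
      (V g : S.Alg) * a * star (V g : S.Alg) = w g * a * star (w g : S.Alg)) :
    ∃ w' : G →* unitary S.Alg, (∀ g, (w' g : S.Alg) ∈ S.obs (Set.Ico x (x + R))) ∧
      (∀ g, (w g : S.Alg) * w' g = V g) ∧
      ∀ g, ∀ b ∈ S.obs (Set.Ico x (x + R)), ∀ b' ∈ S.obs (Set.Ico x (x + R)),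
        (V g : S.Alg) * b * star (V g : S.Alg) = b' →
        (w' g : S.Alg) * b * star (w' g : S.Alg) = b' := by
  have hd : Disjoint (Set.Ico (x - R : ℤ) x) (Set.Ico x (x + R)) :=
    Set.disjoint_left.2 fun i h1 h2 => not_lt.2 h2.1 h1.2
  have hsub : Set.Ico (x - R : ℤ) x ⊆ Set.Ico (x - R : ℤ) (x + R) :=
    Set.Ico_subset_Ico_right (by linarith [Int.natCast_nonneg R])
  have hmem : ∀ g, star (w g : S.Alg) * V g ∈ S.obs (Set.Ico x (x + R)) := by
    intro g
    have hs : Set.Ico x (x + R : ℤ) = Set.Ico (x - R : ℤ) (x + R) ∩ (Set.Ico (x - R : ℤ) x)ᶜ := by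
      ext j
      simp only [Set.mem_Ico, Set.mem_inter_iff, Set.mem_compl_iff]
      omega
    rw [hs, obs_inter, ← centralizer_obs]
    refine ⟨mul_mem (star_mem (S.obs_mono hsub (hw g))) (hV g), mem_centralizer_of_comm
      fun a ha => ?_⟩
    have h2 := congrArg (fun y => star (w g : S.Alg) * y * V g) (hVw g a ha)
    simp only [mul_assoc, star_mul_self_cancel, star_mul_val, mul_one] at h2
    simpa only [mul_assoc] using h2.symm
  refine ⟨MonoidHom.mk' (fun g => star (w g) * V g) fun g h => Subtype.ext ?_, hmem, fun g => ?_,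
    fun g b hb b' hb' h => ?_⟩
  · change star (w (g * h) : S.Alg) * V (g * h) =
      (star (w g : S.Alg) * V g) * (star (w h : S.Alg) * V h)
    have e1 := S.obs_commute hd (hw h) (hmem g)
    have e2 : (V (g * h) : S.Alg) = w (g * h) *
        ((star (w g : S.Alg) * V g) * (star (w h : S.Alg) * V h)) := by
      rw [map_mul w]
      change _ = (w g * w h : S.Alg) * _
      rw [mul_assoc (w g : S.Alg), ← mul_assoc (w h : S.Alg), e1]
      simp only [mul_assoc, mul_star_self_cancel]
      rw [map_mul]; rfl
    rw [e2, star_mul_self_cancel]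
  · exact mul_star_self_cancel (w g) _
  · change (star (w g : S.Alg) * V g) * b * star (star (w g : S.Alg) * V g) = b'
    have e1 := S.obs_commute hd (hw g) hb'
    rw [star_mul, star_star]
    calc _ = star (w g : S.Alg) * (V g * b * star (V g : S.Alg)) * w g := by simp only [mul_assoc]
      _ = b' := by rw [h, mul_assoc, ← e1, star_mul_self_cancel]

variable [Fintype G] [DecidableEq G] {β : G →* S.Aut} {α : S.Aut}

/-- If the index vanishes and the gates commute with a translation frame, then the unitaries which
cut the circuit can be chosen symmetric. On the interval around `x` the representation of `G`
factorizes across the cut as `Ul Ur`, and, pulled back along the given unitary `u`, as `wl wr`: the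
factor `wl` comes from the linear representation on the boundary algebra. Both factorizations
translate the frame, hence are intertwined by unitaries `cl` and `cr` on the two sides, and
`u cl* cr*` is symmetric. -/
theorem exists_symmetric_cut (hβ : S.IsOnSite β) (Fr : TranslationFrame β)
    {x : ℤ} {R : ℕ} (hR : 1 ≤ R) (hr : S.HasRange α R) (h0 : HasIndexClass β α 0)
    {u : unitary S.Alg} (hu : (u : S.Alg) ∈ S.obs (Set.Ico (x - R) (x + R)))
    (huf : ∀ j h, (u : S.Alg) * Fr.f j h = Fr.f j h * u)
    (hux : S.Preserves ((conjAut u)⁻¹ * α) (Set.Iio x)) :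
    ∃ v : unitary S.Alg, (v : S.Alg) ∈ S.obs (Set.Ico (x - R) (x + R)) ∧ (v : S.Alg) ∈ fixedAlg β ∧
      S.Preserves ((conjAut v)⁻¹ * α) (Set.Iio x) := by
  have hR' : (1 : ℤ) ≤ R := by exact_mod_cast hR
  have hd : Disjoint (Set.Ico (x - R : ℤ) x) (Set.Ico x (x + R)) :=
    Set.disjoint_left.2 fun i h1 h2 => not_lt.2 h2.1 h1.2
  have hsubl : Set.Ico (x - R : ℤ) x ⊆ Set.Ico (x - R : ℤ) (x + R) :=
    Set.Ico_subset_Ico_right (by linarith)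
  have hsubr : Set.Ico x (x + R : ℤ) ⊆ Set.Ico (x - R : ℤ) (x + R) :=
    Set.Ico_subset_Ico_left (by linarith)
  obtain ⟨V, hV⟩ := hβ.exists_rep_of_finite (Set.finite_Ico (x - R : ℤ) (x + R))
  obtain ⟨Ul, hUl⟩ := hβ.exists_rep_of_finite (Set.finite_Ico (x - R : ℤ) x)
  obtain ⟨Ur, hUr, hUlr, hUrf⟩ := exists_right_factor V Ul (fun g => (hV g).1) (fun g => (hUl g).1)
    fun g a ha => by rw [← (hV g).2 a (S.obs_mono hsubl ha), ← (hUl g).2 a ha]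
  obtain ⟨W, hW⟩ := (h0 x R hr).exists_hom
  rw [boundary_eq_map (S.obs_mono Set.Ico_subset_Ici_self hu) hux] at hW
  -- transport the representations back along `u`
  let θ : S.Aut := (conjAut u)⁻¹
  have hθ : S.Preserves θ (Set.Ico (x - R) (x + R)) := (preserves_conj hu).inv
  have hθf : ∀ j h, conjAut u (Fr.f j h) = Fr.f j h := fun j h => conj_eq_of_commute (huf j h)
  have hθf' : ∀ j h, θ (Fr.f j h) = Fr.f j h := fun j h => by
    conv_lhs => rw [← hθf j h]
    exact S.aut_inv_apply _ _
  let wl : G →* unitary S.Alg := MonoidHom.mk' (fun g => mapU θ (W g)) fun g h =>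
    Subtype.ext (by
      change θ (W (g * h) : S.Alg) = θ (W g) * θ (W h)
      rw [← map_mul, map_mul W]; rfl)
  let V' : G →* unitary S.Alg := MonoidHom.mk' (fun g => mapU θ (V g)) fun g h =>
    Subtype.ext (by
      change θ (V (g * h) : S.Alg) = θ (V g) * θ (V h)
      rw [← map_mul, map_mul V]; rfl)
  have hV' : ∀ g, ∀ a ∈ S.obs (Set.Ico (x - R) (x + R)),
      (V' g : S.Alg) * a * star (V' g : S.Alg) = θ (β g (conjAut u a)) := fun g a ha => by
    rw [(hV g).2 _ ((preserves_conj hu a).1 ha), map_mul, map_mul, map_star]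
    change _ = θ (V g) * ((conjAut u)⁻¹ (conjAut u a)) * star (θ (V g))
    rw [aut_inv_apply]
    rfl
  have hwl : ∀ g, (wl g : S.Alg) ∈ S.obs (Set.Ico (x - R) x) := fun g =>
    (mem_map_aut (conjAut u)).1 (hW g).1
  have hwl' : ∀ g, ∀ a ∈ S.obs (Set.Ico (x - R) x),
      (wl g : S.Alg) * a * star (wl g : S.Alg) = θ (β g (conjAut u a)) := fun g a ha => by
    have h1 : β g (conjAut u a) = W g * conjAut u a * star (W g : S.Alg) :=
      (hW g).2 _ ⟨a, ha, rfl⟩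
    rw [h1, map_mul, map_mul, map_star]
    change _ = θ (W g) * ((conjAut u)⁻¹ (conjAut u a)) * star (θ (W g))
    rw [aut_inv_apply]
    rfl
  obtain ⟨wr, hwr, hwlr, hwrf⟩ := exists_right_factor V' wl (fun g => (hθ _).1 (hV g).1) hwl
    fun g a ha => by rw [hV' g a (S.obs_mono hsubl ha), hwl' g a ha]
  have hfl : ∀ h, Fr.f (x - 1) h ∈ S.obs (Set.Ico (x - R) x) := fun h =>
    S.obs_site_le (by constructor <;> linarith) (Fr.mem _ h)
  have hfr : ∀ h, Fr.f x h ∈ S.obs (Set.Ico x (x + R)) := fun h =>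
    S.obs_site_le (by constructor <;> linarith) (Fr.mem _ h)
  obtain ⟨cl, hcl, hcl'⟩ := exists_intertwiner Ul wl (Fr.f (x - 1)) (fun g => (hUl g).1) hwl hfl
    (Fr.star_eq _) (Fr.mul_eq _) (Fr.sum_eq _)
    (fun g h => by rw [← (hUl g).2 _ (hfl h), Fr.apply_eq])
    (fun g h => by rw [hwl' g _ (hfl h), hθf, Fr.apply_eq, hθf'])
  obtain ⟨cr, hcr, hcr'⟩ := exists_intertwiner Ur wr (Fr.f x) hUr hwr hfr
    (Fr.star_eq _) (Fr.mul_eq _) (Fr.sum_eq _)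
    (fun g h => hUrf g _ (hfr h) _ (hfr _) (by
      rw [← (hV g).2 _ (S.obs_mono hsubr (hfr h)), Fr.apply_eq]))
    (fun g h => hwrf g _ (hfr h) _ (hfr _) (by
      rw [hV' g _ (S.obs_mono hsubr (hfr h)), hθf, Fr.apply_eq, hθf']))
  have hv : ((u * (star cl * star cr) : unitary S.Alg) : S.Alg) ∈
      S.obs (Set.Ico (x - R) (x + R)) :=
    mul_mem hu (mul_mem (star_mem (S.obs_mono hsubl hcl)) (star_mem (S.obs_mono hsubr hcr)))
  refine ⟨u * (star cl * star cr), hv, fun g => ?_, ?_⟩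
  · rw [(hV g).2 _ hv]
    have e1 : (V g : S.Alg) * u = u * (wl g * wr g) := by
      rw [hwlr]
      change _ = (u : S.Alg) * (star (u : S.Alg) * V g * u)
      simp only [mul_assoc, mul_star_self_cancel]
    have el : (wl g : S.Alg) * star (cl : S.Alg) = star (cl : S.Alg) * Ul g := by
      have := congrArg (fun y => star (cl : S.Alg) * y * star (cl : S.Alg)) (hcl' g)
      simp only [mul_assoc, star_mul_self_cancel, mul_star_val, mul_one] at this
      exact this
    have er : (wr g : S.Alg) * star (cr : S.Alg) = star (cr : S.Alg) * Ur g := by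
      have := congrArg (fun y => star (cr : S.Alg) * y * star (cr : S.Alg)) (hcr' g)
      simp only [mul_assoc, star_mul_self_cancel, mul_star_val, mul_one] at this
      exact this
    have c1 := S.obs_commute hd (star_mem hcl) (hwr g)
    have c2 := S.obs_commute hd (hUl g).1 (star_mem hcr)
    have e2 : (V g : S.Alg) * (u * (star (cl : S.Alg) * star (cr : S.Alg))) =
        u * (star (cl : S.Alg) * star (cr : S.Alg)) * V g := by
      calc _ = (V g * u : S.Alg) * (star (cl : S.Alg) * star (cr : S.Alg)) := by
            simp only [mul_assoc]
        _ = u * (wl g * (wr g * star (cl : S.Alg)) * star (cr : S.Alg)) := by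
          rw [e1]; simp only [mul_assoc]
        _ = u * ((wl g * star (cl : S.Alg)) * (wr g * star (cr : S.Alg))) := by
          rw [← c1]; simp only [mul_assoc]
        _ = u * (star (cl : S.Alg) * (Ul g * star (cr : S.Alg)) * Ur g) := by
          rw [el, er]; simp only [mul_assoc]
        _ = u * (star (cl : S.Alg) * star (cr : S.Alg)) * (Ul g * Ur g) := by
          rw [c2]; simp only [mul_assoc]
        _ = _ := by rw [hUlr]
    change (V g : S.Alg) * (u * (star (cl : S.Alg) * star (cr : S.Alg))) * star (V g : S.Alg) =
      u * (star (cl : S.Alg) * star (cr : S.Alg))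
    rw [e2, mul_star_self_cancel_right]
  · have h1 : (conjAut (u * (star cl * star cr)))⁻¹ * α =
        conjAut cr * conjAut cl * ((conjAut u)⁻¹ * α) := by
      have h2 : (conjAut (u * (star cl * star cr)) : S.Aut) =
          conjAut u * ((conjAut cl)⁻¹ * (conjAut cr)⁻¹) := by
        have := map_mul (Unitary.conjStarAlgAut ℂ S.Alg) u (star cl * star cr)
        refine this.trans (congrArg _ ?_)
        refine (map_mul (Unitary.conjStarAlgAut ℂ S.Alg) (star cl) (star cr)).trans ?_
        exact congrArg₂ (· * ·) (map_inv (Unitary.conjStarAlgAut ℂ S.Alg) cl)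
          (map_inv (Unitary.conjStarAlgAut ℂ S.Alg) cr)
      rw [h2]
      group
    rw [h1]
    refine Preserves.mul (Preserves.mul ?_ ?_) hux
    · have : S.Preserves (conjAut cr) (Set.Ici x) :=
        preserves_conj (S.obs_mono Set.Ico_subset_Ici_self hcr)
      simpa using this.compl
    · exact preserves_conj (S.obs_mono Set.Ico_subset_Iio_self hcl)

end SpinChain

/-! ### Circuits with vanishing index have symmetric gates -/

/-- A two-sided sequence with prescribed quotients of consecutive terms. -/
theorem exists_int_primitive {H : Type*} [CommGroup H] (d : ℤ → H) :
    ∃ ξ : ℤ → H, ∀ k, ξ (k + 1) = ξ k * d k := by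
  refine ⟨fun k => (∏ i ∈ Finset.range k.toNat, d i) *
    ∏ i ∈ Finset.range (-k).toNat, (d (-1 - i))⁻¹, fun k => ?_⟩
  rcases le_or_gt 0 k with hk | hk
  · obtain ⟨n, rfl⟩ := Int.eq_ofNat_of_zero_le hk
    have h1 : ((n : ℤ) + 1).toNat = n + 1 := by omega
    have h2 : (-((n : ℤ) + 1)).toNat = 0 := by omega
    have h3 : (-(n : ℤ)).toNat = 0 := by omega
    simp only [h1, h2, h3, Int.toNat_natCast, Finset.prod_range_succ, Finset.range_zero,
      Finset.prod_empty, mul_one]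
  · obtain ⟨n, rfl⟩ : ∃ n : ℕ, k = -((n : ℤ) + 1) := ⟨(-k - 1).toNat, by omega⟩
    have h1 : (-((n : ℤ) + 1)).toNat = 0 := by omega
    have h2 : (-((n : ℤ) + 1) + 1).toNat = 0 := by omega
    have h3 : (- -((n : ℤ) + 1)).toNat = n + 1 := by omega
    have h4 : (-(-((n : ℤ) + 1) + 1)).toNat = n := by omega
    have h5 : -1 - (n : ℤ) = -((n : ℤ) + 1) := by ring
    simp only [h1, h2, h3, h4, Finset.prod_range_succ, Finset.range_zero, Finset.prod_empty,
      one_mul, h5, inv_mul_cancel_right]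

namespace SpinChain

variable {S : SpinChain} {G : Type} [Group G]

/-- The layer of gates on the intervals of length `N` starting at `N k + c`. -/
def blockLayer (S : SpinChain) {N : ℤ} (hN : 0 < N) (c : ℤ) (u : ℤ → unitary S.Alg)
    (hu : ∀ k, (u k : S.Alg) ∈ S.obs (Set.Icc (N * k + c) (N * k + c + N - 1))) : S.Layer where
  m k := N * k + c
  n k := N * k + c + N - 1
  le k := by linarith
  bounded := ⟨N - 1, fun k => by linarith⟩
  partition j := by
    have h1 := Int.emod_add_mul_ediv (j - c) N
    have h2 := Int.emod_nonneg (j - c) hN.ne'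
    have h3 := Int.emod_lt_of_pos (j - c) hN
    refine ⟨(j - c) / N, ⟨by linarith, by linarith⟩, fun k hk => ?_⟩
    refine (Int.ediv_eq_iff_of_pos hN).2 ⟨?_, ?_⟩ |>.symm
    · linarith [hk.1]
    · linarith [hk.2]
  gate := u
  gate_mem := hu

theorem blockLayer_apply {N : ℤ} {hN : 0 < N} {c : ℤ} {u : ℤ → unitary S.Alg}
    {hu : ∀ k, (u k : S.Alg) ∈ S.obs (Set.Icc (N * k + c) (N * k + c + N - 1))} {γ : S.Aut}
    (h : (S.blockLayer hN c u hu).Implements γ) (k : ℤ) {j : ℤ} {y : S.Alg} (hy : y ∈ S.obs {j})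
    (h1 : N * k + c ≤ j) (h2 : j ≤ N * k + c + N - 1) : γ y = u k * y * star (u k : S.Alg) :=
  h k y (S.obs_site_le (Set.mem_Icc.2 ⟨h1, h2⟩) hy)

/-- An automorphism which commutes with the symmetry and is inner on a finite set of sites is
implemented there by a unitary on which the symmetry acts by a character. -/
theorem exists_character {β : G →* S.Aut} (hβ : S.IsOnSite β) {X : Set ℤ} (hX : X.Finite)
    {α : S.Aut} (hα : ∀ g, α * β g = β g * α) {u : unitary S.Alg} (hu : (u : S.Alg) ∈ S.obs X)
    (h : ∀ a ∈ S.obs X, α a = u * a * star (u : S.Alg)) :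
    ∃ χ : G →* Circle, ∀ g, β g u = (χ g : ℂ) • (u : S.Alg) := by
  have key : ∀ g, ∃ c : Circle, β g u = (c : ℂ) • (u : S.Alg) := by
    intro g
    have hz : star (u : S.Alg) * β g u ∈ S.obs X :=
      mul_mem (star_mem (s := S.obs X) hu) (hβ.apply_mem g hu)
    have hzc : ∀ b ∈ S.obs X, (star (u : S.Alg) * β g u) * b = b * (star (u : S.Alg) * β g u) := by
      intro b hb
      have hb' : β g⁻¹ b ∈ S.obs X := hβ.apply_mem _ hb
      have e0 : β g (β g⁻¹ b) = b := by
        rw [map_inv]; exact aut_apply_inv _ _ _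
      have e1 := DFunLike.congr_fun (hα g) (β g⁻¹ b)
      change α (β g (β g⁻¹ b)) = β g (α (β g⁻¹ b)) at e1
      rw [e0, h b hb, h _ hb', map_mul, map_mul, map_star, e0] at e1
      have e2 : star (β g u) * β g (u : S.Alg) = 1 := by
        rw [← map_star, ← map_mul, star_mul_val]; exact map_one (β g)
      have e3 := congrArg (fun y => star (u : S.Alg) * y * β g u) e1
      simp only [mul_assoc, star_mul_self_cancel, e2, mul_one] at e3
      rw [mul_assoc, ← e3]
    obtain ⟨c, hc⟩ := (S.isMatrix_obs hX).hasTrivialCenter _ hz hzc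
    have hu' : star (u : S.Alg) * β g u ∈ unitary S.Alg :=
      mul_mem (star u).2 (Unitary.map_mem (β g) u.2)
    obtain ⟨φ, hφ⟩ := exists_circle_of_smul_one hu' hc
    refine ⟨φ, ?_⟩
    have := congrArg (fun y => (u : S.Alg) * y) hφ
    simpa only [mul_star_self_cancel, mul_smul_comm, mul_one] using this
  choose c hc using key
  refine ⟨MonoidHom.mk' c fun g k => ?_, hc⟩
  have h1 : β (g * k) u = β g (β k u) := by rw [map_mul]; rfl
  rw [hc, hc, map_smul, hc, smul_smul] at h1
  apply Circle.ext
  rw [unitary_smul_inj u h1, Circle.coe_mul, mul_comm]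

theorem mem_obs_Icc {j m n : ℤ} {a : S.Alg} (ha : a ∈ S.obs {j}) (h : m ≤ j) (h' : j ≤ n) :
    a ∈ S.obs (Set.Icc m n) := S.obs_site_le (Set.mem_Icc.2 ⟨h, h'⟩) ha

theorem obs_site_of_ne {i j : ℤ} (h : j ≠ i) {a : S.Alg} (ha : a ∈ S.obs {j}) :
    a ∈ S.obs {i}ᶜ := S.obs_site_le h ha

theorem conj_mul_of_right {u v : unitary S.Alg} {i : ℤ} {y : S.Alg} (hv : (v : S.Alg) ∈ S.obs {i})
    (hu : (u : S.Alg) ∈ S.obs {i}ᶜ) (hy : y ∈ S.obs {i}ᶜ) :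
    star (u * v : S.Alg) * y * (u * v) = star (u : S.Alg) * y * u := by
  have h := S.obs_commute disjoint_compl_right hv (mul_mem (mul_mem (star_mem hu) hy) hu)
  calc _ = star (v : S.Alg) * (star (u : S.Alg) * y * u * v) := by
        rw [star_mul]; simp only [mul_assoc]
    _ = _ := by rw [← h, star_mul_self_cancel]

theorem conj_mul_of_left {u v : unitary S.Alg} {i : ℤ} {y : S.Alg} (hu : (u : S.Alg) ∈ S.obs {i})
    (hy : y ∈ S.obs {i}ᶜ) :
    star (u * v : S.Alg) * y * (u * v) = star (v : S.Alg) * y * v := by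
  have h := S.obs_commute disjoint_compl_right hu hy
  calc _ = star (v : S.Alg) * (star (u : S.Alg) * (y * u)) * v := by
        rw [star_mul]; simp only [mul_assoc]
    _ = _ := by rw [← h, star_mul_self_cancel]

/-- Mutually orthogonal projections with sum one. -/
structure IsPartition {I A : Type*} [Fintype I] [DecidableEq I] [CStarAlgebra A] (p : I → A) :
    Prop where
  star_eq : ∀ i, star (p i) = p i
  mul_eq : ∀ i k, p i * p k = if i = k then p i else 0
  sum_eq : ∑ i, p i = 1

/-- The unitaries `∑ᵢ φ(i) p(i)`, for functions `φ` with values of modulus one. -/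
def IsPartition.diag {I A : Type*} [Fintype I] [DecidableEq I] [CStarAlgebra A] {p : I → A}
    (hp : IsPartition p) : (I → Circle) →* unitary A where
  toFun φ := ⟨∑ i, (φ i : ℂ) • p i, by
    have hs : star (∑ i, (φ i : ℂ) • p i) = ∑ i, star (φ i : ℂ) • p i := by
      rw [star_sum]
      exact Finset.sum_congr rfl fun i _ => by rw [star_smul, hp.star_eq]
    rw [Unitary.mem_iff, hs, Finset.sum_mul_sum, Finset.sum_mul_sum]
    simp only [smul_mul_smul_comm, hp.mul_eq, smul_ite, smul_zero, Finset.sum_ite_eq,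
      Finset.mem_univ, if_true, mul_comm _ (star (_ : ℂ)), circle_star_mul, one_smul, hp.sum_eq,
      and_self]⟩
  map_one' := Subtype.ext (by simp [hp.sum_eq])
  map_mul' φ ψ := Subtype.ext (by
    change (∑ i, ((φ i * ψ i : Circle) : ℂ) • p i) = (∑ i, (φ i : ℂ) • p i) * ∑ i, (ψ i : ℂ) • p i
    rw [Finset.sum_mul_sum]
    simp only [smul_mul_smul_comm, hp.mul_eq, smul_ite, smul_zero, Finset.sum_ite_eq,
      Finset.mem_univ, if_true, Circle.coe_mul])

theorem IsPartition.coe_diag {I A : Type*} [Fintype I] [DecidableEq I] [CStarAlgebra A] {p : I → A}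
    (hp : IsPartition p) (φ : I → Circle) : (hp.diag φ : A) = ∑ i, (φ i : ℂ) • p i := rfl

section Frame

variable [Fintype G] [DecidableEq G] {β : G →* S.Aut}

namespace TranslationFrame

variable (Fr : TranslationFrame β)

/-- The observables commuting with all projections of the frame. -/
def commutant : StarSubalgebra ℂ S.Alg where
  carrier := {a | ∀ j h, a * Fr.f j h = Fr.f j h * a}
  mul_mem' ha hb j h := by rw [mul_assoc, hb, ← mul_assoc, ha, mul_assoc]
  add_mem' ha hb j h := by rw [add_mul, mul_add, ha, hb]
  algebraMap_mem' r j h := Algebra.commutes _ _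
  star_mem' ha j h := by
    have := congrArg star (ha j h)
    rw [star_mul, star_mul, Fr.star_eq] at this
    exact this.symm

theorem apply_mem_commutant (L : S.Layer) (δ : S.Aut) (h : L.Implements δ)
    (hL : ∀ a, (L.gate a : S.Alg) ∈ Fr.commutant) (b : S.Alg) (hb : b ∈ Fr.commutant) :
    δ b ∈ Fr.commutant := fun j k => by
  have h1 : δ (Fr.f j k) = Fr.f j k := by
    rw [h.site (Fr.mem j k), hL _ j k, mul_star_self_cancel_right]
  rw [← h1, ← map_mul, ← map_mul, hb j k]

theorem isPartition (j : ℤ) : IsPartition (Fr.f j) := ⟨Fr.star_eq j, Fr.mul_eq j, Fr.sum_eq j⟩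

/-- The operators on the site `j` of multiplication by functions on `G` of modulus one. -/
def diag (j : ℤ) : (G → Circle) →* unitary S.Alg := (Fr.isPartition j).diag

theorem diag_mem (j : ℤ) (φ : G → Circle) : (Fr.diag j φ : S.Alg) ∈ S.obs {j} :=
  sum_mem fun h _ => SMulMemClass.smul_mem _ (Fr.mem j h)

theorem apply_diag (g : G) (j : ℤ) (φ : G → Circle) :
    β g (Fr.diag j φ) = Fr.diag j fun a => φ (g⁻¹ * a) := by
  change β g (∑ h, (φ h : ℂ) • Fr.f j h) = ∑ h, (φ (g⁻¹ * h) : ℂ) • Fr.f j h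
  rw [map_sum, ← Equiv.sum_comp (Equiv.mulLeft g) fun h => (φ (g⁻¹ * h) : ℂ) • Fr.f j h]
  exact Finset.sum_congr rfl fun h _ => by
    rw [map_smul, Fr.apply_eq, Equiv.coe_mulLeft, inv_mul_cancel_left]

/-- Characters give unitaries on which the symmetry acts by the inverse character. -/
theorem exists_charged (Fr : TranslationFrame β) (j : ℤ) (ξ : G →* Circle) : ∃ t : unitary S.Alg, (t : S.Alg) ∈ S.obs {j} ∧
    ∀ g, β g t = ((ξ g)⁻¹ : Circle) • (t : S.Alg) := by
  refine ⟨Fr.diag j ξ, Fr.diag_mem j ξ, fun g => ?_⟩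
  rw [apply_diag, diag, IsPartition.coe_diag, IsPartition.coe_diag, Finset.smul_sum]
  refine Finset.sum_congr rfl fun h _ => ?_
  rw [Circle.smul_def, smul_smul, map_mul, map_inv, Circle.coe_mul]

end TranslationFrame

theorem smul_smul_mul_of_circle {A : Type*} [CStarAlgebra A] (c d : Circle) (x y : A) :
    (c • x) * (d • y) = (c * d) • (x * y) := by
  simp only [Circle.smul_def, smul_mul_smul_comm, Circle.coe_mul]

/-- If all gates commute with a translation frame and the index vanishes, then the circuit can be
rewritten with symmetric gates. -/
theorem isSymmetricFDQC_of_index_zero (hβ : S.IsOnSite β) (Fr : TranslationFrame β) {α : S.Aut}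
    (hα : ∀ g, α * β g = β g * α) (hc : S.IsCircuitIn Fr.commutant α)
    (h0 : HasIndexClass β α 0) : S.IsSymmetricFDQC β α := by
  obtain ⟨r, hr⟩ := hc.exists_hasRange
  obtain ⟨R₁, hcut⟩ := hc.exists_cut Fr.apply_mem_commutant
  obtain ⟨R, hRdef⟩ : ∃ R : ℕ, R = r + R₁ + 1 := ⟨_, rfl⟩
  have hR : 1 ≤ R := by omega
  have hR' : (1 : ℤ) ≤ R := by exact_mod_cast hR
  have hN : (0 : ℤ) < 2 * R := by linarith
  have hsc : ∀ x : ℤ, ∃ v : unitary S.Alg, (v : S.Alg) ∈ S.obs (Set.Ico (x - R) (x + R)) ∧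
      (v : S.Alg) ∈ fixedAlg β ∧ S.Preserves ((conjAut v)⁻¹ * α) (Set.Iio x) := by
    intro x
    obtain ⟨u, huB, hux, hu⟩ := hcut x
    refine exists_symmetric_cut hβ Fr hR (hr.mono (by omega)) h0 (S.obs_mono ?_ hux) huB hu
    have : (R₁ : ℤ) ≤ R := by exact_mod_cast (by omega : R₁ ≤ R)
    exact Set.Ico_subset_Ico (by linarith) (by linarith)
  choose v hv hvβ hvα using hsc
  have hsub : ∀ k : ℤ, Set.Ico (2 * (R : ℤ) * k - R) (2 * R * k + R) ⊆
      Set.Icc (2 * R * k + -R) (2 * R * k + -R + 2 * R - 1) := fun k i hi =>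
    ⟨by linarith [hi.1], by linarith [hi.2]⟩
  -- remove the symmetric cuts at the points `2 R k`
  obtain ⟨L₁, hL₁⟩ : ∃ L : S.Layer, L = S.blockLayer hN (-R) (fun k => v (2 * R * k)) (fun k =>
      S.obs_mono (hsub k) (hv (2 * R * k))) :=
    ⟨_, rfl⟩
  obtain ⟨l₁, hl₁⟩ := L₁.exists_implements
  have hL₁β : ∀ a, (L₁.gate a : S.Alg) ∈ fixedAlg β := fun a => by rw [hL₁]; exact hvβ _
  obtain ⟨α₁, hα₁⟩ : ∃ α₁ : S.Aut, α₁ = l₁⁻¹ * α := ⟨_, rfl⟩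
  have hpre : ∀ k : ℤ, S.Preserves α₁ (Set.Iio (2 * R * k)) := by
    intro k
    obtain ⟨q, hq⟩ := L₁.bounded
    obtain ⟨u, -, -, hu, hu1, -⟩ := hl₁.exists_cut (x := 2 * R * k) hq hL₁β
    have hu2 : u = v (2 * R * k) := by
      rw [hu1 k (by rw [hL₁]; constructor <;> simp only [blockLayer] <;> linarith)
        (by rw [hL₁]; constructor <;> simp only [blockLayer] <;> linarith), hL₁]
      rfl
    have h1 : α₁ = ((conjAut u)⁻¹ * l₁)⁻¹ * ((conjAut u)⁻¹ * α) := by rw [hα₁]; group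
    rw [h1]
    refine hu.inv.mul ?_
    rw [hu2]
    exact hvα _
  have hpreJ : ∀ k : ℤ, S.Preserves α₁ (Set.Icc (2 * R * k + 0) (2 * R * k + 0 + 2 * R - 1)) := by
    intro k
    have h1 := (hpre (k + 1)).inter (hpre k).compl
    have h2 : Set.Iio (2 * (R : ℤ) * (k + 1)) ∩ (Set.Iio (2 * (R : ℤ) * k))ᶜ =
        Set.Icc (2 * R * k + 0) (2 * R * k + 0 + 2 * R - 1) := by
      ext i
      simp only [Set.mem_inter_iff, Set.mem_Iio, Set.mem_compl_iff, not_lt, Set.mem_Icc, mul_add]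
      constructor
      · rintro ⟨h, h'⟩; constructor <;> linarith
      · rintro ⟨h, h'⟩; constructor <;> linarith
    rwa [h2] at h1
  have hα₁β : ∀ g, α₁ * β g = β g * α₁ := by
    intro g
    have h1 := hl₁.comm_symmetry hβ hL₁β g
    have h2 : l₁⁻¹ * β g = β g * l₁⁻¹ := by
      rw [inv_mul_eq_iff_eq_mul, ← mul_assoc, h1, mul_inv_cancel_right]
    rw [hα₁, mul_assoc, hα, ← mul_assoc, h2, mul_assoc]
  have hexu : ∀ k : ℤ, ∃ u : unitary S.Alg,
      (u : S.Alg) ∈ S.obs (Set.Icc (2 * R * k + 0) (2 * R * k + 0 + 2 * R - 1)) ∧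
      ∀ b ∈ S.obs (Set.Icc (2 * R * k + 0) (2 * R * k + 0 + 2 * R - 1)),
        α₁ b = u * b * star (u : S.Alg) := fun k =>
    (S.isMatrix_obs (Set.finite_Icc _ _)).exists_unitary (α₁ : S.Alg →⋆ₐ[ℂ] S.Alg)
      fun b hb => (hpreJ k b).1 hb
  choose u hu huα using hexu
  have hexχ := fun k => exists_character hβ (Set.finite_Icc _ _) hα₁β (hu k) (huα k)
  choose χ hχ using hexχ
  -- charges are moved between neighbouring intervals to make the gates neutral
  obtain ⟨ξ, hξ⟩ := exists_int_primitive fun k => (χ k)⁻¹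
  choose a ha haβ using fun k : ℤ => Fr.exists_charged (2 * R * k) (ξ k)
  choose b hb hbβ using fun k : ℤ => Fr.exists_charged (2 * R * k - 1) (ξ k)⁻¹
  obtain ⟨L₂, hL₂⟩ : ∃ L : S.Layer, L = S.blockLayer hN 0 (fun k => u k * (a k * b (k + 1)))
      (fun k => mul_mem (hu k) (mul_mem (mem_obs_Icc (ha k) (by linarith) (by linarith))
        (mem_obs_Icc (hb (k + 1)) (by linarith) (by linarith)))) := ⟨_, rfl⟩
  obtain ⟨L₃, hL₃⟩ : ∃ L : S.Layer, L = S.blockLayer hN (-R) (fun k => star (a k * b k))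
      (fun k => star_mem (mul_mem (mem_obs_Icc (ha k) (by linarith) (by linarith))
        (mem_obs_Icc (hb k) (by linarith) (by linarith)))) := ⟨_, rfl⟩
  obtain ⟨l₂, hl₂⟩ := L₂.exists_implements
  obtain ⟨l₃, hl₃⟩ := L₃.exists_implements
  have hL₂β : ∀ k, (L₂.gate k : S.Alg) ∈ fixedAlg β := by
    intro k g
    rw [hL₂]
    change β g (u k * (a k * b (k + 1)) : S.Alg) = u k * (a k * b (k + 1))
    rw [map_mul, map_mul, hχ, haβ, hbβ, ← Circle.smul_def, smul_smul_mul_of_circle,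
      smul_smul_mul_of_circle, hξ]
    simp
  have hL₃β : ∀ k, (L₃.gate k : S.Alg) ∈ fixedAlg β := by
    intro k
    rw [hL₃]
    refine star_mem (S := StarSubalgebra ℂ S.Alg) (s := fixedAlg β)
      (show (a k * b k : S.Alg) ∈ _ from fun g => ?_)
    rw [map_mul, haβ, hbβ, smul_smul_mul_of_circle]
    simp
  have h23 : α₁ = l₂ * l₃ := by
    refine S.aut_eq_of_site fun j y hy => ?_
    obtain ⟨k, hk⟩ : ∃ k, j ∈ Set.Icc (2 * (R : ℤ) * k + 0) (2 * R * k + 0 + 2 * R - 1) := by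
      obtain ⟨k, hk, -⟩ := L₂.partition j
      rw [hL₂] at hk
      exact ⟨k, hk⟩
    have hy' := S.obs_site_le hk hy
    have h3 : l₃ y = star (a k * b (k + 1) : S.Alg) * y * (a k * b (k + 1)) := by
      rcases lt_or_ge j (2 * R * k + R) with hj | hj
      · rw [hL₃] at hl₃
        refine (blockLayer_apply hl₃ k hy (by linarith [hk.1]) (by linarith)).trans ?_
        change star (a k * b k : S.Alg) * y * star (star (a k * b k : S.Alg)) = _
        rw [star_star, conj_mul_of_right (i := 2 * R * k - 1) (hb k)
            (obs_site_of_ne (by linarith) (ha k)) (obs_site_of_ne (by linarith [hk.1]) hy),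
          conj_mul_of_right (i := 2 * R * (k + 1) - 1) (hb (k + 1))
            (obs_site_of_ne (by linarith) (ha k)) (obs_site_of_ne (by linarith) hy)]
      · rw [hL₃] at hl₃
        refine (blockLayer_apply hl₃ (k + 1) hy (by linarith [hk.1]) (by linarith [hk.2])).trans ?_
        change star (a (k + 1) * b (k + 1) : S.Alg) * y *
          star (star (a (k + 1) * b (k + 1) : S.Alg)) = _
        rw [star_star, conj_mul_of_left (i := 2 * R * (k + 1)) (ha (k + 1))
            (obs_site_of_ne (by linarith [hk.2]) hy),
          conj_mul_of_left (i := 2 * R * k) (ha k) (obs_site_of_ne (by linarith) hy)]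
    have h4 := hl₂ k
    rw [hL₂] at h4
    have hab : (a k * b (k + 1) : S.Alg) ∈
        S.obs (Set.Icc (2 * (R : ℤ) * k + 0) (2 * R * k + 0 + 2 * R - 1)) :=
      mul_mem (mem_obs_Icc (ha k) (by linarith) (by linarith))
        (mem_obs_Icc (hb (k + 1)) (by linarith) (by linarith))
    change α₁ y = l₂ (l₃ y)
    rw [h3, huα k y hy']
    refine Eq.symm ((h4 _ (mul_mem (mul_mem (star_mem hab) hy') hab)).trans ?_)
    change (u k * (a k * b (k + 1)) : S.Alg) * _ * star (u k * (a k * b (k + 1)) : S.Alg) = _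
    have e1 := fun y => mul_star_self_cancel (a k * b (k + 1)) y
    have e2 := mul_star_val (a k * b (k + 1))
    change ∀ y, (a k * b (k + 1) : S.Alg) * (star (a k * b (k + 1) : S.Alg) * y) = y at e1
    rw [star_mul (u k : S.Alg)]
    calc _ = (u k : S.Alg) * ((a k * b (k + 1) : S.Alg) * (star (a k * b (k + 1) : S.Alg) *
          (y * ((a k * b (k + 1) : S.Alg) * (star (a k * b (k + 1) : S.Alg) *
            star (u k : S.Alg)))))) := by noncomm_ring
      _ = _ := by rw [e1, e1, mul_assoc]
  have h123 : α = l₁ * (l₂ * l₃) := by rw [← h23, hα₁, mul_inv_cancel_left]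
  rw [h123]
  exact isCircuitIn_fixedAlg_iff.1 ((IsCircuitIn.of_layer hl₁ hL₁β).mul
    ((IsCircuitIn.of_layer hl₂ hL₂β).mul (IsCircuitIn.of_layer hl₃ hL₃β)))

end Frame

end SpinChain

/-! ### The regular chain -/

namespace SpinChain

variable {G : Type} [Group G]

/-- Unitary representations on the sites define an on-site symmetry. -/
theorem exists_symmetry {S : SpinChain} (U : ℤ → G →* unitary S.Alg)
    (hU : ∀ j g, (U j g : S.Alg) ∈ S.obs {j}) :
    ∃ β : G →* S.Aut, ∀ j g, ∀ x ∈ S.obs {j}, β g x = U j g * x * star (U j g : S.Alg) := by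
  have key : ∀ g, ∃ γ : S.Aut, ∀ j, ∀ x ∈ S.obs {j}, γ x = U j g * x * star (U j g : S.Alg) := by
    intro g
    obtain ⟨L, hL⟩ : ∃ L : S.Layer, L = S.blockLayer one_pos 0 (fun k => U k g)
      (fun k => mem_obs_Icc (hU k g) (by linarith) (by linarith)) := ⟨_, rfl⟩
    obtain ⟨γ, hγ⟩ := L.exists_implements
    rw [hL] at hγ
    exact ⟨γ, fun j x hx => blockLayer_apply hγ j hx (by linarith) (by linarith)⟩
  choose γ hγ using key
  refine ⟨MonoidHom.mk' γ fun g h => S.aut_eq_of_site fun j x hx => ?_, fun j g x hx => hγ g j x hx⟩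
  change γ (g * h) x = γ g (γ h x)
  rw [hγ h j x hx, hγ g j _ (mul_mem (mul_mem (hU j h) hx) (star_mem (hU j h))), hγ _ j x hx,
    map_mul]
  change (U j g * U j h : S.Alg) * x * star (U j g * U j h : S.Alg) = _
  rw [star_mul]
  simp only [mul_assoc]

variable (G) in
/-- The chain with on-site Hilbert space `ℓ²(G)` at every site. -/
def regular [Finite G] : SpinChain where
  ι _ := G
  finite _ := inferInstance
  nonempty _ := ⟨1⟩
  bounded := ⟨Nat.card G, fun _ => le_rfl⟩

variable [Fintype G]

/-- The basis vector `|h⟩` at the single site `j`. -/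
def regularConfig (j : ℤ) : G ≃ (regular G).LocalConfig {j} where
  toFun h _ := h
  invFun c := c ⟨j, Finset.mem_singleton_self j⟩
  left_inv _ := rfl
  right_inv c := funext fun i => by
    obtain ⟨i, hi⟩ := i
    obtain rfl := Finset.mem_singleton.1 hi
    rfl

/-- The matrix unit `|h⟩⟨k|` at the site `j` of the regular chain. -/
def regularUnit (j : ℤ) (h k : G) : (regular G).Alg :=
  (regular G).loc {j} (Amplify.matrixUnit (regularConfig j h) (regularConfig j k))

theorem regularUnit_mem (j : ℤ) (h k : G) : regularUnit j h k ∈ (regular G).obs {j} :=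
  (regular G).loc_mem_obs (by simp) _

theorem star_regularUnit (j : ℤ) (h k : G) : star (regularUnit j h k) = regularUnit j k h := by
  rw [regularUnit, ← map_star, Amplify.star_matrixUnit]; rfl

theorem sum_regularUnit (j : ℤ) : ∑ h : G, regularUnit j h h = 1 := by
  have : Fintype ((regular G).LocalConfig {j}) := Fintype.ofEquiv _ (regularConfig j)
  have h1 := congrArg ((regular G).loc {j}) (Amplify.sum_matrixUnit (X := (regular G).LocalConfig {j}))
  rw [map_one, map_sum, ← (regularConfig j).sum_comp] at h1
  exact h1

variable [DecidableEq G]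

theorem regularUnit_mul (j : ℤ) (h k h' k' : G) :
    regularUnit j h k * regularUnit j h' k' = if k = h' then regularUnit j h k' else 0 := by
  classical
  rw [regularUnit, regularUnit, ← map_mul, Amplify.matrixUnit_mul]
  simp only [EmbeddingLike.apply_eq_iff_eq]
  split_ifs
  · rfl
  · exact map_zero _

/-- Left translation by `g` at the site `j`. -/
def translation (j : ℤ) : G →* unitary (regular G).Alg where
  toFun g := ⟨∑ h, regularUnit j (g * h) h, by
    have hs : star (∑ h, regularUnit j (g * h) h) = ∑ h, regularUnit j h (g * h) := by
      rw [star_sum]; exact Finset.sum_congr rfl fun h _ => star_regularUnit _ _ _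
    rw [Unitary.mem_iff, hs, Finset.sum_mul_sum, Finset.sum_mul_sum]
    simp only [regularUnit_mul, mul_right_inj, Finset.sum_ite_eq, Finset.mem_univ, if_true]
    exact ⟨sum_regularUnit j, (Equiv.sum_comp (Equiv.mulLeft g) fun h => regularUnit j h h).trans
      (sum_regularUnit j)⟩⟩
  map_one' := Subtype.ext (by simpa using sum_regularUnit j)
  map_mul' g k := Subtype.ext (by
    change (∑ h, regularUnit j (g * k * h) h) = (∑ h, regularUnit j (g * h) h) * ∑ h, regularUnit j (k * h) h
    rw [Finset.sum_mul_sum, Finset.sum_comm]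
    simp only [regularUnit_mul, Finset.sum_ite_eq', Finset.mem_univ, if_true, mul_assoc])

theorem translation_mem (j : ℤ) (g : G) : (translation j g : (regular G).Alg) ∈ (regular G).obs {j} :=
  sum_mem fun _ _ => regularUnit_mem _ _ _

theorem translation_conj (j : ℤ) (g h : G) :
    (translation j g : (regular G).Alg) * regularUnit j h h * star (translation j g : (regular G).Alg) =
      regularUnit j (g * h) (g * h) := by
  have h1 : (translation j g : (regular G).Alg) * regularUnit j h h = regularUnit j (g * h) h := by
    change (∑ k, regularUnit j (g * k) k) * regularUnit j h h = _
    simp only [Finset.sum_mul, regularUnit_mul, Finset.sum_ite_eq', Finset.mem_univ, if_true]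
  have h2 : star (translation j g : (regular G).Alg) = ∑ k, regularUnit j k (g * k) := by
    change star (∑ k, regularUnit j (g * k) k) = _
    rw [star_sum]; exact Finset.sum_congr rfl fun h _ => star_regularUnit _ _ _
  rw [h1, h2]
  simp only [Finset.mul_sum, regularUnit_mul, Finset.sum_ite_eq, Finset.mem_univ, if_true]

variable (G) in
/-- There is a chain with an on-site symmetry and a translation frame: `G` acting on `ℓ²(G)` by
left translation, with the projections onto the basis vectors. -/
theorem exists_translationFrame : ∃ (S : SpinChain) (β : G →* S.Aut),
    S.IsOnSite β ∧ Nonempty (TranslationFrame β) := by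
  obtain ⟨β, hβ⟩ := exists_symmetry (translation (G := G)) translation_mem
  refine ⟨regular G, β, ⟨translation, translation_mem, hβ⟩, ⟨{
    f := fun j h => regularUnit j h h
    mem := fun j h => regularUnit_mem j h h
    star_eq := fun j h => star_regularUnit j h h
    mul_eq := fun j h k => ?_
    sum_eq := sum_regularUnit
    apply_eq := fun j g h => ?_ }⟩⟩
  · rw [regularUnit_mul]
    split_ifs with hk
    · rw [hk]
    · rfl
  · rw [hβ j g _ (regularUnit_mem j h h), translation_conj]

end SpinChain

/-! ### A circuit with prescribed index -/

namespace SpinChain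

variable {S : SpinChain} {G : Type} [Group G] {β : G →* S.Aut}

section CommutingGates

theorem mul_star_comm {A : Type*} [CStarAlgebra A] {a : A} {u : unitary A}
    (h : a * (u : A) = u * a) : a * star (u : A) = star (u : A) * a := by
  have e := congrArg (fun y => star (u : A) * y * star (u : A)) h
  simp only [mul_assoc, star_mul_self_cancel, mul_star_val, mul_one] at e
  exact e.symm

theorem site_commute {i j : ℤ} {x y : S.Alg} (h : i ≠ j) (hx : x ∈ S.obs {i}) (hy : y ∈ S.obs {j}) :
    x * y = y * x :=
  S.obs_commute (Set.disjoint_singleton.2 h) hx hy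

variable {D : ℤ → unitary S.Alg} {α : S.Aut}

/-- The circuit is symmetric if the symmetry changes the gates by factors which cancel. -/
theorem comm_symmetry_of_factors (hβ : S.IsOnSite β) (hα : ∀ j, ∀ x ∈ S.obs {j},
      α x = (D (j - 1) * D j : S.Alg) * x * star (D (j - 1) * D j : S.Alg))
    {m : ℤ → G → unitary S.Alg} (hmmem : ∀ j g, (m j g : S.Alg) ∈ S.obs {j})
    (hmD : ∀ i j g, (m i g : S.Alg) * D j = D j * m i g)
    (hβD : ∀ g j, β g (D j) = D j * (m j g * star (m (j + 1) g : S.Alg))) (g : G) :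
    α * β g = β g * α := by
  refine S.aut_eq_of_site fun j x hx => ?_
  have hβx : β g x ∈ S.obs {j} := hβ.apply_mem g hx
  change α (β g x) = β g (α x)
  rw [hα j x hx, hα j _ hβx, map_mul, map_mul, map_star, map_mul, hβD, hβD, sub_add_cancel]
  obtain ⟨w, hw⟩ : ∃ w : unitary S.Alg, w = m (j - 1) g * star (m (j + 1) g) := ⟨_, rfl⟩
  have hwc : (w : S.Alg) * β g x = β g x * w := by
    rw [hw]
    change (m (j - 1) g * star (m (j + 1) g : S.Alg)) * _ = _ * (m (j - 1) g *
      star (m (j + 1) g : S.Alg))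
    have e1 := site_commute (by linarith : j + 1 ≠ j) (star_mem (hmmem (j + 1) g)) hβx
    have e2 := site_commute (by linarith : j - 1 ≠ j) (hmmem (j - 1) g) hβx
    rw [mul_assoc, e1, ← mul_assoc, e2, mul_assoc]
  have hfac : (D (j - 1) * (m (j - 1) g * star (m j g : S.Alg)) *
      (D j * (m j g * star (m (j + 1) g : S.Alg))) : S.Alg) = D (j - 1) * D j * w := by
    have e1 : (m (j - 1) g * star (m j g : S.Alg)) * D j =
        D j * (m (j - 1) g * star (m j g : S.Alg)) := by
      rw [mul_assoc, ← mul_star_comm (hmD j j g).symm, ← mul_assoc, hmD, mul_assoc]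
    rw [hw]
    calc _ = (D (j - 1) : S.Alg) * ((m (j - 1) g * star (m j g : S.Alg)) * D j) *
          (m j g * star (m (j + 1) g : S.Alg)) := by simp only [mul_assoc]
      _ = _ := by
        rw [e1]
        simp only [mul_assoc, star_mul_self_cancel]
        rfl
  rw [hfac, star_mul _ (w : S.Alg)]
  calc _ = (D (j - 1) * D j : S.Alg) * (β g x * w * star (w : S.Alg)) *
        star (D (j - 1) * D j : S.Alg) := by rw [mul_star_self_cancel_right]
    _ = _ := by rw [← hwc]; simp only [mul_assoc]

theorem hasRange_one_of_gates (hDmem : ∀ j {X : Set ℤ}, j ∈ X → j + 1 ∈ X → (D j : S.Alg) ∈ S.obs X)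
    (hα : ∀ j, ∀ x ∈ S.obs {j},
      α x = (D (j - 1) * D j : S.Alg) * x * star (D (j - 1) * D j : S.Alg)) :
    S.HasRange α 1 := HasRange.of_site fun j x hx => by
  have h1 : (D (j - 1) * D j : S.Alg) ∈ S.obs (Set.Icc (j - (1 : ℕ)) (j + (1 : ℕ))) :=
    mul_mem (hDmem _ ⟨by simp, by push_cast; linarith⟩ ⟨by push_cast; linarith, by push_cast; linarith⟩)
      (hDmem _ ⟨by push_cast; linarith, by push_cast; linarith⟩ ⟨by push_cast; linarith, by simp⟩)
  rw [hα j x hx]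
  exact mul_mem (mul_mem h1 (mem_obs_Icc hx (by push_cast; linarith) (by push_cast; linarith)))
    (star_mem h1)

/-- Only the gate `D (-1)` crosses the cut at `0`. -/
theorem preserves_of_gates (hDmem : ∀ j {X : Set ℤ}, j ∈ X → j + 1 ∈ X → (D j : S.Alg) ∈ S.obs X)
    (hDD : ∀ i j, (D i : S.Alg) * D j = D j * D i) (hα : ∀ j, ∀ x ∈ S.obs {j},
      α x = (D (j - 1) * D j : S.Alg) * x * star (D (j - 1) * D j : S.Alg)) :
    S.Preserves ((conjAut (D (-1)))⁻¹ * α) (Set.Iio 0) := by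
  have hinv : ∀ y : S.Alg, (D (-1) : S.Alg) * y = y * D (-1) → (conjAut (D (-1)))⁻¹ y = y :=
    fun y hy => by rw [conj_inv_apply, mul_assoc, ← hy, star_mul_self_cancel]
  have hfar : ∀ j, j ≠ -1 → j ≠ 0 → ∀ x ∈ S.obs {j},
      (conjAut (D (-1)))⁻¹ (α x) ∈ S.obs (Set.Icc (j - (1 : ℕ)) (j + (1 : ℕ))) := by
    intro j h1 h2 x hx
    rw [hinv]
    · exact (hasRange_one_of_gates hDmem hα).site hx
    · have e0 : Disjoint ({j}ᶜ : Set ℤ) {j} := disjoint_compl_left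
      have e1 := S.obs_commute e0 (hDmem (-1) (Ne.symm h1) (by simpa using Ne.symm h2)) hx
      have e2 : (D (-1) : S.Alg) * (D (j - 1) * D j : unitary S.Alg) =
          (D (j - 1) * D j : unitary S.Alg) * D (-1) := by
        change (D (-1) : S.Alg) * (D (j - 1) * D j) = D (j - 1) * D j * D (-1)
        rw [← mul_assoc, hDD, mul_assoc, hDD, mul_assoc]
      have e3 := mul_star_comm e2
      change (D (-1) : S.Alg) * (D (j - 1) * D j) = D (j - 1) * D j * D (-1) at e2
      change (D (-1) : S.Alg) * star (D (j - 1) * D j : S.Alg) =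
        star (D (j - 1) * D j : S.Alg) * D (-1) at e3
      rw [hα j x hx, ← mul_assoc, ← mul_assoc, e2, mul_assoc _ (D (-1) : S.Alg) x, e1, ← mul_assoc,
        mul_assoc _ (D (-1) : S.Alg), e3, ← mul_assoc]
  have hl : ∀ x ∈ S.obs {-1}, (conjAut (D (-1)))⁻¹ (α x) ∈ S.obs (Set.Iio 0) := by
    intro x hx
    have h1 : (D (-2) : S.Alg) ∈ S.obs (Set.Iio 0) := hDmem _ (by simp) (by simp)
    have h2 : (conjAut (D (-1)))⁻¹ (α x) = D (-2) * x * star (D (-2) : S.Alg) := by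
      rw [hα (-1) x hx, show (-1 : ℤ) - 1 = -2 by norm_num, hDD (-2) (-1), conj_inv_apply,
        star_mul]
      simp only [mul_assoc, star_mul_self_cancel, star_mul_val, mul_one]
    rw [h2]
    exact mul_mem (mul_mem h1 (S.obs_site_le (by simp) hx)) (star_mem h1)
  have hr : ∀ x ∈ S.obs {0}, (conjAut (D (-1)))⁻¹ (α x) ∈ S.obs (Set.Iio 0)ᶜ := by
    intro x hx
    have h1 : (D 0 : S.Alg) ∈ S.obs (Set.Iio 0)ᶜ := hDmem _ (by simp) (by simp)
    have h2 : (conjAut (D (-1)))⁻¹ (α x) = D 0 * x * star (D 0 : S.Alg) := by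
      rw [hα 0 x hx, zero_sub, conj_inv_apply, star_mul]
      simp only [mul_assoc, star_mul_self_cancel, star_mul_val, mul_one]
    rw [h2]
    exact mul_mem (mul_mem h1 (S.obs_site_le (by simp) hx)) (star_mem h1)
  refine Preserves.of_le ?_ ?_
  · refine fun a => S.aut_mem_of_site _ fun j hj x hx => ?_
    rw [Set.mem_Iio] at hj
    by_cases h1 : j = -1
    · subst h1; exact hl x hx
    · refine S.obs_mono (fun i hi => ?_) (hfar j h1 hj.ne x hx)
      have := hi.2
      push_cast at this
      rw [Set.mem_Iio]
      omega
  · refine fun a => S.aut_mem_of_site _ fun j hj x hx => ?_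
    rw [Set.mem_compl_iff, Set.mem_Iio, not_lt] at hj
    by_cases h1 : j = 0
    · subst h1; exact hr x hx
    · refine S.obs_mono (fun i hi => ?_) (hfar j (by omega) h1 x hx)
      have := hi.1
      push_cast at this
      rw [Set.mem_compl_iff, Set.mem_Iio, not_lt]
      omega

/-- If the symmetry changes the gates by the factors `m_j(g) m_{j+1}(g)*`, then the representation
`U` on the last site, twisted by `m`, implements the symmetry on the boundary algebra. -/
theorem hasClass_of_twist (hβ : S.IsOnSite β) {m : ℤ → G → unitary S.Alg}
    (hmmem : ∀ j g, (m j g : S.Alg) ∈ S.obs {j})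
    (hβD : ∀ g j, β g (D j) = D j * (m j g * star (m (j + 1) g : S.Alg)))
    {μ : G → G → Circle} {κ : H2U1 G} (hμ : IsClass μ κ)
    (hmm : ∀ j g h, (m j g * β g (m j h) : S.Alg) = (μ g h : ℂ) • (m j (g * h) : S.Alg)) :
    HasClass β ((S.obs {(-1 : ℤ)}).map (conjAut (D (-1)) : S.Alg →⋆ₐ[ℂ] S.Alg)) κ := by
  obtain ⟨U, hU⟩ := hβ.exists_rep_of_finite (Set.finite_singleton (-1 : ℤ))
  have hmβ : ∀ g a, a ∈ S.obs {(-1 : ℤ)} →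
      β g (D (-1) * a * star (D (-1) : S.Alg)) =
        D (-1) * (m (-1) g * U g * a * star (m (-1) g * U g : S.Alg)) * star (D (-1) : S.Alg) := by
    intro g a ha
    have hβa := hβ.apply_mem g ha
    have e1 := site_commute (by norm_num : (-1 : ℤ) + 1 ≠ -1) (star_mem (hmmem (-1 + 1) g)) hβa
    rw [map_mul, map_mul, map_star, hβD, star_mul, star_mul, star_star, star_mul]
    calc _ = (D (-1) : S.Alg) * (m (-1) g * (star (m (-1 + 1) g : S.Alg) * β g a) *
          (m (-1 + 1) g * star (m (-1) g : S.Alg))) * star (D (-1) : S.Alg) := by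
          simp only [mul_assoc]
      _ = (D (-1) : S.Alg) * (m (-1) g * β g a * star (m (-1) g : S.Alg)) *
            star (D (-1) : S.Alg) := by
          rw [e1]; simp only [mul_assoc, star_mul_self_cancel]
      _ = _ := by rw [(hU g).2 a ha]; simp only [mul_assoc]
  have hmU : ∀ g h, (m (-1) g * U g * (m (-1) h * U h) : S.Alg) =
      (μ g h : ℂ) • (m (-1) (g * h) * U (g * h) : S.Alg) := by
    intro g h
    have e1 : (U g : S.Alg) * m (-1) h = β g (m (-1) h) * U g := by
      rw [(hU g).2 _ (hmmem (-1) h), star_mul_self_cancel_right]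
    calc _ = (m (-1) g * (U g * m (-1) h) * U h : S.Alg) := by simp only [mul_assoc]
      _ = (m (-1) g * β g (m (-1) h) * (U g * U h) : S.Alg) := by rw [e1]; simp only [mul_assoc]
      _ = _ := by rw [hmm, map_mul, smul_mul_assoc]; rfl
  refine ⟨((S.isMatrix_obs (Set.finite_singleton _)).map _).hasTrivialCenter,
    fun g => D (-1) * (m (-1) g * U g) * star (D (-1)), μ, fun g => ⟨⟨m (-1) g * U g,
      mul_mem (hmmem (-1) g) (hU g).1, rfl⟩, ?_⟩, fun g h => ?_, hμ⟩
  · rintro _ ⟨a, ha, rfl⟩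
    refine (hmβ g a ha).trans ?_
    change _ = (D (-1) * (m (-1) g * U g) * star (D (-1) : S.Alg)) *
      (D (-1) * a * star (D (-1) : S.Alg)) *
      star (D (-1) * (m (-1) g * U g) * star (D (-1) : S.Alg))
    rw [star_mul (D (-1) * (m (-1) g * U g) : S.Alg), star_star, star_mul (D (-1) : S.Alg)]
    simp only [mul_assoc, star_mul_self_cancel]
  · change (D (-1) * (m (-1) g * U g) * star (D (-1) : S.Alg)) *
      (D (-1) * (m (-1) h * U h) * star (D (-1) : S.Alg)) =
      (μ g h : ℂ) • (D (-1) * (m (-1) (g * h) * U (g * h)) * star (D (-1) : S.Alg))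
    rw [← smul_mul_assoc, ← mul_smul_comm, ← hmU]
    simp only [mul_assoc, star_mul_self_cancel]

end CommutingGates

variable [Fintype G] [DecidableEq G]

namespace TranslationFrame

variable (Fr : TranslationFrame β)

theorem f_mem_commutant (j : ℤ) (h : G) : Fr.f j h ∈ Fr.commutant := by
  intro i k
  by_cases hij : j = i
  · subst hij
    rw [Fr.mul_eq, Fr.mul_eq]
    by_cases hk : h = k
    · rw [hk]
    · rw [if_neg hk, if_neg (Ne.symm hk)]
  · exact S.obs_commute (Set.disjoint_singleton.2 hij) (Fr.mem j h) (Fr.mem i k)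

/-- The joint projections of the sites `j` and `j + 1`. -/
theorem isPartition_pair (j : ℤ) :
    IsPartition fun p : G × G => Fr.f j p.1 * Fr.f (j + 1) p.2 where
  star_eq p := by
    rw [star_mul, Fr.star_eq, Fr.star_eq, Fr.f_mem_commutant (j + 1) p.2 j p.1]
  mul_eq p q := by
    have h1 := Fr.f_mem_commutant (j + 1) p.2 j q.1
    calc _ = Fr.f j p.1 * (Fr.f (j + 1) p.2 * Fr.f j q.1) * Fr.f (j + 1) q.2 := by
          simp only [mul_assoc]
      _ = (Fr.f j p.1 * Fr.f j q.1) * (Fr.f (j + 1) p.2 * Fr.f (j + 1) q.2) := by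
          rw [h1]; simp only [mul_assoc]
      _ = _ := by
          rw [Fr.mul_eq, Fr.mul_eq]
          by_cases h1 : p.1 = q.1 <;> by_cases h2 : p.2 = q.2 <;> simp [h1, h2, Prod.ext_iff]
  sum_eq := by
    rw [Fintype.sum_prod_type]
    simp only [← Finset.mul_sum, Fr.sum_eq, mul_one]

/-- The operators on the sites `j` and `j + 1` of multiplication by functions on `G × G`. -/
def diagPair (j : ℤ) : (G × G → Circle) →* unitary S.Alg := (Fr.isPartition_pair j).diag

theorem coe_diag (j : ℤ) (φ : G → Circle) :
    (Fr.diag j φ : S.Alg) = ∑ a, (φ a : ℂ) • Fr.f j a := rfl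

theorem coe_diagPair (j : ℤ) (φ : G × G → Circle) :
    (Fr.diagPair j φ : S.Alg) = ∑ p : G × G, (φ p : ℂ) • (Fr.f j p.1 * Fr.f (j + 1) p.2) := rfl

theorem diagPair_fst (j : ℤ) (φ : G → Circle) :
    Fr.diagPair j (fun p => φ p.1) = Fr.diag j φ := by
  apply Subtype.ext
  rw [coe_diagPair, coe_diag, Fintype.sum_prod_type]
  simp only [← Finset.smul_sum, ← Finset.mul_sum, Fr.sum_eq, mul_one]

theorem diagPair_snd (j : ℤ) (φ : G → Circle) :
    Fr.diagPair j (fun p => φ p.2) = Fr.diag (j + 1) φ := by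
  apply Subtype.ext
  rw [coe_diagPair, coe_diag, Fintype.sum_prod_type, Finset.sum_comm]
  simp only [← Finset.smul_sum, ← Finset.sum_mul, Fr.sum_eq, one_mul]

theorem diagPair_mem (j : ℤ) (φ : G × G → Circle) {X : Set ℤ} (h : j ∈ X) (h' : j + 1 ∈ X) :
    (Fr.diagPair j φ : S.Alg) ∈ S.obs X :=
  sum_mem fun _ _ => SMulMemClass.smul_mem _
    (mul_mem (S.obs_site_le h (Fr.mem _ _)) (S.obs_site_le h' (Fr.mem _ _)))

theorem diagPair_mem_commutant (j : ℤ) (φ : G × G → Circle) :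
    (Fr.diagPair j φ : S.Alg) ∈ Fr.commutant :=
  sum_mem fun _ _ => SMulMemClass.smul_mem _
    (mul_mem (Fr.f_mem_commutant _ _) (Fr.f_mem_commutant _ _))

theorem diag_mem_commutant (j : ℤ) (φ : G → Circle) : (Fr.diag j φ : S.Alg) ∈ Fr.commutant :=
  sum_mem fun _ _ => SMulMemClass.smul_mem _ (Fr.f_mem_commutant _ _)

theorem commute_diagPair {b : S.Alg} (hb : b ∈ Fr.commutant) (j : ℤ) (φ : G × G → Circle) :
    b * Fr.diagPair j φ = Fr.diagPair j φ * b := by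
  rw [coe_diagPair, Finset.sum_mul, Finset.mul_sum]
  refine Finset.sum_congr rfl fun p _ => ?_
  rw [mul_smul_comm, smul_mul_assoc, ← mul_assoc, hb, mul_assoc, hb, mul_assoc]

theorem apply_diagPair (g : G) (j : ℤ) (φ : G × G → Circle) :
    β g (Fr.diagPair j φ) = Fr.diagPair j fun p => φ (g⁻¹ * p.1, g⁻¹ * p.2) := by
  let e : G × G ≃ G × G := (Equiv.mulLeft g).prodCongr (Equiv.mulLeft g)
  rw [coe_diagPair, coe_diagPair, map_sum]
  refine Eq.trans ?_ (e.sum_comp _)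
  refine Finset.sum_congr rfl fun p _ => ?_
  rw [map_smul, map_mul, Fr.apply_eq, Fr.apply_eq]
  change _ = (φ (g⁻¹ * (g * p.1), g⁻¹ * (g * p.2)) : ℂ) •
    (Fr.f j (g * p.1) * Fr.f (j + 1) (g * p.2))
  rw [inv_mul_cancel_left, inv_mul_cancel_left]

end TranslationFrame

/-- A layer of diagonal gates fixes the diagonal operators. -/
theorem apply_diagPair_of_layer (Fr : TranslationFrame β) {L : S.Layer} {γ : S.Aut}
    (hγ : L.Implements γ) (hL : ∀ a, (L.gate a : S.Alg) ∈ Fr.commutant) (j : ℤ)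
    (φ : G × G → Circle) : γ (Fr.diagPair j φ) = Fr.diagPair j φ := by
  have h1 : ∀ j h, γ (Fr.f j h) = Fr.f j h := fun j h => by
    rw [hγ.site (Fr.mem j h), hL _ j h, mul_star_self_cancel_right]
  rw [TranslationFrame.coe_diagPair, map_sum]
  exact Finset.sum_congr rfl fun p _ => by rw [map_smul, map_mul, h1, h1]

/-- The product of the commuting gates `D_j`, one for each pair of neighbouring sites, is a circuit
of depth two. -/
theorem TranslationFrame.exists_diagonal_circuit (Fr : TranslationFrame β) (φ : G × G → Circle)
    {D : ℤ → unitary S.Alg} (hD : D = fun j => Fr.diagPair j φ) :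
    ∃ α : S.Aut, S.IsFDQC α ∧ ∀ j, ∀ x ∈ S.obs {j},
      α x = (D (j - 1) * D j : S.Alg) * x * star (D (j - 1) * D j : S.Alg) := by
  have hDmem : ∀ j {X : Set ℤ}, j ∈ X → j + 1 ∈ X → (D j : S.Alg) ∈ S.obs X := fun j X h h' => by
    rw [hD]; exact Fr.diagPair_mem j _ h h'
  have hDc : ∀ j, (D j : S.Alg) ∈ Fr.commutant := fun j => by
    rw [hD]; exact Fr.diagPair_mem_commutant j _
  have hDb : ∀ j {b : S.Alg}, b ∈ Fr.commutant → b * D j = D j * b := fun j b hb => by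
    rw [hD]; exact Fr.commute_diagPair hb j _
  obtain ⟨L₁, hL₁⟩ : ∃ L : S.Layer, L = S.blockLayer two_pos 0 (fun k => D (2 * k + 0))
      (fun k => hDmem _ (Set.mem_Icc.2 ⟨by linarith, by linarith⟩)
        (Set.mem_Icc.2 ⟨by linarith, by linarith⟩)) := ⟨_, rfl⟩
  obtain ⟨L₂, hL₂⟩ : ∃ L : S.Layer, L = S.blockLayer two_pos (-1) (fun k => D (2 * k + -1))
      (fun k => hDmem _ (Set.mem_Icc.2 ⟨by linarith, by linarith⟩)
        (Set.mem_Icc.2 ⟨by linarith, by linarith⟩)) := ⟨_, rfl⟩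
  obtain ⟨l₁, hl₁⟩ := L₁.exists_implements
  obtain ⟨l₂, hl₂⟩ := L₂.exists_implements
  have hL₂D : ∀ j, l₂ (D j) = D j := fun j => by
    rw [hD]
    exact apply_diagPair_of_layer Fr hl₂ (fun a => by rw [hL₂]; exact hDc _) j _
  rw [hL₁] at hl₁
  rw [hL₂] at hl₂
  refine ⟨l₂ * l₁, isCircuitIn_top_iff.1 ((IsCircuitIn.of_layer hl₂ fun _ =>
    StarSubalgebra.mem_top).mul (.of_layer hl₁ fun _ => StarSubalgebra.mem_top)), fun j x hx => ?_⟩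
  have hc := hDb j (hDc (j - 1))
  change l₂ (l₁ x) = _
  rcases Int.even_or_odd' j with ⟨k, hk | hk⟩
  · have h1 : l₁ x = D j * x * star (D j : S.Alg) := by
      rw [blockLayer_apply hl₁ k hx (by linarith) (by linarith)]
      rw [show 2 * k + 0 = j by linarith]
    have h2 : l₂ x = D (j - 1) * x * star (D (j - 1) : S.Alg) := by
      rw [blockLayer_apply hl₂ k hx (by linarith) (by linarith)]
      rw [show 2 * k + -1 = j - 1 by linarith]
    rw [h1, map_mul, map_mul, map_star, hL₂D, h2, hc, star_mul]
    simp only [mul_assoc]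
  · have h1 : l₁ x = D (j - 1) * x * star (D (j - 1) : S.Alg) := by
      rw [blockLayer_apply hl₁ k hx (by linarith) (by linarith)]
      rw [show 2 * k + 0 = j - 1 by linarith]
    have h2 : l₂ x = D j * x * star (D j : S.Alg) := by
      rw [blockLayer_apply hl₂ (k + 1) hx (by linarith) (by linarith)]
      rw [show 2 * (k + 1) + -1 = j by linarith]
    rw [h1, map_mul, map_mul, map_star, hL₂D, h2, star_mul]
    simp only [mul_assoc]

/-- On a chain with a translation frame every cohomology class is the index of a circuit. For a
cocycle `μ`, the circuit is the product of the commuting gates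
`D_j = ∑ μ(a, a⁻¹b) f_j(a) f_{j+1}(b)`. The cocycle identity says that the symmetry multiplies `D_j`
by `m_j(g) m_{j+1}(g)*` with `m_j(g) = ∑ μ(g, g⁻¹a) f_j(a)`; these factors cancel in the circuit but
not in a gate, and at a cut they turn the representation on the last site into one with cocycle
`μ`. -/
theorem TranslationFrame.exists_circuit (hβ : S.IsOnSite β) (Fr : TranslationFrame β)
    (κ : H2U1 G) :
    ∃ α : S.Aut, S.IsFDQC α ∧ (∀ g, α * β g = β g * α) ∧ HasIndexClass β α κ := by
  obtain ⟨μ, hμ⟩ := IsClass.exists_cocycle κ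
  obtain ⟨D, hD⟩ : ∃ D : ℤ → unitary S.Alg, D = fun j =>
    Fr.diagPair j fun p => μ p.1 (p.1⁻¹ * p.2) := ⟨_, rfl⟩
  obtain ⟨m, hm⟩ : ∃ m : ℤ → G → unitary S.Alg, m = fun j g =>
    Fr.diag j fun a => μ g (g⁻¹ * a) := ⟨_, rfl⟩
  have hDmem : ∀ j {X : Set ℤ}, j ∈ X → j + 1 ∈ X → (D j : S.Alg) ∈ S.obs X := fun j X h h' => by
    rw [hD]; exact Fr.diagPair_mem j _ h h'
  have hDc : ∀ j, (D j : S.Alg) ∈ Fr.commutant := fun j => by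
    rw [hD]; exact Fr.diagPair_mem_commutant j _
  have hDb : ∀ j {b : S.Alg}, b ∈ Fr.commutant → b * D j = D j * b := fun j b hb => by
    rw [hD]; exact Fr.commute_diagPair hb j _
  have hmmem : ∀ j g, (m j g : S.Alg) ∈ S.obs {j} := fun j g => by rw [hm]; exact Fr.diag_mem j _
  have hDD : ∀ i j, (D i : S.Alg) * D j = D j * D i := fun i j => hDb j (hDc i)
  have hmc : ∀ j g, (m j g : S.Alg) ∈ Fr.commutant := fun j g => by
    rw [hm]; exact Fr.diag_mem_commutant j _
  have hβD : ∀ g j, β g (D j) = D j * (m j g * star (m (j + 1) g : S.Alg)) := by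
    intro g j
    have h1 : β g (D j) * m (j + 1) g = D j * m j g := by
      rw [hD, hm]
      change β g (Fr.diagPair j _) * Fr.diag (j + 1) _ = Fr.diagPair j _ * Fr.diag j _
      rw [Fr.apply_diagPair, ← Fr.diagPair_snd j, ← Fr.diagPair_fst j]
      refine congrArg Subtype.val ((map_mul (Fr.diagPair j) _ _).symm.trans
        (Eq.trans (congrArg _ ?_) (map_mul (Fr.diagPair j) _ _)))
      funext p
      have := hμ.cocycle g (g⁻¹ * p.1) (p.1⁻¹ * p.2)
      simp only [mul_inv_cancel_left, mul_assoc] at this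
      simpa only [Pi.mul_apply, mul_inv_rev, inv_inv, mul_assoc, mul_inv_cancel_left] using this.symm
    rw [← mul_assoc, ← h1, mul_star_self_cancel_right]
  have hmm : ∀ j g h, (m j g * β g (m j h) : S.Alg) = (μ g h : ℂ) • (m j (g * h) : S.Alg) := by
    intro j g h
    have e3 : (fun a => μ g (g⁻¹ * a)) * (fun a => μ h (h⁻¹ * (g⁻¹ * a))) =
        fun a => μ g h * μ (g * h) ((g * h)⁻¹ * a) := by
      funext a
      have := hμ.cocycle g h (h⁻¹ * (g⁻¹ * a))
      rw [mul_inv_cancel_left] at this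
      change μ g (g⁻¹ * a) * μ h (h⁻¹ * (g⁻¹ * a)) = _
      rw [mul_comm, ← this, mul_comm, mul_inv_rev, mul_assoc h⁻¹]
    have e4 : (m j g * β g (m j h) : S.Alg) =
        Fr.diag j (fun a => μ g h * μ (g * h) ((g * h)⁻¹ * a)) := by
      rw [hm]
      change (Fr.diag j _ : S.Alg) * β g (Fr.diag j _) = _
      rw [Fr.apply_diag, ← e3]
      exact congrArg Subtype.val (map_mul (Fr.diag j) _ _).symm
    rw [e4, hm]
    change _ = (μ g h : ℂ) • (Fr.diag j _ : S.Alg)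
    rw [Fr.coe_diag, Fr.coe_diag, Finset.smul_sum]
    exact Finset.sum_congr rfl fun a _ => by rw [smul_smul, Circle.coe_mul]
  obtain ⟨α, hF, hα⟩ := Fr.exists_diagonal_circuit (fun p => μ p.1 (p.1⁻¹ * p.2)) hD
  have hαβ := comm_symmetry_of_factors hβ hα hmmem (fun i j g => hDb j (hmc i g)) hβD
  refine ⟨α, hF, hαβ, HasIndexClass.of_cut hβ hαβ (x := 0) (hasRange_one_of_gates hDmem hα) ?_⟩
  have hD1 : (D (-1) : S.Alg) ∈ S.obs (Set.Ici (0 - ((1 : ℕ) : ℤ))) :=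
    hDmem _ (by simp) (by simp)
  have hset : Set.Ico (0 - ((1 : ℕ) : ℤ)) 0 = {-1} := by
    ext i; simp only [Set.mem_Ico, Set.mem_singleton_iff]; push_cast; omega
  rw [boundary_eq_map hD1 (preserves_of_gates hDmem hDD hα), hset]
  exact hasClass_of_twist hβ hmmem hβD hμ hmm

end SpinChain

/-! ### Stacked circuits and the exchange of factors -/

namespace SpinChain

variable {S T : SpinChain} {G : Type} [Group G]

theorem IsCircuitIn.tensor {B : StarSubalgebra ℂ S.Alg} {B' : StarSubalgebra ℂ T.Alg}
    {K : StarSubalgebra ℂ (S.stack T).Alg} {α : S.Aut} {α' : T.Aut} (h : S.IsCircuitIn B α)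
    (h' : T.IsCircuitIn B' α') (hB : ∀ b ∈ B, S.inl T b ∈ K) (hB' : ∀ b ∈ B', S.inr T b ∈ K) :
    (S.stack T).IsCircuitIn K (S.tensorAut T α α') := by
  have e1 : (S.stack T).IsCircuitIn K (S.tensorAut T α 1) := by
    refine h.induction (p := fun α => (S.stack T).IsCircuitIn K (S.tensorAut T α 1))
      (by rw [tensorAut_one]; exact one) fun L δ γ hL hLB ih => ?_
    rw [← one_mul (1 : T.Aut), tensorAut_mul]
    refine (of_layer (L := { L with
      gate := fun a => tensorU (L.gate a) (1 : unitary T.Alg)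
      gate_mem := fun a => mul_mem (S.inl_mem_obs T (L.gate_mem a))
        (S.inr_mem_obs T (one_mem _)) })
      (fun a => S.tensorAut_conj T (L.gate a) 1 (hL a) (fun x _ => by simp)) fun a => ?_).mul ih
    change S.inl T (L.gate a) * S.inr T (1 : T.Alg) ∈ K
    rw [map_one, mul_one]
    exact hB _ (hLB a)
  have e2 : (S.stack T).IsCircuitIn K (S.tensorAut T 1 α') := by
    refine h'.induction (p := fun α' => (S.stack T).IsCircuitIn K (S.tensorAut T 1 α'))
      (by rw [tensorAut_one]; exact one) fun L δ γ hL hLB ih => ?_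
    rw [← one_mul (1 : S.Aut), tensorAut_mul]
    refine (of_layer (L := { L with
      gate := fun a => tensorU (1 : unitary S.Alg) (L.gate a)
      gate_mem := fun a => mul_mem (S.inl_mem_obs T (one_mem _))
        (S.inr_mem_obs T (L.gate_mem a)) })
      (fun a => S.tensorAut_conj T 1 (L.gate a) (fun x _ => by simp) (hL a)) fun a => ?_).mul ih
    change S.inl T (1 : S.Alg) * S.inr T (L.gate a) ∈ K
    rw [map_one, one_mul]
    exact hB' _ (hLB a)
  have := e1.mul e2
  rwa [← tensorAut_mul, mul_one, one_mul] at this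

theorem tensorAut_comm {β : G →* S.Aut} {β' : G →* T.Aut} {α : S.Aut} {α' : T.Aut}
    (h : ∀ g, α * β g = β g * α) (h' : ∀ g, α' * β' g = β' g * α') (g : G) :
    S.tensorAut T α α' * S.tensorSymmetry T β β' g =
      S.tensorSymmetry T β β' g * S.tensorAut T α α' := by
  change _ * S.tensorAut T (β g) (β' g) = S.tensorAut T (β g) (β' g) * _
  rw [← tensorAut_mul, ← tensorAut_mul, h, h']

section Frame

variable [Fintype G] [DecidableEq G] {β : G →* S.Aut} {β' : G →* T.Aut}

/-- A translation frame of the second chain is one of the stacked chain. -/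
def TranslationFrame.stack (Fr : TranslationFrame β') (β : G →* S.Aut) :
    TranslationFrame (S.tensorSymmetry T β β') where
  f j h := S.inr T (Fr.f j h)
  mem j h := S.inr_mem_obs T (Fr.mem j h)
  star_eq j h := by rw [← map_star, Fr.star_eq]
  mul_eq j h k := by rw [← map_mul, Fr.mul_eq, apply_ite (S.inr T), map_zero]
  sum_eq j := by rw [← map_sum, Fr.sum_eq, map_one]
  apply_eq j g h := (S.tensorAut_inr T (β g) (β' g) _).trans (by rw [Fr.apply_eq])

theorem TranslationFrame.inl_mem_commutant (Fr : TranslationFrame β') (a : S.Alg) :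
    S.inl T a ∈ (Fr.stack β).commutant := fun _ _ => (S.inl_commute_inr T _ _).eq

theorem TranslationFrame.inr_mem_commutant (Fr : TranslationFrame β') {b : T.Alg}
    (hb : b ∈ Fr.commutant) : S.inr T b ∈ (Fr.stack β).commutant := fun j h => by
  change S.inr T b * S.inr T (Fr.f j h) = S.inr T (Fr.f j h) * S.inr T b
  rw [← map_mul, ← map_mul, hb j h]

end Frame

/-- The exchange of two factors, as a homomorphism which respects supports. -/
theorem exists_swapHom (A B C : SpinChain) :
    ∃ θ : (A.stack (B.stack C)).Alg →⋆ₐ[ℂ] (B.stack (A.stack C)).Alg,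
      (∀ a, θ (A.inl _ a) = B.inr _ (A.inl C a)) ∧
      (∀ b, θ (A.inr _ (B.inl C b)) = B.inl _ b) ∧
      (∀ c, θ (A.inr _ (B.inr C c)) = B.inr _ (A.inr C c)) ∧
      ∀ (X : Set ℤ) (x), x ∈ (A.stack (B.stack C)).obs X → θ x ∈ (B.stack (A.stack C)).obs X := by
  obtain ⟨θ₁, hb, hc⟩ := B.exists_lift C (B.inl (A.stack C)) ((B.inr (A.stack C)).comp (A.inr C))
    fun b c => B.inl_commute_inr _ _ _
  have hcomm : ∀ a x, Commute (((B.inr (A.stack C)).comp (A.inl C)) a) (θ₁ x) := by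
    intro a x
    have h := stack_map_mem θ₁ (X := Set.univ) (K := StarSubalgebra.centralizer ℂ
      (((B.inr (A.stack C)).comp (A.inl C)).range : Set _))
      (by
        have : (StarSubalgebra.centralizer ℂ
            (((B.inr (A.stack C)).comp (A.inl C)).range : Set (B.stack (A.stack C)).Alg) : Set _) =
            ⋂ y ∈ ((B.inr (A.stack C)).comp (A.inl C)).range,
              {z | y * z = z * y} := by
          ext z
          simp only [SetLike.mem_coe, Set.mem_iInter, Set.mem_ofPred_eq]
          exact ⟨fun h y hy => comm_of_mem_centralizer h hy, fun h => mem_centralizer_of_comm h⟩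
        rw [this]
        exact isClosed_biInter fun y _ => isClosed_eq (by fun_prop) (by fun_prop))
      (fun b _ => mem_centralizer_of_comm (by
        rintro _ ⟨a, rfl⟩
        rw [hb]
        exact (B.inl_commute_inr (A.stack C) b (A.inl C a)).eq.symm))
      (fun c _ => mem_centralizer_of_comm (by
        rintro _ ⟨a, rfl⟩
        rw [hc]
        change B.inr (A.stack C) (A.inl C a) * B.inr (A.stack C) (A.inr C c) =
          B.inr (A.stack C) (A.inr C c) * B.inr (A.stack C) (A.inl C a)
        rw [← map_mul, ← map_mul, (A.inl_commute_inr C a c).eq]))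
      (a := x) (by rw [obs_univ]; exact StarSubalgebra.mem_top)
    exact comm_of_mem_centralizer h ⟨a, rfl⟩
  obtain ⟨θ, hθl, hθr⟩ := A.exists_lift (B.stack C) _ θ₁ hcomm
  refine ⟨θ, hθl, fun b => (hθr _).trans (hb b), fun c => (hθr _).trans (hc c), fun X x hx => ?_⟩
  refine stack_map_mem θ (isClosed_obs _ X) (fun a ha => ?_) (fun y hy => ?_) hx
  · rw [hθl]; exact B.inr_mem_obs _ (A.inl_mem_obs C ha)
  · rw [hθr]
    refine stack_map_mem θ₁ (isClosed_obs _ X) (fun b hb' => ?_) (fun c hc' => ?_) hy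
    · rw [hb]; exact B.inl_mem_obs _ hb'
    · rw [hc]; exact B.inr_mem_obs _ (A.inr_mem_obs C hc')

theorem hom_ext₃ (A B C : SpinChain) {D : Type*} [CStarAlgebra D]
    {f g : (A.stack (B.stack C)).Alg →⋆ₐ[ℂ] D} (h₁ : ∀ a, f (A.inl _ a) = g (A.inl _ a))
    (h₂ : ∀ b, f (A.inr _ (B.inl C b)) = g (A.inr _ (B.inl C b)))
    (h₃ : ∀ c, f (A.inr _ (B.inr C c)) = g (A.inr _ (B.inr C c))) : f = g := by
  refine A.hom_ext (B.stack C) h₁ fun y => ?_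
  exact DFunLike.congr_fun (B.hom_ext C (f := f.comp (A.inr (B.stack C)))
    (g := g.comp (A.inr (B.stack C))) h₂ h₃) y

/-- The exchange of the factors `A` and `B` of `A ⊗ (B ⊗ C)`. -/
theorem exists_swap (A B C : SpinChain) :
    ∃ Φ : (A.stack (B.stack C)).Alg ≃⋆ₐ[ℂ] (B.stack (A.stack C)).Alg,
      (∀ j x, x ∈ (A.stack (B.stack C)).obs {j} ↔ Φ x ∈ (B.stack (A.stack C)).obs {j}) ∧
      ∀ (α : A.Aut) (β : B.Aut) (γ : C.Aut) x,
        Φ (A.tensorAut (B.stack C) α (B.tensorAut C β γ) x) =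
          B.tensorAut (A.stack C) β (A.tensorAut C α γ) (Φ x) := by
  obtain ⟨θ, h1, h2, h3, h4⟩ := exists_swapHom A B C
  obtain ⟨θ', h1', h2', h3', h4'⟩ := exists_swapHom B A C
  have e1 : θ'.comp θ = StarAlgHom.id ℂ _ := hom_ext₃ A B C
    (fun a => (congrArg θ' (h1 a)).trans (h2' a)) (fun b => (congrArg θ' (h2 b)).trans (h1' b))
    (fun c => (congrArg θ' (h3 c)).trans (h3' c))
  have e2 : θ.comp θ' = StarAlgHom.id ℂ _ := hom_ext₃ B A C
    (fun a => (congrArg θ (h1' a)).trans (h2 a)) (fun b => (congrArg θ (h2' b)).trans (h1 b))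
    (fun c => (congrArg θ (h3' c)).trans (h3 c))
  refine ⟨StarAlgEquiv.ofStarAlgHom θ θ' e1 e2, fun j x => ⟨h4 _ x, fun hx => ?_⟩,
    fun α β γ x => ?_⟩
  · have := h4' _ _ hx
    rwa [show θ' (StarAlgEquiv.ofStarAlgHom θ θ' e1 e2 x) = x from DFunLike.congr_fun e1 x] at this
  · refine DFunLike.congr_fun (hom_ext₃ A B C
      (f := θ.comp (A.tensorAut (B.stack C) α (B.tensorAut C β γ) : _ →⋆ₐ[ℂ] _))
      (g := (B.tensorAut (A.stack C) β (A.tensorAut C α γ) : _ →⋆ₐ[ℂ] _).comp θ) ?_ ?_ ?_) x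
    · intro a
      change θ (A.tensorAut _ _ _ (A.inl _ a)) = B.tensorAut _ _ _ (θ (A.inl _ a))
      rw [tensorAut_inl, h1, h1, tensorAut_inr, tensorAut_inl]
    · intro b
      change θ (A.tensorAut _ _ _ (A.inr _ (B.inl C b))) =
        B.tensorAut _ _ _ (θ (A.inr _ (B.inl C b)))
      rw [tensorAut_inr, tensorAut_inl, h2, h2, tensorAut_inl]
    · intro c
      change θ (A.tensorAut _ _ _ (A.inr _ (B.inr C c))) =
        B.tensorAut _ _ _ (θ (A.inr _ (B.inr C c)))
      rw [tensorAut_inr, tensorAut_inr, h3, h3, tensorAut_inr, tensorAut_inr]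

end SpinChain

/-! ### The index isomorphism -/

namespace SymmetricEntangler

open SpinChain

variable {G : Type} [Group G]

theorem exists_index (E : SymmetricEntangler G) : ∃ κ, HasIndexClass E.β E.α κ :=
  exists_hasIndexClass E.onSite E.equivariant E.isFDQC

/-- The index of a symmetric entangler. -/
def index (E : SymmetricEntangler G) : H2U1 G := E.exists_index.choose

theorem hasIndexClass (E : SymmetricEntangler G) : HasIndexClass E.β E.α E.index :=
  E.exists_index.choose_spec

theorem index_eq {E : SymmetricEntangler G} {κ : H2U1 G} (h : HasIndexClass E.β E.α κ) :
    E.index = κ := by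
  obtain ⟨R, hR⟩ := E.isFDQC.exists_range_cut
  exact E.hasIndexClass.unique (hR R le_rfl).1 h

theorem index_stack (E F : SymmetricEntangler G) : (E.stack F).index = E.index + F.index :=
  index_eq (HasIndexClass.stack E.onSite F.onSite E.equivariant F.equivariant E.isFDQC F.isFDQC
    E.hasIndexClass F.hasIndexClass)

theorem index_identity (S : SpinChain) (β : G →* S.Aut) (h : S.IsOnSite β) :
    (identity S β h).index = 0 := index_eq (HasIndexClass.one h)

theorem Equivalent.index_eq {E F : SymmetricEntangler G} (h : E.Equivalent F) :
    E.index = F.index := by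
  obtain ⟨Φ, hΦ, hΦβ, γ, hγ, hΦα⟩ := h
  have hγF : E.chain.IsFDQC γ := by
    obtain ⟨l, hl, h⟩ := hγ
    exact ⟨l, hl, fun δ hδ => (h δ hδ).imp fun _ h => h.1⟩
  have hF : E.chain.IsFDQC (E.α * γ) :=
    isCircuitIn_top_iff.1 ((isCircuitIn_top_iff.2 E.isFDQC).mul (isCircuitIn_top_iff.2 hγF))
  exact (SymmetricEntangler.index_eq (HasIndexClass.congr F.onSite F.equivariant hF F.isFDQC Φ hΦ
    hΦβ hΦα (HasIndexClass.mul_symmetric E.onSite E.equivariant E.isFDQC hγ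
      E.hasIndexClass))).symm

theorem StablyEquivalent.index_eq {E F : SymmetricEntangler G} (h : E.StablyEquivalent F) :
    E.index = F.index := by
  obtain ⟨S, β, hS, T, β', hT, h⟩ := h
  simpa only [index_stack, index_identity, add_zero] using h.index_eq

/-- Entanglers of equal index are stably equivalent: after stacking `E` with the chain of `F` and a
regular chain, `E⁻¹ ⊗ F ⊗ 1` has vanishing index and its gates commute with a translation frame. -/
theorem stablyEquivalent_of_index_eq [Finite G] {E F : SymmetricEntangler G}
    (h : E.index = F.index) : E.StablyEquivalent F := by
  classical
  have := Fintype.ofFinite G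
  obtain ⟨R, βR, hR, ⟨Fr⟩⟩ := exists_translationFrame G
  obtain ⟨Φ, hΦ, hΦα⟩ := exists_swap E.chain F.chain R
  refine ⟨F.chain.stack R, F.chain.tensorSymmetry R F.β βR, F.onSite.stack hR,
    E.chain.stack R, E.chain.tensorSymmetry R E.β βR, E.onSite.stack hR, Φ, hΦ,
    fun g => hΦα (E.β g) (F.β g) (βR g),
    E.chain.tensorAut (F.chain.stack R) E.α⁻¹ (F.chain.tensorAut R F.α 1), ?_, fun x => ?_⟩
  · have h1 : ∀ g, F.chain.tensorAut R F.α 1 * F.chain.tensorSymmetry R F.β βR g =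
        F.chain.tensorSymmetry R F.β βR g * F.chain.tensorAut R F.α 1 :=
      tensorAut_comm F.equivariant fun g => by rw [one_mul, mul_one]
    have h1F : R.IsFDQC 1 := isCircuitIn_top_iff.1 IsCircuitIn.one
    have h2 : HasIndexClass (F.chain.tensorSymmetry R F.β βR) (F.chain.tensorAut R F.α 1)
        (F.index + 0) := HasIndexClass.stack F.onSite hR F.equivariant
      (fun g => by rw [one_mul, mul_one]) F.isFDQC h1F F.hasIndexClass (HasIndexClass.one hR)
    have h3 := HasIndexClass.stack E.onSite (F.onSite.stack hR) (inv_comm E.equivariant) h1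
      E.isFDQC.inv (F.isFDQC.stack h1F)
      (HasIndexClass.inv E.onSite E.equivariant E.isFDQC E.hasIndexClass) h2
    rw [add_zero, h, neg_add_cancel] at h3
    refine isSymmetricFDQC_of_index_zero (E.onSite.stack (F.onSite.stack hR))
      ((Fr.stack F.β).stack E.β) (tensorAut_comm (inv_comm E.equivariant) h1) ?_ h3
    refine (isCircuitIn_top_iff.2 E.isFDQC.inv).tensor
      ((isCircuitIn_top_iff.2 F.isFDQC).tensor IsCircuitIn.one
        (fun b _ => Fr.inl_mem_commutant b) fun b hb => Fr.inr_mem_commutant hb)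
      (fun b _ => TranslationFrame.inl_mem_commutant _ b)
      fun b hb => TranslationFrame.inr_mem_commutant _ hb
  · have e1 : E.chain.tensorAut (F.chain.stack R) E.α 1 *
        E.chain.tensorAut (F.chain.stack R) E.α⁻¹ (F.chain.tensorAut R F.α 1) =
        E.chain.tensorAut (F.chain.stack R) 1 (F.chain.tensorAut R F.α 1) := by
      rw [← tensorAut_mul, mul_inv_cancel, one_mul]
    have e2 := hΦα 1 F.α 1 x
    rw [← e1, tensorAut_one] at e2
    exact e2.symm

theorem exists_index_eq [Finite G] (κ : H2U1 G) : ∃ E : SymmetricEntangler G, E.index = κ := by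
  classical
  have := Fintype.ofFinite G
  obtain ⟨S, β, hβ, ⟨Fr⟩⟩ := exists_translationFrame G
  obtain ⟨α, hF, hα, hκ⟩ := Fr.exists_circuit hβ κ
  exact ⟨⟨S, β, α, hβ, hF, hα⟩, index_eq hκ⟩

variable (G) in
/-- The congruence of having the same index. -/
def indexCon : Con (SymmetricEntangler G) where
  r E F := E.index = F.index
  iseqv := ⟨fun _ => rfl, fun h => h.symm, fun h h' => h.trans h'⟩
  mul' {E E' F F'} h h' := by
    change (E.stack F).index = (E'.stack F').index
    rw [index_stack, index_stack]
    exact congrArg₂ (· + ·) h h'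

variable (G) in
/-- The index as an isomorphism from the classes of symmetric entanglers to group cohomology. -/
def indexEquiv [Finite G] : (indexCon G).Quotient ≃* Multiplicative (H2U1 G) :=
  { Equiv.ofBijective
      (Quotient.lift (fun E : SymmetricEntangler G => Multiplicative.ofAdd E.index)
        fun _ _ h => congrArg Multiplicative.ofAdd h)
      ⟨by
        rintro ⟨E⟩ ⟨F⟩ h
        exact Quotient.sound (Multiplicative.ofAdd.injective h), fun κ => by
        obtain ⟨E, hE⟩ := exists_index_eq (Multiplicative.toAdd κ)
        exact ⟨Quotient.mk _ E, congrArg Multiplicative.ofAdd hE⟩⟩ with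
    map_mul' := by
      rintro ⟨E⟩ ⟨F⟩
      exact congrArg Multiplicative.ofAdd (index_stack E F) }

end SymmetricEntangler

end

theorem lemma3p1 (G : Type) [Group G] [Finite G] :
    ∃ c : Con (SymmetricEntangler G),
      (∀ E F, c E F ↔ E.StablyEquivalent F) ∧
      (∃ grp : Group c.Quotient, grp.toMul = c.hasMul) ∧
      ∃ ind : c.Quotient ≃* Multiplicative (H2U1 G),
        ∀ E : SymmetricEntangler G, E.HasIndex (ind (E : c.Quotient)).toAdd := by
  refine ⟨SymmetricEntangler.indexCon G, fun E F => ⟨SymmetricEntangler.stablyEquivalent_of_index_eq,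
    SymmetricEntangler.StablyEquivalent.index_eq⟩, ?_,
    SymmetricEntangler.indexEquiv G, fun E => E.hasIndex_of_class _ E.hasIndexClass⟩
  let φ := SymmetricEntangler.indexEquiv G
  let _ : One (SymmetricEntangler.indexCon G).Quotient := ⟨φ.symm 1⟩
  let _ : Inv (SymmetricEntangler.indexCon G).Quotient := ⟨fun a => φ.symm (φ a)⁻¹⟩
  refine ⟨Group.ofLeftAxioms (fun a b c => ?_) (fun a => ?_) fun a => ?_, rfl⟩ <;>
    apply φ.injective
  · rw [map_mul, map_mul, map_mul, map_mul, mul_assoc]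
  · rw [map_mul]
    exact (congrArg (· * φ a) (φ.apply_symm_apply 1)).trans (one_mul _)
  · rw [map_mul]
    exact (congrArg (· * φ a) (φ.apply_symm_apply _)).trans
      ((inv_mul_cancel _).trans (φ.apply_symm_apply 1).symm)
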